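/- **Setting.** Let $(\mathcal X,\rho_{\mathcal X})$ be a metric space with its Borel $\sigma$-algebra, $\mathcal A$ a measurable space, and $\rho$ a metric on $\mathcal X\times\mathcal A$ whose Borel sets are measurable and with $\rho[(x,a),(x',a)]\le\rho_{\mathcal X}(x,x')$. Let $N_{\mathcal X}(\varepsilon)$ and $N_{\mathcal X\mathcal A}(\varepsilon)$ be the $\varepsilon$-covering numbers (closed balls) of $(\mathcal X,\rho_{\mathcal X})$ and $(\mathcal X\times\mathcal A,\rho)$; both are assumed to be $O(\varepsilon^{-d})$ as $\varepsilon\to0$ for some $d\ge0$. The covering dimension $d_2$ of $\mathcal X$ is the infimum of the $d\ge 0$ with $N_{\mathcal X}(\varepsilon)=O(\varepsilon^{-d})$. For episodes $k\in[K]$ and steps $h\in[H]$ there are mean rewards $r_h^k:\mathcal X\times\mathcal A\to[0,1]$ and Markov kernels $P_h^k$ from $\mathcal X\times\mathcal A$ to $\mathcal X$ with $|r_h^k(u)-r_h^k(v)|\le L_r\,\rho(u,v)$ and $W_1(P_h^k(\cdot|u),P_h^k(\cdot|v))\le L_p\,\rho(u,v)$ for all $u,v\in\mathcal X\times\mathcal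 A$, where $W_1$ is the 1-Wasserstein distance, $L_r>0$ and $L_p\ge0$. Put $L_Q=\sum_{h=1}^H L_rL_p^{h-1}$. A policy $\pi$ consists of measurable maps $\pi_h:\mathcal X\to\mathcal A$; its value is $V^\pi_{k,H+1}=0$, $V^\pi_{k,h}(x)=r_h^k(x,\pi_h(x))+\int V^\pi_{k,h+1}\,dP_h^k(\cdot|x,\pi_h(x))$, and $V^*_{k,h}(x)=\sup_\pi V^\pi_{k,h}(x)$. A learner observes random $(x_h^k,a_h^k,\tilde r_h^k)_{h\le H}$ and $x_{H+1}^k$, for $k\le K$. The initial states and the actions may be chosen in any non-anticipating way. Given the history $\mathcal F_h^k$ (all observations up to and including $x_h^k,a_h^k$), the reward $\tilde r_h^k\in[0,1]$ has conditional mean $r_h^k(x_h^k,a_h^k)$, and $x_{h+1}^k$ has conditional law $P_h^k(\cdot|x_h^k,a_h^k)$. Let $\sigma,\beta,C_1,C_2>0$, $C_3\ge0$, $\eta\in(0,1)$, $W\in\{1,2,\dots\}$, and let $\Gamma:\mathbb N\times[0,\infty)\to[0,1]$ satisfy $\Gamma(t,z)\le C_1e^{-z^2/2}$, $|\Gamma(t,y)-\Gamma(t,z)|\le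 C_2|y-z|$, and $\Gamma(t,z)\le C_3\eta^t$ for $t\ge W$. Put, for $u\in\mathcal X\times\mathcal A$ and $f:\mathcal X\to\mathbb R$, $$w_h^{k,s}(u)=\Gamma\big(k-s-1,\rho(u,(x_h^s,a_h^s))/\sigma\big),\quad \mathbf C_h^k(u)=\beta+\sum_{s=1}^{k-1}w_h^{k,s}(u),\quad \tilde w_h^{k,s}(u)=\frac{w_h^{k,s}(u)}{\mathbf C_h^k(u)},$$ $$\hat r_h^k(u)=\sum_{s=1}^{k-1}\tilde w_h^{k,s}(u)\tilde r_h^s,\quad \hat P_h^kf(u)=\sum_{s=1}^{k-1}\tilde w_h^{k,s}(u)f(x_{h+1}^s),$$ $$\bar r_h^k(u)=\sum_{s=1}^{k-1}\tilde w_h^{k,s}(u)r_h^s(u)+\frac{\beta\, r_h^k(u)}{\mathbf C_h^k(u)},\quad \bar P_h^kf(u)=\sum_{s=1}^{k-1}\tilde w_h^{k,s}(u)P_h^sf(u)+\frac{\beta\, P_h^kf(u)}{\mathbf C_h^k(u)}.$$ Here $Pf(u)=\int f\,dP(\cdot|u)$. **Widths.** Let $\log^+=\max(0,\log)$ and $\ell_k=1+\sqrt{\log^+(C_1k/\beta)}$,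 and put $$\square_r(k,\delta)=\log\frac{KH\,N_{\mathcal X\mathcal A}(\sigma^2/K)\sqrt{1+k/\beta}}{\delta},\qquad \mathbf b_r(k,\delta)=\frac{C_2}{2\beta^{3/2}}\sqrt{2\square_r(k,\delta)}+\frac{4C_2}{\beta}+2L_r\ell_k,$$ $$\square_p(k,\delta)=\log\frac{KH\,N_{\mathcal X\mathcal A}(\sigma^2/(KH))\sqrt{1+k/\beta}}{\delta},\qquad \mathbf b_p(k,\delta)=\frac{C_2}{2\beta^{3/2}}\sqrt{2\square_p(k,\delta)}+\frac{4C_2}{\beta}+2L_pL_Q\ell_k,$$ $$\square_u(k,\delta)=\log\left(\frac{KH\,N_{\mathcal X\mathcal A}(\sigma^{2+d_2/2}/(KH))\sqrt{1+k/\beta}}{\delta}\Big(\frac{2H}{L_Q\sigma}\Big)^{N_{\mathcal X}(\sigma)}\right),$$ $$\theta^1(k,\delta)=\frac{4C_2}{\beta}+\frac{C_2}{2\beta^{3/2}}\sqrt{8\square_u(k,\delta)},\qquad \theta^2(k)=4L_pL_Q\ell_k+32L_Q,$$ $$\square_3(k,\delta)=\log\left(\frac{4e(2k+1)}{\delta}KH\,N_{\mathcal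 X\mathcal A}\Big(\frac{\sigma^{2+d_2}}{H^2K}\Big)\Big(\frac{2H}{L_Q\sigma}\Big)^{N_{\mathcal X}(\sigma)}\right),$$ $$\theta^3(k,\delta)=\frac{2L_pL_Q\sigma}{H^2K}+\frac{4C_2}{H\beta}+\frac{14\,\square_3(k,\delta)C_2}{\beta^2},\qquad \theta^4(k)=32L_Q+6L_pL_Q\ell_k,$$ $$\mathbf{bias}_p(k,h)=L_Q\sum_{i=\max(1,k-W)}^{k-1}\sup_{u}W_1\big(P_h^i(\cdot|u),P_h^{i+1}(\cdot|u)\big)+\frac{2C_3H}{\beta}\,\frac{\eta^W}{1-\eta}.$$ **Lemma.** Let $\delta>0$ and suppose $L_Q\sigma\le 2H$. Let $\mathcal G=\mathcal G_1\cap\mathcal G_2\cap\mathcal G_3\cap\mathcal G_4$, where $\mathcal G_1,\dots,\mathcal G_4$ are the events that, for all $u\in\mathcal X\times\mathcal A$, $k\in[K]$, $h\in[H]$ (and, for $\mathcal G_3,\mathcal G_4$, all $2L_Q$-Lipschitz $f:\mathcal X\to\mathbb R$ with $|f|\le 2H$), respectively, $$|\hat r_h^k(u)-\bar r_h^k(u)|\le\sqrt{\frac{2\square_r(k,\delta/8)}{\mathbf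 C_h^k(u)}}+\frac{\beta}{\mathbf C_h^k(u)}+\mathbf b_r(k,\delta/8)\sigma,$$ $$|(\hat P_h^k-\bar P_h^k)V^*_{k,h+1}(u)|\le\sqrt{\frac{2H^2\square_p(k,\delta/8)}{\mathbf C_h^k(u)}}+\frac{\beta H}{\mathbf C_h^k(u)}+\mathbf b_p(k,\delta/8)\sigma,$$ $$|(\hat P_h^k-\bar P_h^k)f(u)|\le\sqrt{\frac{8H^2\square_u(k,\delta/8)}{\mathbf C_h^k(u)}}+\frac{2\beta H}{\mathbf C_h^k(u)}+\theta^1(k,\delta/8)\sigma^{1+d_2/2}+\theta^2(k)\sigma,$$ $$|(\hat P_h^k-\bar P_h^k)f(u)|\le\frac1HP_h^k|f|(u)+\frac{14H^2\square_3(k,\delta/8)+2\beta H}{\mathbf C_h^k(u)}+\theta^3(k,\delta/8)\sigma^{1+d_2}+\theta^4(k)\sigma+\frac2H\mathbf{bias}_p(k,h).$$ Then $\mathcal G$ is an event (it is measurable) and $\mathbb P(\mathcal G)\ge1-\delta/2$. (Square roots of negative numbers, which occur only for some $\delta>2$, are read as $0$.) -/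

import Mathlib

open Set Filter Topology MeasureTheory ProbabilityTheory
open scoped NNReal ENNReal

namespace KernelRL

/-! ### Metric notions -/

/-- The `ε`-covering number of a metric space: the least number of closed `ε`-balls, centred in the
space, that cover it. -/
noncomputable def covNum (Z : Type*) [MetricSpace Z] (ε : ℝ) : ℕ :=
  (Metric.coveringNumber ε.toNNReal (Set.univ : Set Z)).toNat

/-- `N(ε) = O(ε^{-d})` for the covering numbers `N(ε)` of `Z` (which are thus finite). -/
def HasCoveringExponent (Z : Type*) [MetricSpace Z] (d : ℝ) : Prop :=
  0 ≤ d ∧ ∃ c : ℝ, ∀ ε : ℝ, 0 < ε → ε ≤ 1 →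
    (Metric.coveringNumber ε.toNNReal (Set.univ : Set Z)).toENNReal ≤ ENNReal.ofReal (c * ε ^ (-d))

/-- The covering dimension: the infimum of the `d ≥ 0` with `N(ε) = O(ε^{-d})`. -/
noncomputable def coveringDim (Z : Type*) [MetricSpace Z] : ℝ :=
  sInf {d : ℝ | HasCoveringExponent Z d}

/-- The 1-Wasserstein distance, as the supremum of `∫ f dμ - ∫ f dν` over the 1-Lipschitz `f`
(used on spaces of finite diameter, where this is a finite supremum). -/
noncomputable def wasserstein {X : Type*} [MetricSpace X] [MeasurableSpace X]
    (μ ν : Measure X) : ℝ :=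
  ⨆ f : {f : X → ℝ // LipschitzWith 1 f}, ((∫ y, f.1 y ∂μ) - ∫ y, f.1 y ∂ν)

/-- The functions that are `L`-Lipschitz and bounded by `B` in absolute value. -/
def boundedLipschitz (X : Type*) [MetricSpace X] (L B : ℝ) : Set (X → ℝ) :=
  {f | (∀ x y, |f x - f y| ≤ L * dist x y) ∧ ∀ x, |f x| ≤ B}

/-! ### The non-stationary Markov decision process -/

/-- Mean rewards `r k h` in `[0,1]` and transition kernels `P k h`, for episode `k` and step `h`. -/
structure MDP (X A : Type*) [MeasurableSpace X] [MeasurableSpace A] where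
  r : ℕ → ℕ → X × A → ℝ
  P : ℕ → ℕ → Kernel (X × A) X
  measurable_r : ∀ k h, Measurable (r k h)
  r_mem : ∀ k h u, r k h u ∈ Set.Icc (0 : ℝ) 1
  markov : ∀ k h, IsMarkovKernel (P k h)

section MDP

variable {X A : Type*} [MeasurableSpace X] [MeasurableSpace A]

/-- Lipschitz rewards, and Lipschitz transitions for the Wasserstein distance, in all steps
`h ∈ [H]` of all episodes `k ∈ [K]`. -/
structure MDP.IsLipschitz [MetricSpace X] [MetricSpace (X × A)] (M : MDP X A) (K H : ℕ)
    (Lr Lp : ℝ) : Prop where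
  reward : ∀ k ∈ Finset.Icc 1 K, ∀ h ∈ Finset.Icc 1 H, ∀ u v : X × A,
    |M.r k h u - M.r k h v| ≤ Lr * dist u v
  transition : ∀ k ∈ Finset.Icc 1 K, ∀ h ∈ Finset.Icc 1 H, ∀ u v : X × A,
    wasserstein (M.P k h u) (M.P k h v) ≤ Lp * dist u v

/-- Expected total reward of the policy `π` in episode `k` when `n` steps are left, that is, from
step `h = H + 1 - n` on. -/
noncomputable def MDP.valueToGo (M : MDP X A) (H k : ℕ) (π : ℕ → X → A) : ℕ → X → ℝ
  | 0 => fun _ => 0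
  | n + 1 => fun x => M.r k (H - n) (x, π (H - n) x)
      + ∫ y, M.valueToGo H k π n y ∂(M.P k (H - n) (x, π (H - n) x))

/-- `V^π_{k,h}`, the value function of the policy `π` from step `h` of episode `k`. -/
noncomputable def MDP.policyValue (M : MDP X A) (H : ℕ) (π : ℕ → X → A) (k h : ℕ) : X → ℝ :=
  M.valueToGo H k π (H + 1 - h)

/-- `V*_{k,h}(x) = sup_π V^π_{k,h}(x)`, over the deterministic (measurable) policies `π`. -/
noncomputable def MDP.optimalValue (M : MDP X A) (H k h : ℕ) (x : X) : ℝ :=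
  ⨆ π : {π : ℕ → X → A // ∀ j, Measurable (π j)}, M.policyValue H π.1 k h x

end MDP

/-- `L_Q = ∑_{h=1}^{H} L_r L_p^{h-1}`, the Lipschitz constant of the optimal value functions. -/
noncomputable def lipQ (H : ℕ) (Lr Lp : ℝ) : ℝ := ∑ i ∈ Finset.range H, Lr * Lp ^ i

/-! ### The data collected by the learner -/

/-- States `x k h`, actions `a k h` and observed rewards `rew k h` at step `h` of episode `k`. -/
structure Trajectory (Ω X A : Type*) where
  x : ℕ → ℕ → Ω → X
  a : ℕ → ℕ → Ω → A
  rew : ℕ → ℕ → Ω → ℝ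

section Trajectory

variable {Ω X A : Type*} [MeasurableSpace X] [MeasurableSpace A]

/-- What is observed in episode `k` before the action of step `h`: states up to step `h`, and
actions and rewards of the earlier steps. -/
abbrev Trajectory.episodeInfo (T : Trajectory Ω X A) (k h : ℕ) : MeasurableSpace Ω :=
  (⨆ j ∈ Finset.Icc 1 h, MeasurableSpace.comap (T.x k j) inferInstance) ⊔
  (⨆ j ∈ Finset.Ico 1 h, MeasurableSpace.comap (T.a k j) inferInstance) ⊔
  (⨆ j ∈ Finset.Ico 1 h, MeasurableSpace.comap (T.rew k j) inferInstance)

/-- The history `F_h^k`: all earlier episodes in full, and episode `k` up to and including the state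
and the action of step `h`. -/
abbrev Trajectory.history (T : Trajectory Ω X A) (H k h : ℕ) : MeasurableSpace Ω :=
  (⨆ s ∈ Finset.Ico 1 k, T.episodeInfo s (H + 1)) ⊔ T.episodeInfo k h ⊔
    MeasurableSpace.comap (T.a k h) inferInstance

/-- `T` is the result of interacting with the process `M` for `K` episodes of `H` steps. The initial
states and the actions may depend on the past in any way. -/
structure Trajectory.IsInteraction [MeasurableSpace Ω] (T : Trajectory Ω X A) (M : MDP X A)
    (K H : ℕ) (μ : Measure Ω) : Prop where
  measurable_x : ∀ k h, Measurable (T.x k h)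
  measurable_a : ∀ k h, Measurable (T.a k h)
  measurable_rew : ∀ k h, Measurable (T.rew k h)
  rew_mem : ∀ k ∈ Finset.Icc 1 K, ∀ h ∈ Finset.Icc 1 H, ∀ᵐ ω ∂μ, T.rew k h ω ∈ Set.Icc (0 : ℝ) 1
  rew_mean : ∀ k ∈ Finset.Icc 1 K, ∀ h ∈ Finset.Icc 1 H,
    μ[T.rew k h | T.history H k h] =ᵐ[μ] fun ω => M.r k h (T.x k h ω, T.a k h ω)
  next_law : ∀ k ∈ Finset.Icc 1 K, ∀ h ∈ Finset.Icc 1 H, ∀ B : Set X, MeasurableSet B →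
    μ[(T.x k (h + 1) ⁻¹' B).indicator (fun _ => (1 : ℝ)) | T.history H k h]
      =ᵐ[μ] fun ω => (M.P k h (T.x k h ω, T.a k h ω)).real B

end Trajectory

/-! ### Kernel, weights and estimators -/

/-- A base kernel `Γ(t, z)`, for `t ∈ ℕ` and `z ≥ 0`, with bandwidth `σ`, regularization `β`, time
parameters `η` and `W`, and constants `C₁`, `C₂`, `C₃`. -/
structure KernelSpec where
  Γ : ℕ → ℝ → ℝ
  σ : ℝ
  β : ℝ
  η : ℝ
  W : ℕ
  C₁ : ℝ
  C₂ : ℝ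
  C₃ : ℝ
  σ_pos : 0 < σ
  β_pos : 0 < β
  η_pos : 0 < η
  η_lt_one : η < 1
  W_pos : 1 ≤ W
  C₁_pos : 0 < C₁
  C₂_pos : 0 < C₂
  C₃_nonneg : 0 ≤ C₃
  Γ_mem : ∀ t z, 0 ≤ z → Γ t z ∈ Set.Icc (0 : ℝ) 1
  Γ_gaussian : ∀ t z, 0 ≤ z → Γ t z ≤ C₁ * Real.exp (-z ^ 2 / 2)
  Γ_lipschitz : ∀ t y z, 0 ≤ y → 0 ≤ z → |Γ t y - Γ t z| ≤ C₂ * |y - z|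
  Γ_forget : ∀ t z, W ≤ t → 0 ≤ z → Γ t z ≤ C₃ * η ^ t

section Estimators

variable {Ω X A : Type*} [MeasurableSpace X] [MeasurableSpace A] [MetricSpace (X × A)]

/-- The weight `w_h^{k,s}(u)` of episode `s < k`, at the state-action pair `u`. -/
noncomputable def weight (κ : KernelSpec) (T : Trajectory Ω X A) (k h s : ℕ) (u : X × A)
    (ω : Ω) : ℝ :=
  κ.Γ (k - s - 1) (dist u (T.x s h ω, T.a s h ω) / κ.σ)

/-- The generalized count `C_h^k(u) = β + ∑_{s<k} w_h^{k,s}(u)`. -/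
noncomputable def count (κ : KernelSpec) (T : Trajectory Ω X A) (k h : ℕ) (u : X × A)
    (ω : Ω) : ℝ :=
  κ.β + ∑ s ∈ Finset.Ico 1 k, weight κ T k h s u ω

/-- The normalized weight `w_h^{k,s}(u) / C_h^k(u)`. -/
noncomputable def normWeight (κ : KernelSpec) (T : Trajectory Ω X A) (k h s : ℕ) (u : X × A)
    (ω : Ω) : ℝ :=
  weight κ T k h s u ω / count κ T k h u ω

/-- The reward estimate. -/
noncomputable def estR (κ : KernelSpec) (T : Trajectory Ω X A) (k h : ℕ) (u : X × A)
    (ω : Ω) : ℝ :=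
  ∑ s ∈ Finset.Ico 1 k, normWeight κ T k h s u ω * T.rew s h ω

/-- The weighted average of the mean rewards of the episodes up to `k`. -/
noncomputable def avR (κ : KernelSpec) (M : MDP X A) (T : Trajectory Ω X A) (k h : ℕ) (u : X × A)
    (ω : Ω) : ℝ :=
  ∑ s ∈ Finset.Ico 1 k, normWeight κ T k h s u ω * M.r s h u
    + κ.β * M.r k h u / count κ T k h u ω

/-- The estimated transition (sub-probability) measure, the sum of point masses with the normalized
weights at the next states, applied to `f`. -/
noncomputable def estP (κ : KernelSpec) (T : Trajectory Ω X A) (k h : ℕ) (f : X → ℝ) (u : X × A)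
    (ω : Ω) : ℝ :=
  ∑ s ∈ Finset.Ico 1 k, normWeight κ T k h s u ω * f (T.x s (h + 1) ω)

/-- The weighted average of the transition kernels of the episodes up to `k`, applied to `f`. -/
noncomputable def avP (κ : KernelSpec) (M : MDP X A) (T : Trajectory Ω X A) (k h : ℕ) (f : X → ℝ)
    (u : X × A) (ω : Ω) : ℝ :=
  ∑ s ∈ Finset.Ico 1 k, normWeight κ T k h s u ω * ∫ y, f y ∂(M.P s h u)
    + κ.β * (∫ y, f y ∂(M.P k h u)) / count κ T k h u ω

end Estimators

/-! ### Confidence widths -/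

section Widths

/-- The factor `1 + √(log⁺ (C₁ k / β))` of the spatial bias. -/
noncomputable def spatialFactor (κ : KernelSpec) (k : ℕ) : ℝ :=
  1 + √(Real.posLog (κ.C₁ * k / κ.β))

/-- `□_r(k, δ)`. -/
noncomputable def logR (X A : Type*) [MetricSpace (X × A)] (κ : KernelSpec) (K H k : ℕ)
    (δ : ℝ) : ℝ :=
  Real.log (K * H * covNum (X × A) (κ.σ ^ 2 / K) * √(1 + k / κ.β) / δ)

/-- `b_r(k, δ)`. -/
noncomputable def bR (X A : Type*) [MetricSpace (X × A)] (κ : KernelSpec) (K H : ℕ) (Lr : ℝ)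
    (k : ℕ) (δ : ℝ) : ℝ :=
  (κ.C₂ / (2 * κ.β ^ (3 / 2 : ℝ)) * √(2 * logR X A κ K H k δ) + 4 * κ.C₂ / κ.β)
    + 2 * Lr * spatialFactor κ k

/-- `□_p(k, δ)`. -/
noncomputable def logP (X A : Type*) [MetricSpace (X × A)] (κ : KernelSpec) (K H k : ℕ)
    (δ : ℝ) : ℝ :=
  Real.log (K * H * covNum (X × A) (κ.σ ^ 2 / (K * H)) * √(1 + k / κ.β) / δ)

/-- `b_p(k, δ)`. -/
noncomputable def bP (X A : Type*) [MetricSpace (X × A)] (κ : KernelSpec) (K H : ℕ) (Lr Lp : ℝ)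
    (k : ℕ) (δ : ℝ) : ℝ :=
  (κ.C₂ / (2 * κ.β ^ (3 / 2 : ℝ)) * √(2 * logP X A κ K H k δ) + 4 * κ.C₂ / κ.β)
    + 2 * Lp * lipQ H Lr Lp * spatialFactor κ k

variable (X A : Type*) [MetricSpace X] [MetricSpace (X × A)]

/-- The uniform logarithmic factor, with the bound `(2H / (L_Q σ))^{N_X(σ)}` for the function
class. -/
noncomputable def logUnif (κ : KernelSpec) (K H : ℕ) (Lr Lp : ℝ) (k : ℕ) (δ : ℝ) : ℝ :=
  Real.log (K * H * covNum (X × A) (κ.σ ^ (2 + coveringDim X / 2) / (K * H))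
      * √(1 + k / κ.β) / δ * (2 * H / (lipQ H Lr Lp * κ.σ)) ^ covNum X κ.σ)

/-- `θ¹(k, δ)`. -/
noncomputable def θ₁ (κ : KernelSpec) (K H : ℕ) (Lr Lp : ℝ) (k : ℕ) (δ : ℝ) : ℝ :=
  4 * κ.C₂ / κ.β
    + κ.C₂ / (2 * κ.β ^ (3 / 2 : ℝ)) * √(8 * logUnif X A κ K H Lr Lp k δ)

/-- `θ²(k, δ)`. -/
noncomputable def θ₂ (κ : KernelSpec) (H : ℕ) (Lr Lp : ℝ) (k : ℕ) : ℝ :=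
  4 * Lp * lipQ H Lr Lp * spatialFactor κ k + 32 * lipQ H Lr Lp

/-- `□₃(k, δ)`. -/
noncomputable def logB (κ : KernelSpec) (K H : ℕ) (Lr Lp : ℝ) (k : ℕ) (δ : ℝ) : ℝ :=
  Real.log (4 * Real.exp 1 * (2 * k + 1) / δ * (K * H)
      * covNum (X × A) (κ.σ ^ (2 + coveringDim X) / (H ^ 2 * K))
      * (2 * H / (lipQ H Lr Lp * κ.σ)) ^ covNum X κ.σ)

/-- `θ³(k, δ)`. -/
noncomputable def θ₃ (κ : KernelSpec) (K H : ℕ) (Lr Lp : ℝ) (k : ℕ) (δ : ℝ) : ℝ :=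
  2 * Lp * lipQ H Lr Lp * κ.σ / (H ^ 2 * K) + 4 * κ.C₂ / (H * κ.β)
    + 14 * logB X A κ K H Lr Lp k δ * κ.C₂ / κ.β ^ 2

/-- `θ⁴(k, δ)`. -/
noncomputable def θ₄ (κ : KernelSpec) (H : ℕ) (Lr Lp : ℝ) (k : ℕ) : ℝ :=
  32 * lipQ H Lr Lp + 6 * Lp * lipQ H Lr Lp * spatialFactor κ k

end Widths

/-- The temporal bias of the transition estimates,
`L_Q ∑_{i = max(1, k-W)}^{k-1} sup_u W₁(P_h^i(u), P_h^{i+1}(u)) + (2 C₃ H / β) η^W / (1 - η)`. -/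
noncomputable def biasP {X A : Type*} [MetricSpace X] [MeasurableSpace X] [MeasurableSpace A]
    (κ : KernelSpec) (M : MDP X A) (H : ℕ) (Lr Lp : ℝ) (k h : ℕ) : ℝ :=
  lipQ H Lr Lp * ∑ i ∈ Finset.Ico (max 1 (k - κ.W)) k,
      (⨆ u : X × A, wasserstein (M.P i h u) (M.P (i + 1) h u))
    + 2 * κ.C₃ * H / κ.β * (κ.η ^ κ.W / (1 - κ.η))

/-! ### The four events, at level `δ`, and the good event -/

section Events

variable {Ω X A : Type*} [MetricSpace X] [MeasurableSpace X] [MeasurableSpace A]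
  [MetricSpace (X × A)]

def eventReward (κ : KernelSpec) (M : MDP X A) (T : Trajectory Ω X A) (K H : ℕ) (Lr δ : ℝ) :
    Set Ω :=
  {ω | ∀ u : X × A, ∀ k ∈ Finset.Icc 1 K, ∀ h ∈ Finset.Icc 1 H,
    |estR κ T k h u ω - avR κ M T k h u ω| ≤
      √(2 * logR X A κ K H k δ / count κ T k h u ω) + κ.β / count κ T k h u ω
        + bR X A κ K H Lr k δ * κ.σ}

def eventOptimalValue (κ : KernelSpec) (M : MDP X A) (T : Trajectory Ω X A) (K H : ℕ)
    (Lr Lp δ : ℝ) : Set Ω :=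
  {ω | ∀ u : X × A, ∀ k ∈ Finset.Icc 1 K, ∀ h ∈ Finset.Icc 1 H,
    |estP κ T k h (M.optimalValue H k (h + 1)) u ω
        - avP κ M T k h (M.optimalValue H k (h + 1)) u ω| ≤
      √(2 * H ^ 2 * logP X A κ K H k δ / count κ T k h u ω) + κ.β * H / count κ T k h u ω
        + bP X A κ K H Lr Lp k δ * κ.σ}

def eventUniform (κ : KernelSpec) (M : MDP X A) (T : Trajectory Ω X A) (K H : ℕ) (Lr Lp δ : ℝ) :
    Set Ω :=
  {ω | ∀ u : X × A, ∀ k ∈ Finset.Icc 1 K, ∀ h ∈ Finset.Icc 1 H,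
    ∀ f ∈ boundedLipschitz X (2 * lipQ H Lr Lp) (2 * H),
    |estP κ T k h f u ω - avP κ M T k h f u ω| ≤
      √(8 * H ^ 2 * logUnif X A κ K H Lr Lp k δ / count κ T k h u ω)
        + 2 * κ.β * H / count κ T k h u ω
        + θ₁ X A κ K H Lr Lp k δ * κ.σ ^ (1 + coveringDim X / 2)
        + θ₂ κ H Lr Lp k * κ.σ}

def eventBernstein (κ : KernelSpec) (M : MDP X A) (T : Trajectory Ω X A) (K H : ℕ) (Lr Lp δ : ℝ) :
    Set Ω :=
  {ω | ∀ u : X × A, ∀ k ∈ Finset.Icc 1 K, ∀ h ∈ Finset.Icc 1 H,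
    ∀ f ∈ boundedLipschitz X (2 * lipQ H Lr Lp) (2 * H),
    |estP κ T k h f u ω - avP κ M T k h f u ω| ≤
      1 / H * (∫ y, |f y| ∂(M.P k h u))
        + (14 * H ^ 2 * logB X A κ K H Lr Lp k δ + 2 * κ.β * H) / count κ T k h u ω
        + θ₃ X A κ K H Lr Lp k δ * κ.σ ^ (1 + coveringDim X)
        + θ₄ κ H Lr Lp k * κ.σ
        + 2 / H * biasP κ M H Lr Lp k h}

/-- The good event: each of the four events at level `δ / 8`. -/
def goodEvent (κ : KernelSpec) (M : MDP X A) (T : Trajectory Ω X A) (K H : ℕ) (Lr Lp δ : ℝ) :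
    Set Ω :=
  eventReward κ M T K H Lr (δ / 8) ∩ eventOptimalValue κ M T K H Lr Lp (δ / 8) ∩
    eventUniform κ M T K H Lr Lp (δ / 8) ∩ eventBernstein κ M T K H Lr Lp (δ / 8)

end Events

end KernelRL

/-! Fix an episode k, a step h, a pair u and a test function. The error of a kernel estimate splits
exactly into noise (observations minus their conditional means at the visited pairs), spatial bias
(means at the visited pairs against means at u) and regularization bias; see
`abs_estimate_sub_average_le`. The Gaussian decay of Γ keeps the weighted mean distance from u to
the data at order σℓ_k (`sum_weight_mul_dist_le`), and the Lipschitz assumptions turn this into the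
spatial terms of the widths.

For a fixed pair and a deterministic function, the weight of episode s is determined by F_h^s, so
the noise is a sum of martingale differences over s. Products of factors exp(t w (Z - m) - penalty)
then have mean at most one (`integral_prod_le_one`). Mixing over t with a Gaussian of precision βB²
yields the self-normalized bound `IsWeightedNoise.hoeffding`, the source of √(1 + k/β). The single
value t = 1/(4H²), with the conditional variance in the penalty, yields `IsWeightedNoise.bernstein`.

Uniformity comes from union bounds over k, h and a net of X × A, and, in the last two events, a net
of at most (2H/(L_Q σ))^{N_X(σ)} Lipschitz functions. Weights are Lipschitz in u and the count is at
least β, so passing from a net point to u costs only the C₂ terms. The second event tests one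
deterministic function per (k, h). That V* is L_Q-Lipschitz and bounded by H follows from
identifying it with the Bellman recursion, through measurable near-optimal policies
(`MDP.IsLipschitz.optimalValue_eq`).

In the fourth event the variance is at most ∫ f² ≤ 2H ∫ |f|. Spatial and temporal biases move this
integral from the past kernels at the visited pairs to P_h^k at u, and the factor t reduces it to a
multiple 1/(2H) of P|f| plus biases.

Every event is a family of inequalities between quantities continuous in u and in f (for uniform
distance), so countable dense sets give measurability. Each event fails with probability at most
δ/8. -/

set_option linter.unusedSectionVars false

namespace KernelRL

/-! ### Exponential moments of bounded variables -/

section Concentration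

variable {Ω : Type*} [mΩ : MeasurableSpace Ω] {μ : Measure Ω}

lemma integrable_of_measurable_of_ae_bound [IsFiniteMeasure μ] {f : Ω → ℝ} (hf : Measurable f)
    {B : ℝ} (hB : ∀ᵐ ω ∂μ, |f ω| ≤ B) : Integrable f μ :=
  Integrable.of_bound hf.aestronglyMeasurable B hB

/-- The product of nonnegative factors of conditional mean at most one has mean at most one. -/
lemma integral_prod_le_one [IsProbabilityMeasure μ] {F : ℕ → MeasurableSpace Ω}
    (hF : ∀ s, F s ≤ mΩ) {q : ℕ → Ω → ℝ} (n : ℕ) (hq0 : ∀ s ω, 0 ≤ q s ω)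
    (hqm : ∀ s ∈ Finset.Ico 1 n, Measurable (q s))
    (hqa : ∀ s ∈ Finset.Ico 1 n, ∀ t ∈ Finset.Ico 1 n, s < t → Measurable[F t] (q s))
    (hqb : ∀ s ∈ Finset.Ico 1 n, ∃ B, ∀ᵐ ω ∂μ, q s ω ≤ B)
    (hqc : ∀ s ∈ Finset.Ico 1 n, μ[q s | F s] ≤ᵐ[μ] fun _ => 1) :
    (∃ B, ∀ᵐ ω ∂μ, ∏ s ∈ Finset.Ico 1 n, q s ω ≤ B) ∧
      ∫ ω, ∏ s ∈ Finset.Ico 1 n, q s ω ∂μ ≤ 1 := by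
  induction n with
  | zero => exact ⟨⟨1, by simp⟩, by simp⟩
  | succ n ih =>
    rcases Nat.eq_zero_or_pos n with rfl | hn
    · exact ⟨⟨1, by simp⟩, by simp⟩
    have hsub : ∀ s ∈ Finset.Ico 1 n, s ∈ Finset.Ico 1 (n + 1) := by
      intro s hs; simp only [Finset.mem_Ico] at hs ⊢; omega
    have hnn : n ∈ Finset.Ico 1 (n + 1) := by simp; omega
    obtain ⟨⟨B, hB⟩, hI⟩ := ih (fun s hs => hqm s (hsub s hs))
      (fun s hs t ht => hqa s (hsub s hs) t (hsub t ht)) (fun s hs => hqb s (hsub s hs))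
      (fun s hs => hqc s (hsub s hs))
    obtain ⟨B', hB'⟩ := hqb n hnn
    simp only [Finset.prod_Ico_succ_top hn]
    set p : Ω → ℝ := fun ω => ∏ s ∈ Finset.Ico 1 n, q s ω with hp
    have hp0 : ∀ ω, 0 ≤ p ω := fun ω => Finset.prod_nonneg fun s _ => hq0 s ω
    have hbd : ∀ᵐ ω ∂μ, p ω * q n ω ≤ B * B' := by
      filter_upwards [hB, hB'] with ω h1 h2
      exact mul_le_mul h1 h2 (hq0 _ _) ((hp0 ω).trans h1)
    refine ⟨⟨_, hbd⟩, ?_⟩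
    have hpF : Measurable[F n] p := by
      refine Finset.measurable_prod _ fun s hs => ?_
      refine hqa s (hsub s hs) n hnn (Finset.mem_Ico.1 hs).2
    have hpm : Measurable p := hpF.mono (hF n) le_rfl
    have hpi : Integrable p μ := integrable_of_measurable_of_ae_bound hpm (B := B)
      (by filter_upwards [hB] with ω h; rwa [abs_of_nonneg (hp0 ω)])
    have hqi : Integrable (q n) μ := integrable_of_measurable_of_ae_bound (hqm n hnn) (B := B')
      (by filter_upwards [hB'] with ω h; rwa [abs_of_nonneg (hq0 n ω)])
    have hpqi : Integrable (p * q n) μ :=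
      integrable_of_measurable_of_ae_bound (hpm.mul (hqm n hnn)) (B := B * B')
      (by filter_upwards [hbd] with ω h
          rwa [Pi.mul_apply, abs_of_nonneg (mul_nonneg (hp0 ω) (hq0 n ω))])
    -- The product of the earlier factors is known at time n, so it comes out of the conditional
    -- expectation of the last factor.
    have key := condExp_mul_of_stronglyMeasurable_left (μ := μ) hpF.stronglyMeasurable hpqi hqi
    calc ∫ ω, p ω * q n ω ∂μ = ∫ ω, (μ[p * q n | F n]) ω ∂μ := (integral_condExp (hF n)).symm
      _ ≤ ∫ ω, p ω ∂μ := by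
          refine integral_mono_ae integrable_condExp hpi ?_
          filter_upwards [key, hqc n hnn] with ω h1 h2
          rw [h1, Pi.mul_apply]
          exact mul_le_of_le_one_right (hp0 ω) h2
      _ ≤ 1 := hI

/-- Hoeffding's lemma for the two-point distribution on `{-1, 1}` with mean `m`. -/
lemma cosh_add_mul_sinh_le {m t : ℝ} (hm : |m| ≤ 1) :
    Real.cosh t + m * Real.sinh t ≤ Real.exp (t * m + t ^ 2 / 2) := by
  obtain ⟨h1, h2⟩ := abs_le.1 hm
  set p : ℝ := (1 - m) / 2 with hp
  have hp0 : 0 ≤ p := by rw [hp]; linarith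
  have hp1 : 0 ≤ 1 - p := by rw [hp]; linarith
  -- The left side is the moment generating function of this two-point law of mean m. Its support
  -- lies in an interval of length 2, so Hoeffding's lemma gives variance proxy 1.
  let ν : Measure ℝ := ENNReal.ofReal p • Measure.dirac (-1) + ENNReal.ofReal (1 - p) • Measure.dirac 1
  have hν : IsProbabilityMeasure ν := ⟨by
    simp only [ν, Measure.coe_add, Measure.coe_smul, Pi.add_apply, Pi.smul_apply, measure_univ,
      smul_eq_mul, mul_one]
    rw [← ENNReal.ofReal_add hp0 hp1]; simp⟩
  have hint : ∀ f : ℝ → ℝ, ∫ x, f x ∂ν = p * f (-1) + (1 - p) * f 1 := by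
    intro f
    have i1 : Integrable f (ENNReal.ofReal p • Measure.dirac (-1)) :=
      (integrable_dirac (by simp)).smul_measure (by simp)
    have i2 : Integrable f (ENNReal.ofReal (1 - p) • Measure.dirac 1) :=
      (integrable_dirac (by simp)).smul_measure (by simp)
    simp only [ν]
    rw [integral_add_measure i1 i2, integral_smul_measure, integral_smul_measure, integral_dirac,
      integral_dirac, ENNReal.toReal_ofReal hp0, ENNReal.toReal_ofReal hp1]
    simp
  have hb : ∀ᵐ x ∂ν, x - m ∈ Icc (-1 - m) (1 - m) := by
    simp only [ν]
    rw [ae_add_measure_iff]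
    constructor
    · refine Measure.ae_smul_measure ?_ _
      rw [ae_dirac_eq]; constructor <;> linarith
    · refine Measure.ae_smul_measure ?_ _
      rw [ae_dirac_eq]; constructor <;> linarith
  have hsub := hasSubgaussianMGF_of_mem_Icc_of_integral_eq_zero (μ := ν) (X := fun x => x - m)
    (by fun_prop) hb (by rw [hint]; rw [hp]; ring)
  have := hsub.mgf_le t
  rw [mgf, hint] at this
  have e1 : Real.cosh t + m * Real.sinh t
      = Real.exp (t * m) * (p * Real.exp (t * (-1 - m)) + (1 - p) * Real.exp (t * (1 - m))) := by
    have a1 : Real.exp (t * m) * Real.exp (t * (-1 - m)) = Real.exp (-t) := by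
      rw [← Real.exp_add]; congr 1; ring
    have a2 : Real.exp (t * m) * Real.exp (t * (1 - m)) = Real.exp t := by
      rw [← Real.exp_add]; congr 1; ring
    rw [mul_add, mul_left_comm, a1, mul_left_comm, a2, Real.cosh_eq, Real.sinh_eq, hp]; ring
  rw [e1, Real.exp_add]
  refine mul_le_mul_of_nonneg_left (this.trans (le_of_eq ?_)) (Real.exp_pos _).le
  congr 1
  have : ‖(1 - m) - (-1 - m)‖₊ = 2 := by
    rw [show (1 - m) - (-1 - m) = 2 by ring]; simp
  rw [this]; simp

/-- A convexity bound for the exponential on a symmetric interval. -/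
lemma exp_mul_le_cosh_add {B z t : ℝ} (hB : 0 < B) (hz : |z| ≤ B) :
    Real.exp (t * z) ≤ Real.cosh (t * B) + z / B * Real.sinh (t * B) := by
  obtain ⟨h1, h2⟩ := abs_le.1 hz
  -- t z is the convex combination of -tB and tB with weights (1 ∓ z/B)/2; the chord of the
  -- exponential rearranges into cosh and sinh.
  have := convexOn_exp.2 (mem_univ (-(t * B))) (mem_univ (t * B))
    (show 0 ≤ (1 - z / B) / 2 by have := (div_le_one hB).2 h2; linarith)
    (show 0 ≤ (1 + z / B) / 2 by
        have : -1 ≤ z / B := by rw [le_div_iff₀ hB]; linarith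
        linarith) (by ring)
  simp only [smul_eq_mul] at this
  have e : (1 - z / B) / 2 * -(t * B) + (1 + z / B) / 2 * (t * B) = t * z := by
    field_simp; ring
  rw [e] at this
  refine this.trans (le_of_eq ?_)
  rw [Real.cosh_eq, Real.sinh_eq]; ring

lemma exp_le_one_add_add_sq {x : ℝ} (hx : |x| ≤ 1) : Real.exp x ≤ 1 + x + x ^ 2 := by
  have := Real.abs_exp_sub_one_sub_id_le hx
  have := abs_le.1 this
  linarith [this.2]

end Concentration

/-- If a variable is bounded by an affine expression in `Z`, `Z'` with known coefficients, its
conditional mean is bounded by the same expression in the conditional means. -/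
lemma condExp_le_one_of_le_affine {Ω : Type*} {F mΩ : MeasurableSpace Ω} {μ : Measure Ω}
    [IsProbabilityMeasure μ] (hF : F ≤ mΩ)
    {q Z Z' m m' a b c : Ω → ℝ} {R : ℝ} (hq : Integrable q μ) (hZ : Measurable Z)
    (hZb : ∀ᵐ ω ∂μ, |Z ω| ≤ R) (hZ' : Measurable Z') (hZb' : ∀ᵐ ω ∂μ, |Z' ω| ≤ R)
    (hm : μ[Z | F] =ᵐ[μ] m) (hm' : μ[Z' | F] =ᵐ[μ] m')
    (ha : Measurable[F] a) (hb : Measurable[F] b) (hc : Measurable[F] c)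
    (hab : ∀ ω, |a ω| ≤ R) (hbb : ∀ ω, |b ω| ≤ R) (hcb : ∀ ω, |c ω| ≤ R)
    (hle : ∀ᵐ ω ∂μ, q ω ≤ a ω + b ω * Z ω + c ω * Z' ω)
    (hone : ∀ ω, a ω + b ω * m ω + c ω * m' ω ≤ 1) :
    μ[q | F] ≤ᵐ[μ] fun _ => 1 := by
  have hZi := integrable_of_measurable_of_ae_bound hZ hZb
  have hZi' := integrable_of_measurable_of_ae_bound hZ' hZb'
  have ia : Integrable a μ :=
    integrable_of_measurable_of_ae_bound (ha.mono hF le_rfl) (ae_of_all _ hab)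
  have ib : Integrable (b * Z) μ :=
    hZi.bdd_mul (hb.mono hF le_rfl).aestronglyMeasurable (ae_of_all _ hbb)
  have ic : Integrable (c * Z') μ :=
    hZi'.bdd_mul (hc.mono hF le_rfl).aestronglyMeasurable (ae_of_all _ hcb)
  have h1 : μ[q | F] ≤ᵐ[μ] μ[a + b * Z + c * Z' | F] :=
    condExp_mono hq ((ia.add ib).add ic) (by
      filter_upwards [hle] with ω h; simpa using h)
  have h2 := condExp_add (ia.add ib) ic F
  have h3 := condExp_add ia ib F
  have h4 := condExp_mul_of_stronglyMeasurable_left (μ := μ) hb.stronglyMeasurable ib hZi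
  have h5 := condExp_mul_of_stronglyMeasurable_left (μ := μ) hc.stronglyMeasurable ic hZi'
  have h6 := condExp_of_stronglyMeasurable hF ha.stronglyMeasurable ia
  filter_upwards [h1, h2, h3, h4, h5, hm, hm'] with ω h1 h2 h3 h4 h5 h7 h8
  refine h1.trans ?_
  rw [h2, Pi.add_apply, h3, Pi.add_apply, h4, h5, h6, Pi.mul_apply, Pi.mul_apply, h7, h8]
  exact hone ω

/-! ### Weighted martingale noise, exponential supermartingales, Bernstein tails -/

section Tails

variable {Ω : Type*} [mΩ : MeasurableSpace Ω]

/-- Observations `Z s`, bounded by `B`, with conditional means `m s` given `F s` and predictable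
weights `w s` in `[0, 1]`, for `1 ≤ s < n`. -/
structure IsWeightedNoise (μ : Measure Ω) (F : ℕ → MeasurableSpace Ω) (n : ℕ)
    (w Z m : ℕ → Ω → ℝ) (B : ℝ) : Prop where
  B_pos : 0 < B
  le : ∀ s, F s ≤ mΩ
  mono : ∀ s ∈ Finset.Ico 1 n, ∀ t ∈ Finset.Ico 1 n, s < t → F s ≤ F t
  w_meas : ∀ s ∈ Finset.Ico 1 n, Measurable[F s] (w s)
  m_meas : ∀ s ∈ Finset.Ico 1 n, Measurable[F s] (m s)
  Z_meas : ∀ s ∈ Finset.Ico 1 n, Measurable (Z s)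
  Z_adapted : ∀ s ∈ Finset.Ico 1 n, ∀ t ∈ Finset.Ico 1 n, s < t → Measurable[F t] (Z s)
  w_mem : ∀ s ω, w s ω ∈ Icc (0 : ℝ) 1
  m_bound : ∀ s ∈ Finset.Ico 1 n, ∀ ω, |m s ω| ≤ B
  Z_bound : ∀ s ∈ Finset.Ico 1 n, ∀ᵐ ω ∂μ, |Z s ω| ≤ B
  cond_mean : ∀ s ∈ Finset.Ico 1 n, μ[Z s | F s] =ᵐ[μ] m s

/-- The weighted sum of the noise. -/
def noiseSum {Ω : Type*} (n : ℕ) (w Z m : ℕ → Ω → ℝ) (ω : Ω) : ℝ :=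
  ∑ s ∈ Finset.Ico 1 n, w s ω * (Z s ω - m s ω)

variable {μ : Measure Ω} {F : ℕ → MeasurableSpace Ω} {n : ℕ}
  {w Z m : ℕ → Ω → ℝ} {B : ℝ}

/-- Turns the one-sided Bernstein tail into a two-sided one. -/
lemma IsWeightedNoise.neg (h : IsWeightedNoise μ F n w Z m B) :
    IsWeightedNoise μ F n w (fun s ω => -Z s ω) (fun s ω => -m s ω) B where
  B_pos := h.B_pos
  le := h.le
  mono := h.mono
  w_meas := h.w_meas
  m_meas s hs := (h.m_meas s hs).neg
  Z_meas s hs := (h.Z_meas s hs).neg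
  Z_adapted s hs t ht hst := (h.Z_adapted s hs t ht hst).neg
  w_mem := h.w_mem
  m_bound s hs ω := by rw [abs_neg]; exact h.m_bound s hs ω
  Z_bound s hs := by
    filter_upwards [h.Z_bound s hs] with ω hω
    rwa [abs_neg]
  cond_mean s hs := by
    filter_upwards [condExp_neg (μ := μ) (Z s) (F s), h.cond_mean s hs] with ω h1 h2
    have : (μ[fun ω => -Z s ω | F s]) ω = (μ[-Z s | F s]) ω := rfl
    rw [this, h1, Pi.neg_apply, h2]

lemma noiseSum_neg {Ω : Type*} {n : ℕ} {w Z m : ℕ → Ω → ℝ} (ω : Ω) :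
    noiseSum n w (fun s ω => -Z s ω) (fun s ω => -m s ω) ω = -noiseSum n w Z m ω := by
  simp only [noiseSum, ← Finset.sum_neg_distrib]
  exact Finset.sum_congr rfl fun s _ => by ring

lemma IsWeightedNoise.abs_mul_sub_le (h : IsWeightedNoise μ F n w Z m B) (t : ℝ) {s : ℕ}
    (hs : s ∈ Finset.Ico 1 n) : ∀ᵐ ω ∂μ, |t * w s ω * (Z s ω - m s ω)| ≤ |t| * (2 * B) := by
  filter_upwards [h.Z_bound s hs] with ω hω
  rw [abs_mul, abs_mul, abs_of_nonneg (h.w_mem s ω).1]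
  have h1 := abs_sub (Z s ω) (m s ω)
  have h2 := h.m_bound s hs ω
  have h3 : |t| * w s ω ≤ |t| := mul_le_of_le_one_right (abs_nonneg t) (h.w_mem s ω).2
  exact mul_le_mul h3 (by linarith) (abs_nonneg _) (abs_nonneg _)

variable [IsProbabilityMeasure μ]

/-- A factor `exp (t w (Z - m) - g)` with a penalty `g ≥ 0`: the exponential supermartingale. -/
lemma IsWeightedNoise.integral_exp_le_one (h : IsWeightedNoise μ F n w Z m B) (t : ℝ)
    {g : ℕ → Ω → ℝ} (hg0 : ∀ s ω, 0 ≤ g s ω)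
    (hg : ∀ s ∈ Finset.Ico 1 n, Measurable[F s] (g s))
    (hc : ∀ s ∈ Finset.Ico 1 n,
      μ[fun ω => Real.exp (t * w s ω * (Z s ω - m s ω) - g s ω) | F s] ≤ᵐ[μ] fun _ => 1) :
    Integrable (fun ω => Real.exp (t * noiseSum n w Z m ω - ∑ s ∈ Finset.Ico 1 n, g s ω)) μ ∧
    ∫ ω, Real.exp (t * noiseSum n w Z m ω - ∑ s ∈ Finset.Ico 1 n, g s ω) ∂μ ≤ 1 := by
  have hm : ∀ s ∈ Finset.Ico 1 n,
      Measurable fun ω => Real.exp (t * w s ω * (Z s ω - m s ω) - g s ω) := by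
    intro s hs
    have h1 := (h.w_meas s hs).mono (h.le s) le_rfl
    have h2 := (h.m_meas s hs).mono (h.le s) le_rfl
    have h3 := (hg s hs).mono (h.le s) le_rfl
    have h4 := h.Z_meas s hs
    fun_prop
  have key := integral_prod_le_one (μ := μ) h.le
    (q := fun s ω => Real.exp (t * w s ω * (Z s ω - m s ω) - g s ω)) n
    (fun s ω => (Real.exp_pos _).le) hm
    (by
      intro s hs u hu hsu
      have h1 := (h.w_meas s hs).mono (h.mono s hs u hu hsu) le_rfl
      have h2 := (h.m_meas s hs).mono (h.mono s hs u hu hsu) le_rfl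
      have h3 := (hg s hs).mono (h.mono s hs u hu hsu) le_rfl
      have h4 := h.Z_adapted s hs u hu hsu
      exact Real.measurable_exp.comp (((measurable_const.mul h1).mul (h4.sub h2)).sub h3))
    (by
      intro s hs
      refine ⟨Real.exp (|t| * (2 * B)), ?_⟩
      filter_upwards [h.abs_mul_sub_le t hs] with ω hω
      exact Real.exp_le_exp.2 (by linarith [(abs_le.1 hω).2, hg0 s ω])) hc
  have e : ∀ ω, ∏ s ∈ Finset.Ico 1 n, Real.exp (t * w s ω * (Z s ω - m s ω) - g s ω)
      = Real.exp (t * noiseSum n w Z m ω - ∑ s ∈ Finset.Ico 1 n, g s ω) := by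
    intro ω
    rw [← Real.exp_sum, Finset.sum_sub_distrib, noiseSum, Finset.mul_sum]
    simp only [mul_assoc]
  simp only [e] at key
  obtain ⟨⟨R, hR⟩, hI⟩ := key
  refine ⟨integrable_of_measurable_of_ae_bound ?_ (B := R) ?_, hI⟩
  · have := Finset.measurable_prod (Finset.Ico 1 n) hm
    simpa only [e] using this
  · filter_upwards [hR] with ω hω
    rwa [abs_of_pos (Real.exp_pos _)]

/-- Convexity replaces exp(t w Z) by its chord over [-B, B], which is affine in Z, so only the
conditional mean m enters. What remains is the moment generating function of a two-point law,
bounded by `cosh_add_mul_sinh_le`. No regular conditional distribution is needed. -/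
lemma IsWeightedNoise.hoeffding_condExp (h : IsWeightedNoise μ F n w Z m B) (t : ℝ) {s : ℕ}
    (hs : s ∈ Finset.Ico 1 n) :
    μ[fun ω => Real.exp (t * w s ω * (Z s ω - m s ω) - t ^ 2 * B ^ 2 * w s ω ^ 2 / 2) | F s]
      ≤ᵐ[μ] fun _ => 1 := by
  have hB := h.B_pos
  have mw := h.w_meas s hs
  have mm := h.m_meas s hs
  have mw' := mw.mono (h.le s) le_rfl
  have mm' := mm.mono (h.le s) le_rfl
  have mZ := h.Z_meas s hs
  have hw : ∀ ω, |t * w s ω| ≤ |t| := fun ω => by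
    rw [abs_mul, abs_of_nonneg (h.w_mem s ω).1]
    exact mul_le_of_le_one_right (abs_nonneg t) (h.w_mem s ω).2
  -- The predictable part of the exponential; the other factor, exp(t w Z), is the only one that
  -- contains Z.
  set E : Ω → ℝ := fun ω => Real.exp (-(t * w s ω * m s ω) - t ^ 2 * B ^ 2 * w s ω ^ 2 / 2)
    with hE
  have mE : Measurable[F s] E := Real.measurable_exp.comp
    (((measurable_const.mul mw).mul mm).neg.sub
      ((measurable_const.mul (mw.pow_const 2)).div_const 2))
  have bE : ∀ ω, |E ω| ≤ Real.exp (|t| * B) := by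
    intro ω
    rw [hE, abs_of_pos (Real.exp_pos _)]
    refine Real.exp_le_exp.2 ?_
    have : |t * w s ω * m s ω| ≤ |t| * B := by
      rw [abs_mul]; exact mul_le_mul (hw ω) (h.m_bound s hs ω) (abs_nonneg _) (abs_nonneg _)
    have h3 : 0 ≤ t ^ 2 * B ^ 2 * w s ω ^ 2 / 2 := by positivity
    linarith [(abs_le.1 this).1]
  have bC : ∀ ω, |Real.cosh (t * w s ω * B)| ≤ Real.cosh (|t| * B) := by
    intro ω
    rw [abs_of_pos (Real.cosh_pos _), Real.cosh_le_cosh, abs_mul, abs_mul |t|, abs_abs]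
    exact mul_le_mul_of_nonneg_right (hw ω) (abs_nonneg _)
  have bS : ∀ ω, |Real.sinh (t * w s ω * B)| ≤ Real.cosh (|t| * B) := by
    intro ω
    refine le_trans ?_ ((le_abs_self _).trans (bC ω))
    rw [abs_le]
    constructor
    · have := Real.sinh_lt_cosh (-(t * w s ω * B))
      rw [Real.sinh_neg, Real.cosh_neg] at this; linarith
    · exact (Real.sinh_lt_cosh _).le
  refine condExp_le_one_of_le_affine (h.le s) (Z := Z s) (Z' := fun _ => 0) (m := m s)
    (m' := fun _ => 0)
    (a := fun ω => E ω * Real.cosh (t * w s ω * B))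
    (b := fun ω => E ω * (Real.sinh (t * w s ω * B) / B)) (c := fun _ => 0)
    (R := max B (max (Real.exp (|t| * B) * Real.cosh (|t| * B))
      (Real.exp (|t| * B) * (Real.cosh (|t| * B) / B))))
    ?_ mZ ?_ measurable_const ?_ (h.cond_mean s hs) ?_ ?_ ?_ measurable_const ?_ ?_ ?_ ?_ ?_
  · refine integrable_of_measurable_of_ae_bound (by fun_prop) (B := Real.exp (|t| * (2 * B))) ?_
    filter_upwards [h.abs_mul_sub_le t hs] with ω hω
    rw [abs_of_pos (Real.exp_pos _)]
    have h3 : 0 ≤ t ^ 2 * B ^ 2 * w s ω ^ 2 / 2 := by positivity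
    exact Real.exp_le_exp.2 (by linarith [(abs_le.1 hω).2])
  · filter_upwards [h.Z_bound s hs] with ω hω using hω.trans (le_max_left _ _)
  · exact ae_of_all _ fun ω => by rw [abs_zero]; exact hB.le.trans (le_max_left _ _)
  · rw [condExp_const (h.le s)]
  · exact mE.mul (Real.measurable_cosh.comp ((measurable_const.mul mw).mul measurable_const))
  · exact mE.mul ((Real.measurable_sinh.comp
      ((measurable_const.mul mw).mul measurable_const)).div_const B)
  · intro ω
    refine le_trans ?_ ((le_max_left _ _).trans (le_max_right _ _))
    rw [abs_mul]
    exact mul_le_mul (bE ω) (bC ω) (abs_nonneg _) (Real.exp_pos _).le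
  · intro ω
    refine le_trans ?_ ((le_max_right _ _).trans (le_max_right _ _))
    rw [abs_mul, abs_div, abs_of_pos hB]
    exact mul_le_mul (bE ω) (div_le_div_of_nonneg_right (bS ω) hB.le)
      (div_nonneg (abs_nonneg _) hB.le) (Real.exp_pos _).le
  · intro ω; rw [abs_zero]; exact hB.le.trans (le_max_left _ _)
  · filter_upwards [h.Z_bound s hs] with ω hω
    have := exp_mul_le_cosh_add (t := t * w s ω) hB hω
    calc Real.exp (t * w s ω * (Z s ω - m s ω) - t ^ 2 * B ^ 2 * w s ω ^ 2 / 2)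
        = E ω * Real.exp (t * w s ω * Z s ω) := by
          rw [hE, ← Real.exp_add]; congr 1; ring
      _ ≤ E ω * (Real.cosh (t * w s ω * B) + Z s ω / B * Real.sinh (t * w s ω * B)) :=
          mul_le_mul_of_nonneg_left this (Real.exp_pos _).le
      _ = _ := by ring
  · intro ω
    have hmB : |m s ω / B| ≤ 1 := by
      rw [abs_div, abs_of_pos hB]; exact (div_le_one hB).2 (h.m_bound s hs ω)
    have := cosh_add_mul_sinh_le (t := t * w s ω * B) hmB
    calc E ω * Real.cosh (t * w s ω * B) + E ω * (Real.sinh (t * w s ω * B) / B) * m s ω + 0 * 0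
        = E ω * (Real.cosh (t * w s ω * B) + m s ω / B * Real.sinh (t * w s ω * B)) := by ring
      _ ≤ E ω * Real.exp (t * w s ω * B * (m s ω / B) + (t * w s ω * B) ^ 2 / 2) :=
          mul_le_mul_of_nonneg_left this (Real.exp_pos _).le
      _ = 1 := by
          rw [hE, ← Real.exp_add, Real.exp_eq_one_iff]
          field_simp; ring

/-- Bernstein-type factor, for observations with conditional second moments `v`. -/
lemma IsWeightedNoise.bernstein_condExp (h : IsWeightedNoise μ F n w Z m B) {v : ℕ → Ω → ℝ}
    {t : ℝ} (ht : 0 ≤ t) (htB : t * (2 * B) ≤ 1) {s : ℕ} (hs : s ∈ Finset.Ico 1 n)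
    (hvm : Measurable[F s] (v s)) (hv : μ[fun ω => Z s ω ^ 2 | F s] =ᵐ[μ] v s)
    (hv0 : ∀ ω, 0 ≤ v s ω - m s ω ^ 2) :
    μ[fun ω => Real.exp (t * w s ω * (Z s ω - m s ω) - t ^ 2 * w s ω * (v s ω - m s ω ^ 2)) | F s]
      ≤ᵐ[μ] fun _ => 1 := by
  have hB := h.B_pos
  have mw := h.w_meas s hs
  have mm := h.m_meas s hs
  have mw' := mw.mono (h.le s) le_rfl
  have mm' := mm.mono (h.le s) le_rfl
  have mv' := hvm.mono (h.le s) le_rfl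
  have mZ := h.Z_meas s hs
  have hw0 : ∀ ω, 0 ≤ t * w s ω := fun ω => mul_nonneg ht (h.w_mem s ω).1
  have hw : ∀ ω, t * w s ω ≤ t := fun ω => mul_le_of_le_one_right ht (h.w_mem s ω).2
  have hpen : ∀ ω, 0 ≤ t ^ 2 * w s ω * (v s ω - m s ω ^ 2) := fun ω =>
    mul_nonneg (mul_nonneg (sq_nonneg t) (h.w_mem s ω).1) (hv0 ω)
  set E : Ω → ℝ := fun ω => Real.exp (-(t ^ 2 * w s ω * (v s ω - m s ω ^ 2))) with hE
  have mE : Measurable[F s] E := Real.measurable_exp.comp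
    ((measurable_const.mul mw).mul (hvm.sub (mm.pow_const 2))).neg
  have E0 : ∀ ω, 0 ≤ E ω := fun ω => (Real.exp_pos _).le
  have E1 : ∀ ω, E ω ≤ 1 := fun ω => Real.exp_le_one_iff.2 (by linarith [hpen ω])
  have hx : ∀ ω, t * w s ω * B ≤ 1 := fun ω => by
    have := mul_le_mul_of_nonneg_right (hw ω) hB.le
    nlinarith [mul_nonneg ht hB.le]
  have bm : ∀ ω, |t * w s ω * m s ω| ≤ 1 := fun ω => by
    rw [abs_mul, abs_of_nonneg (hw0 ω)]
    exact (mul_le_mul_of_nonneg_left (h.m_bound s hs ω) (hw0 ω)).trans (hx ω)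
  -- The bound exp x ≤ 1 + x + x² at x = t w (Z - m) is affine in the pair (Z, Z²); a, b, c are its
  -- coefficients times E. The constant R dominates |Z|, Z² and the coefficient bounds 3, 3t, t².
  refine condExp_le_one_of_le_affine (h.le s) (Z := Z s) (Z' := fun ω => Z s ω ^ 2) (m := m s)
    (m' := v s)
    (a := fun ω => E ω * (1 - t * w s ω * m s ω + (t * w s ω * m s ω) ^ 2))
    (b := fun ω => E ω * (t * w s ω * (1 - 2 * (t * w s ω * m s ω))))
    (c := fun ω => E ω * (t * w s ω) ^ 2)
    (R := B + B ^ 2 + 3 + 3 * t + t ^ 2)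
    ?_ mZ ?_ (mZ.pow_const 2) ?_ (h.cond_mean s hs) hv ?_ ?_ ?_ ?_ ?_ ?_ ?_ ?_
  · refine integrable_of_measurable_of_ae_bound (by fun_prop) (B := Real.exp (|t| * (2 * B))) ?_
    filter_upwards [h.abs_mul_sub_le t hs] with ω hω
    rw [abs_of_pos (Real.exp_pos _)]
    exact Real.exp_le_exp.2 (by linarith [(abs_le.1 hω).2, hpen ω])
  · filter_upwards [h.Z_bound s hs] with ω hω
    nlinarith [sq_nonneg B, sq_nonneg t]
  · filter_upwards [h.Z_bound s hs] with ω hω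
    rw [abs_pow]
    have := pow_le_pow_left₀ (abs_nonneg _) hω 2
    nlinarith [sq_nonneg t]
  · exact mE.mul ((measurable_const.sub ((measurable_const.mul mw).mul mm)).add
      (((measurable_const.mul mw).mul mm).pow_const 2))
  · exact mE.mul ((measurable_const.mul mw).mul (measurable_const.sub
      (measurable_const.mul ((measurable_const.mul mw).mul mm))))
  · exact mE.mul ((measurable_const.mul mw).pow_const 2)
  · intro ω
    have h1 := abs_le.1 (bm ω)
    have h2 : (t * w s ω * m s ω) ^ 2 ≤ 1 := (sq_le_one_iff_abs_le_one _).2 (bm ω)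
    have h3 : |1 - t * w s ω * m s ω + (t * w s ω * m s ω) ^ 2| ≤ 3 := by
      rw [abs_le]; constructor <;> nlinarith [sq_nonneg (t * w s ω * m s ω)]
    rw [abs_mul, abs_of_nonneg (E0 ω)]
    have := mul_le_mul (E1 ω) h3 (abs_nonneg _) zero_le_one
    nlinarith [sq_nonneg B, sq_nonneg t]
  · intro ω
    have h1 := abs_le.1 (bm ω)
    have h3 : |t * w s ω * (1 - 2 * (t * w s ω * m s ω))| ≤ t * 3 := by
      rw [abs_mul, abs_of_nonneg (hw0 ω)]
      refine mul_le_mul (hw ω) ?_ (abs_nonneg _) ht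
      rw [abs_le]; constructor <;> linarith
    rw [abs_mul, abs_of_nonneg (E0 ω)]
    have := mul_le_mul (E1 ω) h3 (abs_nonneg _) zero_le_one
    nlinarith [sq_nonneg B, sq_nonneg t]
  · intro ω
    have h3 : (t * w s ω) ^ 2 ≤ t ^ 2 := pow_le_pow_left₀ (hw0 ω) (hw ω) 2
    rw [abs_mul, abs_of_nonneg (E0 ω), abs_of_nonneg (sq_nonneg (t * w s ω))]
    have := mul_le_mul (E1 ω) h3 (sq_nonneg _) zero_le_one
    nlinarith [sq_nonneg B, sq_nonneg t]
  · filter_upwards [h.abs_mul_sub_le t hs] with ω hω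
    rw [abs_of_nonneg ht] at hω
    have := exp_le_one_add_add_sq (hω.trans htB)
    calc Real.exp (t * w s ω * (Z s ω - m s ω) - t ^ 2 * w s ω * (v s ω - m s ω ^ 2))
        = E ω * Real.exp (t * w s ω * (Z s ω - m s ω)) := by
          rw [hE, ← Real.exp_add]; congr 1; ring
      _ ≤ E ω * (1 + t * w s ω * (Z s ω - m s ω) + (t * w s ω * (Z s ω - m s ω)) ^ 2) :=
          mul_le_mul_of_nonneg_left this (E0 ω)
      _ = _ := by ring
  · intro ω
    have h1 : 1 + t ^ 2 * w s ω * (v s ω - m s ω ^ 2)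
        ≤ Real.exp (t ^ 2 * w s ω * (v s ω - m s ω ^ 2)) := by
      rw [add_comm]; exact Real.add_one_le_exp _
    -- The expansion produces w² times the variance; weights in [0, 1] allow w in the penalty, so
    -- that the sum of penalties is later compared with the count.
    have hw2 : w s ω ^ 2 ≤ w s ω := by nlinarith [(h.w_mem s ω).1, (h.w_mem s ω).2]
    calc _ = E ω * (1 + t ^ 2 * w s ω ^ 2 * (v s ω - m s ω ^ 2)) := by ring
      _ ≤ E ω * Real.exp (t ^ 2 * w s ω * (v s ω - m s ω ^ 2)) := by
          refine mul_le_mul_of_nonneg_left (le_trans ?_ h1) (E0 ω)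
          have := mul_le_mul_of_nonneg_right (mul_le_mul_of_nonneg_left hw2 (sq_nonneg t)) (hv0 ω)
          linarith
      _ = 1 := by rw [hE, ← Real.exp_add]; simp

/-- Bernstein-type tail bound. -/
lemma IsWeightedNoise.bernstein (h : IsWeightedNoise μ F n w Z m B) {v : ℕ → Ω → ℝ}
    {t : ℝ} (ht : 0 < t) (htB : t * (2 * B) ≤ 1)
    (hvm : ∀ s ∈ Finset.Ico 1 n, Measurable[F s] (v s))
    (hv : ∀ s ∈ Finset.Ico 1 n, μ[fun ω => Z s ω ^ 2 | F s] =ᵐ[μ] v s)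
    (hv0 : ∀ s ω, 0 ≤ v s ω - m s ω ^ 2) (L : ℝ) :
    μ.real {ω | L / t + t * ∑ s ∈ Finset.Ico 1 n, w s ω * (v s ω - m s ω ^ 2)
      < noiseSum n w Z m ω} ≤ Real.exp (-L) := by
  obtain ⟨hi, hI⟩ := h.integral_exp_le_one t
    (g := fun s ω => t ^ 2 * w s ω * (v s ω - m s ω ^ 2))
    (fun s ω => mul_nonneg (mul_nonneg (sq_nonneg t) (h.w_mem s ω).1) (hv0 s ω))
    (fun s hs => (measurable_const.mul (h.w_meas s hs)).mul
      ((hvm s hs).sub ((h.m_meas s hs).pow_const 2)))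
    (fun s hs => h.bernstein_condExp ht.le htB hs (hvm s hs) (hv s hs) (hv0 s))
  have hmk := mul_meas_ge_le_integral_of_nonneg (ae_of_all μ fun ω => (Real.exp_pos _).le) hi
    (Real.exp L)
  have hle : μ.real {ω | L / t + t * ∑ s ∈ Finset.Ico 1 n, w s ω * (v s ω - m s ω ^ 2)
      < noiseSum n w Z m ω} ≤ μ.real {ω | Real.exp L ≤ Real.exp (t * noiseSum n w Z m ω -
        ∑ s ∈ Finset.Ico 1 n, t ^ 2 * w s ω * (v s ω - m s ω ^ 2))} := by
    refine measureReal_mono fun ω hω => ?_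
    simp only [mem_ofPred_eq] at hω ⊢
    rw [Real.exp_le_exp]
    have h1 := mul_lt_mul_of_pos_left hω ht
    have h2 : t * (L / t) = L := by field_simp
    have h3 : ∑ s ∈ Finset.Ico 1 n, t ^ 2 * w s ω * (v s ω - m s ω ^ 2)
        = t * (t * ∑ s ∈ Finset.Ico 1 n, w s ω * (v s ω - m s ω ^ 2)) := by
      rw [Finset.mul_sum, Finset.mul_sum]; exact Finset.sum_congr rfl fun s _ => by ring
    rw [mul_add, h2] at h1
    linarith
  refine hle.trans ?_
  rw [Real.exp_neg, ← one_div, le_div_iff₀ (Real.exp_pos L), mul_comm]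
  exact hmk.trans hI

end Tails

/-! ### Self-normalized Hoeffding bound by the method of mixtures -/

section Mixture

/-- Completing the square. With c = 0 it gives the normalization of the mixing density, with c = S
the mixture itself. -/
lemma lintegral_gaussian {b : ℝ} (hb : 0 < b) (c : ℝ) :
    ∫⁻ x : ℝ, ENNReal.ofReal (Real.exp (c * x - b * x ^ 2))
      = ENNReal.ofReal (√(Real.pi / b) * Real.exp (c ^ 2 / (4 * b))) := by
  have e : ∀ x : ℝ, Real.exp (c * x - b * x ^ 2)
      = Real.exp (-b * (x - c / (2 * b)) ^ 2) * Real.exp (c ^ 2 / (4 * b)) := by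
    intro x; rw [← Real.exp_add]; congr 1; field_simp; ring
  simp only [e]
  rw [← ofReal_integral_eq_lintegral_ofReal]
  · rw [integral_mul_const, integral_sub_right_eq_self (fun x => Real.exp (-b * x ^ 2)),
      integral_gaussian]
  · exact ((integrable_exp_neg_mul_sq hb).comp_sub_right _).mul_const _
  · exact ae_of_all _ fun x => by positivity

variable {Ω : Type*} [mΩ : MeasurableSpace Ω] {μ : Measure Ω} [IsProbabilityMeasure μ]

/-- The method of mixtures: a family of exponential bounds, integrated against a centred Gaussian
density. -/
lemma measure_self_normalized_le {S V : Ω → ℝ} (hS : Measurable S) (hV : Measurable V)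
    (hV0 : ∀ ω, 0 ≤ V ω) {β B : ℝ} (hβ : 0 < β) (hB : 0 < B)
    (hexp : ∀ t : ℝ, Integrable (fun ω => Real.exp (t * S ω - t ^ 2 * B ^ 2 * V ω / 2)) μ ∧
      ∫ ω, Real.exp (t * S ω - t ^ 2 * B ^ 2 * V ω / 2) ∂μ ≤ 1)
    {n L : ℝ} (hVn : ∀ ω, V ω ≤ n) :
    μ.real {ω | 2 * B ^ 2 * L * (β + V ω) < S ω ^ 2} ≤ √(1 + n / β) * Real.exp (-L) := by
  have hpi := Real.pi_pos
  -- Unnormalized Gaussian weight of precision βB²: multiplied with the exponential it turns V into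
  -- β + V, so the regularization of the count appears by itself.
  set g : ℝ → ℝ≥0∞ := fun t => ENNReal.ofReal (Real.exp (0 * t - β * B ^ 2 / 2 * t ^ 2)) with hg
  have hgI : ∫⁻ t, g t = ENNReal.ofReal (√(Real.pi / (β * B ^ 2 / 2))) := by
    rw [hg, lintegral_gaussian (by positivity)]; simp
  have hbound : ∫⁻ ω, (∫⁻ t : ℝ, g t *
        ENNReal.ofReal (Real.exp (t * S ω - t ^ 2 * B ^ 2 * V ω / 2))) ∂μ
      ≤ ENNReal.ofReal (√(Real.pi / (β * B ^ 2 / 2))) := by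
    rw [lintegral_lintegral_swap (by
      refine Measurable.aemeasurable ?_
      simp only [hg, Function.uncurry_def]
      fun_prop)]
    rw [← hgI]
    refine lintegral_mono fun t => ?_
    rw [lintegral_const_mul _ (by fun_prop)]
    refine mul_le_of_le_one_right' ?_
    rw [← ofReal_integral_eq_lintegral_ofReal (hexp t).1 (ae_of_all _ fun ω => (Real.exp_pos _).le)]
    exact ENNReal.ofReal_le_one.2 (hexp t).2
  have hinner : ∀ ω, ∫⁻ t : ℝ, g t * ENNReal.ofReal (Real.exp (t * S ω - t ^ 2 * B ^ 2 * V ω / 2))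
      = ENNReal.ofReal (√(Real.pi / (B ^ 2 * (β + V ω) / 2)) *
        Real.exp (S ω ^ 2 / (4 * (B ^ 2 * (β + V ω) / 2)))) := by
    intro ω
    have := hV0 ω
    rw [← lintegral_gaussian (by positivity)]
    refine lintegral_congr fun t => ?_
    rw [hg, ← ENNReal.ofReal_mul (Real.exp_pos _).le, ← Real.exp_add]
    congr 2; ring
  simp only [hinner] at hbound
  set A : Set Ω := {ω | 2 * B ^ 2 * L * (β + V ω) < S ω ^ 2} with hA
  have hAm : MeasurableSet A := measurableSet_lt (by fun_prop) (by fun_prop)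
  by_cases hΩ : Nonempty Ω
  swap
  · rw [show A = ∅ from Set.eq_empty_of_forall_notMem fun ω => (hΩ ⟨ω⟩).elim]; simp; positivity
  have hn : 0 ≤ n := (hV0 hΩ.some).trans (hVn _)
  -- Markov's inequality for the mixture. On A its exponent S²/(2B²(β + V)) exceeds L, and V ≤ n
  -- bounds the prefactor from below; the ratio of the two Gaussian normalizations is √(1 + n/β).
  have hlow : ENNReal.ofReal (√(Real.pi / (B ^ 2 * (β + n) / 2)) * Real.exp L) * μ A
      ≤ ENNReal.ofReal (√(Real.pi / (β * B ^ 2 / 2))) := by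
    rw [← setLIntegral_const]
    refine (setLIntegral_mono (by fun_prop) fun ω hω => ?_).trans
      ((setLIntegral_le_lintegral A _).trans hbound)
    have h0 := hV0 ω
    refine ENNReal.ofReal_le_ofReal ?_
    have h1 : √(Real.pi / (B ^ 2 * (β + n) / 2)) ≤ √(Real.pi / (B ^ 2 * (β + V ω) / 2)) := by
      refine Real.sqrt_le_sqrt ?_
      have := hVn ω
      gcongr
    refine mul_le_mul h1 (Real.exp_le_exp.2 ?_) (Real.exp_pos _).le (Real.sqrt_nonneg _)
    rw [le_div_iff₀ (by positivity)]
    have : 2 * B ^ 2 * L * (β + V ω) < S ω ^ 2 := hω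
    linarith
  have hr : μ.real A * (√(Real.pi / (B ^ 2 * (β + n) / 2)) * Real.exp L)
      ≤ √(Real.pi / (β * B ^ 2 / 2)) := by
    have := ENNReal.toReal_mono ENNReal.ofReal_ne_top hlow
    rw [ENNReal.toReal_mul, ENNReal.toReal_ofReal (by positivity),
      ENNReal.toReal_ofReal (by positivity)] at this
    rw [mul_comm]; exact this
  have hs : √(Real.pi / (β * B ^ 2 / 2)) = √(1 + n / β) * √(Real.pi / (B ^ 2 * (β + n) / 2)) := by
    rw [← Real.sqrt_mul (by positivity)]
    congr 1; field_simp
  have hpos : 0 < √(Real.pi / (B ^ 2 * (β + n) / 2)) := Real.sqrt_pos.2 (by positivity)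
  rw [hs] at hr
  rw [Real.exp_neg]
  have : μ.real A * Real.exp L ≤ √(1 + n / β) := by
    refine le_of_mul_le_mul_right ?_ hpos
    linarith
  rwa [← div_eq_mul_inv, le_div_iff₀ (Real.exp_pos L)]

variable {F : ℕ → MeasurableSpace Ω} {n : ℕ} {w Z m : ℕ → Ω → ℝ} {B : ℝ}

/-- Self-normalized Hoeffding bound. -/
lemma IsWeightedNoise.hoeffding (h : IsWeightedNoise μ F n w Z m B) {β : ℝ} (hβ : 0 < β) (L : ℝ) :
    μ.real {ω | √(2 * B ^ 2 * L * (β + ∑ s ∈ Finset.Ico 1 n, w s ω)) < |noiseSum n w Z m ω|}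
      ≤ √(1 + n / β) * Real.exp (-L) := by
  have hB := h.B_pos
  have mw : ∀ s ∈ Finset.Ico 1 n, Measurable (w s) := fun s hs =>
    (h.w_meas s hs).mono (h.le s) le_rfl
  have mm : ∀ s ∈ Finset.Ico 1 n, Measurable (m s) := fun s hs =>
    (h.m_meas s hs).mono (h.le s) le_rfl
  have hwsq : ∀ s ω, w s ω ^ 2 ≤ w s ω := fun s ω => by
    nlinarith [(h.w_mem s ω).1, (h.w_mem s ω).2]
  have key := measure_self_normalized_le (μ := μ) (S := noiseSum n w Z m)
    (V := fun ω => ∑ s ∈ Finset.Ico 1 n, w s ω ^ 2)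
    (by
      unfold noiseSum
      exact Finset.measurable_fun_sum _ fun s hs => (mw s hs).mul ((h.Z_meas s hs).sub (mm s hs)))
    (Finset.measurable_fun_sum _ fun s hs => (mw s hs).pow_const 2)
    (fun ω => Finset.sum_nonneg fun s _ => sq_nonneg _) hβ hB
    (by
      intro t
      have := h.integral_exp_le_one t (g := fun s ω => t ^ 2 * B ^ 2 * w s ω ^ 2 / 2)
        (fun s ω => by positivity)
        (fun s hs => (measurable_const.mul ((h.w_meas s hs).pow_const 2)).div_const 2)
        (fun s hs => h.hoeffding_condExp t hs)
      simpa only [← Finset.sum_div, ← Finset.mul_sum] using this)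
    (n := n) (L := L)
    (by
      intro ω
      calc ∑ s ∈ Finset.Ico 1 n, w s ω ^ 2 ≤ ∑ s ∈ Finset.Ico 1 n, (1 : ℝ) :=
            Finset.sum_le_sum fun s _ => (hwsq s ω).trans (h.w_mem s ω).2
        _ ≤ n := by simp)
  refine le_trans (measureReal_mono fun ω hω => ?_) key
  simp only [mem_ofPred_eq] at hω ⊢
  have hV : ∑ s ∈ Finset.Ico 1 n, w s ω ^ 2 ≤ ∑ s ∈ Finset.Ico 1 n, w s ω :=
    Finset.sum_le_sum fun s _ => hwsq s ω
  have hV0 : 0 ≤ ∑ s ∈ Finset.Ico 1 n, w s ω ^ 2 := Finset.sum_nonneg fun s _ => sq_nonneg _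
  -- The mixture bound concerns ∑ w², which is at most ∑ w; enlarging the threshold this way needs L
  -- ≥ 0. For L < 0 the threshold for S² is negative and the inclusion is trivial.
  rcases le_or_gt 0 L with hL | hL
  · rw [Real.sqrt_lt' (lt_of_le_of_lt (Real.sqrt_nonneg _) hω), sq_abs] at hω
    refine lt_of_le_of_lt ?_ hω
    gcongr
  · refine lt_of_lt_of_le ?_ (sq_nonneg _)
    have : 0 < 2 * B ^ 2 * (β + ∑ s ∈ Finset.Ico 1 n, w s ω ^ 2) := by positivity
    nlinarith

end Mixture

/-! ### Finite nets, boundedness and separability from covering numbers -/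

section Nets

variable {Z : Type*} [MetricSpace Z]

/-- The growth bound covers only radii up to 1; larger radii follow because covering numbers
decrease with the radius. Finiteness is what makes the natural number `covNum` faithful. -/
lemma coveringNumber_ne_top (hZ : ∃ d, HasCoveringExponent Z d) {ε : ℝ} (hε : 0 < ε) :
    Metric.coveringNumber ε.toNNReal (Set.univ : Set Z) ≠ ⊤ := by
  obtain ⟨d, -, c, hc⟩ := hZ
  have h1 : Metric.coveringNumber (min ε 1).toNNReal (Set.univ : Set Z) ≠ ⊤ := by
    intro h
    have := hc (min ε 1) (lt_min hε one_pos) (min_le_right _ _)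
    rw [h] at this
    simp at this
  exact ne_top_of_le_ne_top h1
    (Metric.coveringNumber_anti (Real.toNNReal_le_toNNReal (min_le_left _ _)))

/-- A finite `ε`-net whose cardinality is the covering number. -/
lemma exists_net (hZ : ∃ d, HasCoveringExponent Z d) {ε : ℝ} (hε : 0 < ε) :
    ∃ C : Finset Z, C.card = covNum Z ε ∧ ∀ z, ∃ c ∈ C, dist z c ≤ ε := by
  obtain ⟨C, -, hfin, hcov, hcard⟩ :=
    Metric.exists_set_encard_eq_coveringNumber (coveringNumber_ne_top hZ hε)
  refine ⟨hfin.toFinset, ?_, fun z => ?_⟩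
  · rw [covNum, ← hcard, hfin.encard_eq_coe_toFinset_card, ENat.toNat_natCast]
  · obtain ⟨c, hc, hzc⟩ := hcov (mem_univ z)
    refine ⟨c, by simpa using hc, ?_⟩
    have h2 : edist z c ≤ (ε.toNNReal : ℝ≥0∞) := hzc
    rw [edist_nndist, ENNReal.coe_le_coe, ← NNReal.coe_le_coe, Real.coe_toNNReal _ hε.le] at h2
    exact h2

lemma covNum_pos [Nonempty Z] (hZ : ∃ d, HasCoveringExponent Z d) {ε : ℝ} (hε : 0 < ε) :
    0 < covNum Z ε := by
  obtain ⟨C, hC, hcov⟩ := exists_net hZ hε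
  obtain ⟨c, hc, -⟩ := hcov (Classical.arbitrary Z)
  rw [← hC]; exact Finset.card_pos.2 ⟨c, hc⟩

lemma exists_dist_le (hZ : ∃ d, HasCoveringExponent Z d) : ∃ D : ℝ, ∀ x y : Z, dist x y ≤ D := by
  obtain ⟨C, -, hcov⟩ := exists_net hZ one_pos
  obtain ⟨D, hD⟩ := (Metric.isBounded_iff.1 C.finite_toSet.isBounded)
  refine ⟨1 + D + 1, fun x y => ?_⟩
  obtain ⟨c, hc, hxc⟩ := hcov x
  obtain ⟨c', hc', hyc⟩ := hcov y
  have h1 := dist_triangle4 x c c' y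
  have h2 := hD hc hc'
  rw [dist_comm c' y] at h1
  linarith

lemma exists_countable_dense (hZ : ∃ d, HasCoveringExponent Z d) :
    ∃ D : Set Z, D.Countable ∧ Dense D := by
  choose C _ hcov using fun n : ℕ => exists_net hZ (ε := 1 / (n + 1)) (by positivity)
  refine ⟨⋃ n, (C n : Set Z), countable_iUnion fun n => (C n).countable_toSet, ?_⟩
  rw [Metric.dense_iff]
  intro x r hr
  obtain ⟨n, hn⟩ := exists_nat_one_div_lt hr
  obtain ⟨c, hc, hxc⟩ := hcov n x
  refine ⟨c, ?_, mem_iUnion.2 ⟨n, hc⟩⟩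
  rw [Metric.mem_ball, dist_comm]
  exact hxc.trans_lt hn

end Nets

/-! ### Wasserstein distance and integrals of Lipschitz functions -/

section Wasserstein

lemma integrable_of_bounded {X : Type*} [MeasurableSpace X] {f : X → ℝ} (hf : Measurable f)
    {B : ℝ} (hB : ∀ x, |f x| ≤ B) (μ : Measure X) [IsFiniteMeasure μ] : Integrable f μ :=
  integrable_of_measurable_of_ae_bound hf (ae_of_all _ hB)

variable {X : Type*} [MetricSpace X] [MeasurableSpace X] [OpensMeasurableSpace X]

lemma continuous_of_abs_sub_le {Z : Type*} [MetricSpace Z] {f : Z → ℝ} {L : ℝ}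
    (hf : ∀ x y, |f x - f y| ≤ L * dist x y) : Continuous f := by
  refine LipschitzWith.continuous (K := L.toNNReal) (LipschitzWith.of_dist_le_mul fun x y => ?_)
  rw [Real.dist_eq]
  exact (hf x y).trans (mul_le_mul_of_nonneg_right (Real.le_coe_toNNReal L) dist_nonneg)

/-- A 1-Lipschitz function oscillates by at most the diameter. This makes the supremum defining
`wasserstein` bounded above; a real supremum over an unbounded family would be the default value 0.
-/
lemma integral_sub_le_diam (μ ν : Measure X)
    [IsProbabilityMeasure μ] [IsProbabilityMeasure ν] {D : ℝ} (hD : ∀ x y : X, dist x y ≤ D)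
    (f : X → ℝ) (hf : LipschitzWith 1 f) : (∫ y, f y ∂μ) - ∫ y, f y ∂ν ≤ D := by
  have hne : Nonempty X := nonempty_of_isProbabilityMeasure μ
  have hL : ∀ x y, |f x - f y| ≤ 1 * dist x y := fun x y => by
    simpa [Real.dist_eq] using hf.dist_le_mul x y
  have hm := (continuous_of_abs_sub_le hL).measurable
  have hb : ∀ x, |f x| ≤ |f hne.some| + D := fun x => by
    have h1 := hL x hne.some
    have h2 := hD x hne.some
    have h3 := abs_sub_abs_le_abs_sub (f x) (f hne.some)
    linarith
  have iμ := integrable_of_bounded hm hb μ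
  have iν := integrable_of_bounded hm hb ν
  have key : ∀ x, (∫ y, f y ∂μ) ≤ f x + D := fun x => by
    calc (∫ y, f y ∂μ) ≤ ∫ _, f x + D ∂μ := integral_mono iμ (integrable_const _) fun y => by
          have := (abs_le.1 (hL y x)).2
          have := hD y x
          show f y ≤ f x + D
          linarith
      _ = f x + D := by simp
  have : (∫ y, f y ∂μ) - D ≤ ∫ y, f y ∂ν := by
    calc (∫ y, f y ∂μ) - D = ∫ _, ((∫ y, f y ∂μ) - D) ∂ν := by simp
      _ ≤ ∫ y, f y ∂ν := integral_mono (integrable_const _) iν fun x => by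
          have := key x
          show (∫ y, f y ∂μ) - D ≤ f x
          linarith
  linarith

lemma wasserstein_nonneg_and_le (μ ν : Measure X)
    [IsProbabilityMeasure μ] [IsProbabilityMeasure ν] {D : ℝ} (hD : ∀ x y : X, dist x y ≤ D) :
    0 ≤ wasserstein μ ν ∧ wasserstein μ ν ≤ D := by
  have hne : Nonempty {f : X → ℝ // LipschitzWith 1 f} := ⟨⟨fun _ => 0, LipschitzWith.const' 0⟩⟩
  constructor
  · have := le_ciSup (f := fun f : {f : X → ℝ // LipschitzWith 1 f} =>
      (∫ y, f.1 y ∂μ) - ∫ y, f.1 y ∂ν)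
      ⟨D, by rintro _ ⟨f, rfl⟩; exact integral_sub_le_diam μ ν hD f.1 f.2⟩
      ⟨fun _ => 0, LipschitzWith.const' 0⟩
    simpa [wasserstein] using this
  · exact ciSup_le fun f => integral_sub_le_diam μ ν hD f.1 f.2

/-- Integrals of an `L`-Lipschitz function differ by at most `L` times the Wasserstein distance. -/
lemma integral_sub_le_wasserstein (hX : ∃ d, HasCoveringExponent X d) (μ ν : Measure X)
    [IsProbabilityMeasure μ] [IsProbabilityMeasure ν] {f : X → ℝ} {L : ℝ} (hL : 0 ≤ L)
    (hf : ∀ x y, |f x - f y| ≤ L * dist x y) :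
    (∫ y, f y ∂μ) - ∫ y, f y ∂ν ≤ L * wasserstein μ ν := by
  obtain ⟨D, hD⟩ := exists_dist_le hX
  rcases hL.eq_or_lt with rfl | hL
  · have hne : Nonempty X := nonempty_of_isProbabilityMeasure μ
    have : f = fun _ => f hne.some := by
      funext x
      have := hf x hne.some
      rw [zero_mul] at this
      linarith [abs_nonpos_iff.1 this]
    rw [this]; simp
  · have hg : LipschitzWith 1 fun x => f x / L := LipschitzWith.of_dist_le_mul fun x y => by
      rw [Real.dist_eq, ← sub_div, abs_div, abs_of_pos hL, div_le_iff₀ hL]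
      simpa [mul_comm] using hf x y
    have := le_ciSup (f := fun f : {f : X → ℝ // LipschitzWith 1 f} =>
      (∫ y, f.1 y ∂μ) - ∫ y, f.1 y ∂ν)
      ⟨D, by rintro _ ⟨f, rfl⟩; exact integral_sub_le_diam μ ν hD f.1 f.2⟩ ⟨_, hg⟩
    simp only [integral_div] at this
    rw [← sub_div, div_le_iff₀ hL] at this
    rw [mul_comm]; exact this

lemma abs_integral_sub_le {μ ν : Measure X} [IsProbabilityMeasure μ] [IsProbabilityMeasure ν]
    (hX : ∃ d, HasCoveringExponent X d) {f : X → ℝ} {L : ℝ} (hL : 0 ≤ L)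
    (hf : ∀ x y, |f x - f y| ≤ L * dist x y) :
    |(∫ y, f y ∂μ) - ∫ y, f y ∂ν| ≤ L * wasserstein μ ν := by
  rw [abs_le]
  have h1 := integral_sub_le_wasserstein hX μ ν hL hf
  have h2 := integral_sub_le_wasserstein hX μ ν hL (f := fun x => -f x) fun x y => by
    rw [← abs_neg]; convert hf x y using 2; ring
  simp only [integral_neg] at h2
  constructor <;> linarith

end Wasserstein

/-! ### Finite nets and countable dense subsets of bounded Lipschitz functions -/

section FunctionClass

variable {X : Type*} [MetricSpace X]

/-- Capping the index at m - 1 puts the right endpoint m into the last unit cell, so that exactly m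
cells cover [0, m]. -/
lemma abs_sub_le_one_of_min_floor_eq {a b : ℝ} {m : ℕ} (hm : 1 ≤ m) (ha : 0 ≤ a) (hb : 0 ≤ b)
    (ham : a ≤ m) (hbm : b ≤ m) (h : min ⌊a⌋₊ (m - 1) = min ⌊b⌋₊ (m - 1)) : |a - b| ≤ 1 := by
  have a1 := Nat.floor_le ha
  have a2 := Nat.lt_floor_add_one a
  have b1 := Nat.floor_le hb
  have b2 := Nat.lt_floor_add_one b
  rcases lt_or_ge ⌊a⌋₊ (m - 1) with hlt | hge
  · have : ⌊a⌋₊ = ⌊b⌋₊ := by omega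
    rw [this] at a1 a2
    rw [abs_le]; constructor <;> linarith
  · have hge' : m - 1 ≤ ⌊b⌋₊ := by omega
    have e1 : (m : ℝ) - 1 ≤ ⌊a⌋₊ := by
      have : m ≤ ⌊a⌋₊ + 1 := by omega
      have : (m : ℝ) ≤ ⌊a⌋₊ + 1 := by exact_mod_cast this
      linarith
    have e2 : (m : ℝ) - 1 ≤ ⌊b⌋₊ := by
      have : m ≤ ⌊b⌋₊ + 1 := by omega
      have : (m : ℝ) ≤ ⌊b⌋₊ + 1 := by exact_mod_cast this
      linarith
    rw [abs_le]; constructor <;> linarith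

/-- A finite uniform net of the class of bounded Lipschitz functions. -/
lemma exists_net_boundedLipschitz (hX : ∃ d, HasCoveringExponent X d) {L B ε : ℝ} (hL : 0 ≤ L)
    (hB : 0 < B) (hε : 0 < ε) {m : ℕ} (hm : 1 ≤ m) :
    ∃ N : Finset (X → ℝ), (∀ g ∈ N, g ∈ boundedLipschitz X L B) ∧ N.card ≤ m ^ covNum X ε ∧
      ∀ f ∈ boundedLipschitz X L B, ∃ g ∈ N, ∀ x, |f x - g x| ≤ 2 * L * ε + 2 * B / m := by
  classical
  obtain ⟨C, hC, hcov⟩ := exists_net hX hε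
  have hm0 : (0 : ℝ) < m := by exact_mod_cast hm
  -- A function is coded by its values at the points of C, each rounded to one of m cells of [-B,
  -- B]; this gives m^|C| codes.
  let scale : ℝ → ℝ := fun y => (y + B) * m / (2 * B)
  let q : (X → ℝ) → C → Fin m := fun f c => ⟨min ⌊scale (f c)⌋₊ (m - 1), by omega⟩
  -- Representatives are taken inside the class, so they inherit its bounds; a code that no member
  -- attains gets the zero function. Two functions with equal code differ by 2B/m on C and, by two
  -- Lipschitz steps, by 2Lε more elsewhere.
  let rep : (C → Fin m) → X → ℝ := fun j =>
    if h : ∃ f ∈ boundedLipschitz X L B, q f = j then h.choose else fun _ => 0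
  have h0 : (fun _ => 0 : X → ℝ) ∈ boundedLipschitz X L B :=
    ⟨fun x y => by simpa using mul_nonneg hL dist_nonneg, fun x => by simpa using hB.le⟩
  refine ⟨Finset.univ.image rep, ?_, ?_, ?_⟩
  · intro g hg
    obtain ⟨j, -, rfl⟩ := Finset.mem_image.1 hg
    by_cases h : ∃ f ∈ boundedLipschitz X L B, q f = j
    · simp only [rep, dif_pos h]; exact h.choose_spec.1
    · simp only [rep, dif_neg h]; exact h0
  · refine Finset.card_image_le.trans ?_
    rw [Finset.card_univ, Fintype.card_fun, Fintype.card_fin, Fintype.card_coe, hC]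
  · intro f hf
    have h : ∃ g ∈ boundedLipschitz X L B, q g = q f := ⟨f, hf, rfl⟩
    refine ⟨rep (q f), Finset.mem_image_of_mem _ (Finset.mem_univ _), ?_⟩
    have hrep : rep (q f) = h.choose := by simp only [rep, dif_pos h]
    rw [hrep]
    obtain ⟨hg, hqg⟩ := h.choose_spec
    set g := h.choose
    intro x
    obtain ⟨c, hc, hxc⟩ := hcov x
    have hcell : min ⌊scale (f c)⌋₊ (m - 1) = min ⌊scale (g c)⌋₊ (m - 1) := by
      have := congrFun hqg ⟨c, hc⟩
      simp only [q, Fin.mk.injEq] at this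
      exact this.symm
    have hs : ∀ y, |y| ≤ B → 0 ≤ scale y ∧ scale y ≤ m := by
      intro y hy
      obtain ⟨h1, h2⟩ := abs_le.1 hy
      refine ⟨div_nonneg (mul_nonneg (by linarith) hm0.le) (by linarith), ?_⟩
      simp only [scale]
      rw [div_le_iff₀ (by linarith)]
      nlinarith
    have h1 := abs_sub_le_one_of_min_floor_eq hm (hs _ (hf.2 c)).1 (hs _ (hg.2 c)).1
      (hs _ (hf.2 c)).2 (hs _ (hg.2 c)).2 hcell
    have h2 : |f c - g c| ≤ 2 * B / m := by
      have e : scale (f c) - scale (g c) = (f c - g c) * (m / (2 * B)) := by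
        simp only [scale]; ring
      rw [e, abs_mul, abs_of_pos (by positivity : (0 : ℝ) < m / (2 * B))] at h1
      rw [le_div_iff₀ hm0]
      rw [mul_div_assoc', div_le_one (by positivity)] at h1
      exact h1
    have h3 := hf.1 x c
    have h4 := hg.1 c x
    rw [dist_comm] at h4
    have h5 : L * dist x c ≤ L * ε := mul_le_mul_of_nonneg_left hxc hL
    calc |f x - g x| = |(f x - f c) + (f c - g c) + (g c - g x)| := by ring_nf
      _ ≤ |f x - f c| + |f c - g c| + |g c - g x| := abs_add_three _ _ _
      _ ≤ _ := by linarith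

/-- A countable subset of the class that is dense for uniform approximation. -/
lemma exists_countable_dense_boundedLipschitz (hX : ∃ d, HasCoveringExponent X d) {L B : ℝ}
    (hL : 0 ≤ L) (hB : 0 < B) :
    ∃ N : Set (X → ℝ), N.Countable ∧ N ⊆ boundedLipschitz X L B ∧
      ∀ f ∈ boundedLipschitz X L B, ∀ ε > 0, ∃ g ∈ N, ∀ x, |f x - g x| ≤ ε := by
  have key : ∀ n : ℕ, ∃ N : Finset (X → ℝ), (∀ g ∈ N, g ∈ boundedLipschitz X L B) ∧
      ∀ f ∈ boundedLipschitz X L B, ∃ g ∈ N, ∀ x, |f x - g x| ≤ 2 * (L + B) * (1 / (n + 1)) := by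
    intro n
    obtain ⟨N, h1, -, h2⟩ := exists_net_boundedLipschitz hX hL hB (ε := 1 / (n + 1))
      (by positivity) (m := n + 1) (by omega)
    refine ⟨N, h1, fun f hf => ?_⟩
    obtain ⟨g, hg, hfg⟩ := h2 f hf
    refine ⟨g, hg, fun x => (hfg x).trans (le_of_eq ?_)⟩
    push_cast; ring
  choose N hN hcov using key
  refine ⟨⋃ n, (N n : Set (X → ℝ)), countable_iUnion fun n => (N n).countable_toSet,
    iUnion_subset fun n g hg => hN n g hg, fun f hf ε hε => ?_⟩
  have hLB : 0 < 2 * (L + B) := by linarith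
  obtain ⟨n, hn⟩ := exists_nat_one_div_lt (div_pos hε hLB)
  obtain ⟨g, hg, hfg⟩ := hcov n f hf
  refine ⟨g, mem_iUnion.2 ⟨n, hg⟩, fun x => (hfg x).trans ?_⟩
  rw [lt_div_iff₀ hLB] at hn
  linarith

end FunctionClass

/-! ### Regularity of the optimal value functions -/

section ValueFunctions

lemma integral_mem_Icc {X : Type*} [MeasurableSpace X] {ν : Measure X} [IsProbabilityMeasure ν] {f : X → ℝ} (hf : Measurable f)
    {a b : ℝ} (h : ∀ x, f x ∈ Icc a b) : ∫ y, f y ∂ν ∈ Icc a b := by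
  have hi : Integrable f ν := integrable_of_bounded hf (B := max |a| |b|)
    (fun x => abs_le_max_abs_abs (h x).1 (h x).2) ν
  constructor
  · calc a = ∫ _, a ∂ν := by simp
      _ ≤ _ := integral_mono (integrable_const _) hi fun x => (h x).1
  · calc ∫ y, f y ∂ν ≤ ∫ _, b ∂ν := integral_mono hi (integrable_const _) fun x => (h x).2
      _ = b := by simp

lemma MDP.step_mem {X A : Type*} [MeasurableSpace X] [MeasurableSpace A]
    {M : MDP X A} {k : ℕ} {f : X → ℝ} (hf : Measurable f) {n : ℕ} (h : ∀ x, f x ∈ Icc (0 : ℝ) n) (j : ℕ)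
    (u : X × A) : M.r k j u + ∫ y, f y ∂(M.P k j u) ∈ Icc (0 : ℝ) (n + 1 : ℕ) := by
  have := M.markov k j
  have h1 := M.r_mem k j u
  have h2 := integral_mem_Icc (ν := M.P k j u) hf h
  push_cast
  exact ⟨by linarith [h1.1, h2.1], by linarith [h1.2, h2.2]⟩

lemma MDP.valueToGo_props {X A : Type*} [MeasurableSpace X] [MeasurableSpace A]
    {M : MDP X A} {H k : ℕ} (π : ℕ → X → A) (hπ : ∀ j, Measurable (π j))
    (n : ℕ) :
    Measurable (M.valueToGo H k π n) ∧ ∀ x, M.valueToGo H k π n x ∈ Icc (0 : ℝ) n := by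
  induction n with
  | zero => exact ⟨measurable_const, fun x => by simp [MDP.valueToGo]⟩
  | succ n ih =>
    obtain ⟨hmeas, hmem⟩ := ih
    have hu : Measurable fun x => (x, π (H - n) x) := measurable_id.prodMk (hπ _)
    constructor
    · have h1 : Measurable fun u => ∫ y, M.valueToGo H k π n y ∂(M.P k (H - n) u) := by
        have := M.markov k (H - n)
        exact (hmeas.stronglyMeasurable.integral_kernel).measurable
      exact ((M.measurable_r k (H - n)).comp hu).add (h1.comp hu)
    · exact fun x => MDP.step_mem hmeas hmem _ _

/-- A measurable selection of nearly optimal actions for a function that is Lipschitz in the state. -/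
lemma exists_measurable_selection {X A : Type*} [MetricSpace X]
    [MeasurableSpace X] [BorelSpace X] [MeasurableSpace A] [Nonempty A]
    (hX : ∃ d, HasCoveringExponent X d)
    {Q : X → A → ℝ} {L : ℝ} (hL : 0 ≤ L) (hQ : ∀ x x' a, Q x a ≤ Q x' a + L * dist x x')
    (hb : ∀ x, BddAbove (range (Q x))) {ε : ℝ} (hε : 0 < ε) :
    ∃ p : X → A, Measurable p ∧ ∀ x, ⨆ a, Q x a ≤ Q x (p x) + ε := by
  rcases isEmpty_or_nonempty X with hE | hE
  · exact ⟨fun _ => Classical.arbitrary A, measurable_const, fun x => (hE.false x).elim⟩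
  -- With this radius, two Lipschitz steps and one near-maximization cost (2L + 1) · ε/(2L + 1) = ε.
  have hδ : 0 < ε / (2 * L + 1) := by positivity
  obtain ⟨C, -, hcov⟩ := exists_net hX hδ
  let e : ℕ → X := fun i => C.toList.getD i (Classical.arbitrary X)
  -- Acting according to the nearest net point gives a policy with finitely many pieces, hence a
  -- measurable one; no selection theorem and no structure on A are required.
  let near := SimpleFunc.nearestPt e C.toList.length
  have hnear : ∀ x, dist (near x) x ≤ ε / (2 * L + 1) := by
    intro x
    obtain ⟨c, hc, hxc⟩ := hcov x
    obtain ⟨i, hi, hic⟩ := List.mem_iff_getElem.1 (Finset.mem_toList.2 hc)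
    have h1 := SimpleFunc.edist_nearestPt_le e x hi.le
    have h2 : e i = c := by simp only [e]; rw [List.getD_eq_getElem _ _ hi, hic]
    rw [h2, edist_dist, edist_dist, ENNReal.ofReal_le_ofReal_iff dist_nonneg, dist_comm c x] at h1
    exact h1.trans hxc
  have hact : ∀ x, ∃ a, (⨆ a, Q x a) - ε / (2 * L + 1) < Q x a := fun x =>
    exists_lt_of_lt_ciSup (by linarith)
  choose act hact using hact
  refine ⟨fun x => act (near x), (near.map act).measurable, fun x => ?_⟩
  have hsup : ⨆ a, Q x a ≤ (⨆ a, Q (near x) a) + L * dist (near x) x :=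
    ciSup_le fun a => by
      rw [dist_comm]
      exact (hQ x (near x) a).trans (add_le_add (le_ciSup (hb _) a) le_rfl)
  have h1 := hQ (near x) x (act (near x))
  have h2 := hact (near x)
  have h3 := mul_le_mul_of_nonneg_left (hnear x) hL
  have h4 : 2 * (L * (ε / (2 * L + 1))) + ε / (2 * L + 1) = ε := by field_simp
  linarith

variable {X A : Type*} [MetricSpace X] [MeasurableSpace X] [BorelSpace X] [MeasurableSpace A]
  [MetricSpace (X × A)] {M : MDP X A} {K H k : ℕ} {Lr Lp : ℝ}

/-- The optimal value when `n` steps are left, by backward recursion over the actions. -/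
noncomputable def MDP.bellman (M : MDP X A) (H k : ℕ) : ℕ → X → ℝ
  | 0 => fun _ => 0
  | n + 1 => fun x => ⨆ a, (M.r k (H - n) (x, a)
      + ∫ y, M.bellman H k n y ∂(M.P k (H - n) (x, a)))

lemma lipQ_nonneg (hLr : 0 ≤ Lr) (hLp : 0 ≤ Lp) (n : ℕ) : 0 ≤ lipQ n Lr Lp :=
  Finset.sum_nonneg fun _ _ => mul_nonneg hLr (pow_nonneg hLp _)

/-- One Bellman step multiplies a Lipschitz constant by L_p and adds L_r. -/
lemma lipQ_succ (n : ℕ) : lipQ (n + 1) Lr Lp = Lr + lipQ n Lr Lp * Lp := by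
  rw [lipQ, lipQ, Finset.sum_range_succ', Finset.sum_mul, add_comm]
  simp [pow_succ, mul_assoc]

lemma lipQ_mono (hLr : 0 ≤ Lr) (hLp : 0 ≤ Lp) {n n' : ℕ} (h : n ≤ n') :
    lipQ n Lr Lp ≤ lipQ n' Lr Lp :=
  Finset.sum_le_sum_of_subset_of_nonneg (Finset.range_mono h)
    fun _ _ _ => mul_nonneg hLr (pow_nonneg hLp _)

lemma lipQ_pos (hLr : 0 < Lr) (hLp : 0 ≤ Lp) (hH : 1 ≤ H) : 0 < lipQ H Lr Lp := by
  have h1 : lipQ 1 Lr Lp = Lr := by simp [lipQ]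
  exact hLr.trans_le (h1.symm.le.trans (lipQ_mono hLr.le hLp hH))

/-- Integration of Lipschitz functions against the transition kernels preserves Lipschitz
continuity. -/
lemma MDP.IsLipschitz.abs_integral_sub_le (hM : M.IsLipschitz K H Lr Lp)
    (hX : ∃ d, HasCoveringExponent X d) {h : ℕ}
    (hk : k ∈ Finset.Icc 1 K) (hh : h ∈ Finset.Icc 1 H) {f : X → ℝ} {L : ℝ} (hL : 0 ≤ L)
    (hf : ∀ x y, |f x - f y| ≤ L * dist x y) (u v : X × A) :
    |(∫ y, f y ∂(M.P k h u)) - ∫ y, f y ∂(M.P k h v)| ≤ L * Lp * dist u v := by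
  have := M.markov k h
  refine (KernelRL.abs_integral_sub_le hX hL hf).trans ?_
  rw [mul_assoc]
  exact mul_le_mul_of_nonneg_left (hM.transition k hk h hh u v) hL

/-- A supremum of functions with a common Lipschitz constant in the state is again Lipschitz.
Continuity is carried through the induction also because it supplies measurability, which a supremum
over uncountably many actions does not. -/
lemma MDP.IsLipschitz.bellman_props [Nonempty A] (hM : M.IsLipschitz K H Lr Lp)
    (hdist : ∀ (x x' : X) (a : A), dist (x, a) (x', a) ≤ dist x x')
    (hX : ∃ d, HasCoveringExponent X d) (hLr : 0 ≤ Lr) (hLp : 0 ≤ Lp) (hk : k ∈ Finset.Icc 1 K)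
    (n : ℕ) (hn : n ≤ H) :
    (∀ x, M.bellman H k n x ∈ Icc (0 : ℝ) n) ∧
      ∀ x y, |M.bellman H k n x - M.bellman H k n y| ≤ lipQ n Lr Lp * dist x y := by
  induction n with
  | zero =>
    refine ⟨fun x => by simp [MDP.bellman], fun x y => by simp [MDP.bellman, lipQ]⟩
  | succ n ih =>
    obtain ⟨hmem, hlip⟩ := ih (by omega)
    have hmeas : Measurable (M.bellman H k n) := (continuous_of_abs_sub_le hlip).measurable
    have hh : H - n ∈ Finset.Icc 1 H := by rw [Finset.mem_Icc]; omega
    set Q : X × A → ℝ := fun u => M.r k (H - n) u + ∫ y, M.bellman H k n y ∂(M.P k (H - n) u)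
      with hQ
    have hQmem : ∀ u, Q u ∈ Icc (0 : ℝ) (n + 1 : ℕ) := fun u => MDP.step_mem hmeas hmem _ u
    have hQlip : ∀ x x' a, Q (x, a) ≤ Q (x', a) + lipQ (n + 1) Lr Lp * dist x x' := by
      intro x x' a
      have h1 := (abs_le.1 (hM.reward k hk _ hh (x, a) (x', a))).2
      have h2 := (abs_le.1 (hM.abs_integral_sub_le hX hk hh (lipQ_nonneg hLr hLp n) hlip
        (x, a) (x', a))).2
      have h3 := mul_le_mul_of_nonneg_left (hdist x x' a) (lipQ_nonneg hLr hLp (n + 1))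
      rw [lipQ_succ] at h3 ⊢
      simp only [hQ]
      linarith
    have hbdd : ∀ x, BddAbove (range fun a => Q (x, a)) := fun x =>
      ⟨_, by rintro _ ⟨a, rfl⟩; exact (hQmem (x, a)).2⟩
    have hW : ∀ x, M.bellman H k (n + 1) x = ⨆ a, Q (x, a) := fun x => rfl
    have hle : ∀ x x', M.bellman H k (n + 1) x
        ≤ M.bellman H k (n + 1) x' + lipQ (n + 1) Lr Lp * dist x x' := by
      intro x x'
      rw [hW, hW]
      exact ciSup_le fun a => (hQlip x x' a).trans
        (add_le_add (le_ciSup (hbdd x') a) le_rfl)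
    refine ⟨fun x => ?_, fun x y => ?_⟩
    · rw [hW]
      exact ⟨(hQmem (x, Classical.arbitrary A)).1.trans (le_ciSup (hbdd x) _),
        ciSup_le fun a => (hQmem (x, a)).2⟩
    · have h1 := hle x y
      have h2 := hle y x
      rw [dist_comm y x] at h2
      rw [abs_le]; constructor <;> linarith

lemma MDP.IsLipschitz.valueToGo_le_bellman [Nonempty A] (hM : M.IsLipschitz K H Lr Lp)
    (hdist : ∀ (x x' : X) (a : A), dist (x, a) (x', a) ≤ dist x x')
    (hX : ∃ d, HasCoveringExponent X d) (hLr : 0 ≤ Lr) (hLp : 0 ≤ Lp) (hk : k ∈ Finset.Icc 1 K)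
    (π : ℕ → X → A) (hπ : ∀ j, Measurable (π j)) (n : ℕ) (hn : n ≤ H) (x : X) :
    M.valueToGo H k π n x ≤ M.bellman H k n x := by
  induction n generalizing x with
  | zero => simp [MDP.valueToGo, MDP.bellman]
  | succ n ih =>
    obtain ⟨hmem, hlip⟩ := hM.bellman_props hdist hX hLr hLp hk n (by omega)
    obtain ⟨vmeas, vmem⟩ := MDP.valueToGo_props (M := M) (H := H) (k := k) π hπ n
    have hmeas : Measurable (M.bellman H k n) := (continuous_of_abs_sub_le hlip).measurable
    have hb : ∀ {f : X → ℝ}, (∀ x, f x ∈ Icc (0 : ℝ) n) → ∀ x, |f x| ≤ n := fun hf x => by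
      rw [abs_of_nonneg (hf x).1]; exact (hf x).2
    have := M.markov k (H - n)
    have h1 : ∫ y, M.valueToGo H k π n y ∂(M.P k (H - n) (x, π (H - n) x))
        ≤ ∫ y, M.bellman H k n y ∂(M.P k (H - n) (x, π (H - n) x)) :=
      integral_mono (integrable_of_bounded vmeas (hb vmem) _)
        (integrable_of_bounded hmeas (hb hmem) _) fun y => ih (by omega) y
    refine (add_le_add le_rfl h1).trans ?_
    exact le_ciSup (f := fun a => M.r k (H - n) (x, a)
      + ∫ y, M.bellman H k n y ∂(M.P k (H - n) (x, a)))
      ⟨_, by rintro _ ⟨a, rfl⟩; exact (MDP.step_mem hmeas hmem _ (x, a)).2⟩ (π (H - n) x)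

/-- Near-optimal actions are selected separately at each step with loss ε, and the losses add up
along the recursion. -/
lemma MDP.IsLipschitz.exists_policy [Nonempty A] (hM : M.IsLipschitz K H Lr Lp)
    (hdist : ∀ (x x' : X) (a : A), dist (x, a) (x', a) ≤ dist x x')
    (hX : ∃ d, HasCoveringExponent X d) (hLr : 0 ≤ Lr) (hLp : 0 ≤ Lp) (hk : k ∈ Finset.Icc 1 K)
    {ε : ℝ} (hε : 0 < ε) :
    ∃ π : ℕ → X → A, (∀ j, Measurable (π j)) ∧
      ∀ n ≤ H, ∀ x, M.bellman H k n x ≤ M.valueToGo H k π n x + n * ε := by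
  have sel : ∀ n : ℕ, ∃ p : X → A, Measurable p ∧ (n < H → ∀ x, M.bellman H k (n + 1) x
      ≤ M.r k (H - n) (x, p x) + (∫ y, M.bellman H k n y ∂(M.P k (H - n) (x, p x))) + ε) := by
    intro n
    by_cases hn : n < H
    swap
    · exact ⟨fun _ => Classical.arbitrary A, measurable_const, fun h => absurd h hn⟩
    obtain ⟨hmem, hlip⟩ := hM.bellman_props hdist hX hLr hLp hk n hn.le
    have hmeas : Measurable (M.bellman H k n) := (continuous_of_abs_sub_le hlip).measurable
    have hh : H - n ∈ Finset.Icc 1 H := by rw [Finset.mem_Icc]; omega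
    obtain ⟨p, hp, hpx⟩ := exists_measurable_selection hX (A := A)
      (Q := fun x a => M.r k (H - n) (x, a) + ∫ y, M.bellman H k n y ∂(M.P k (H - n) (x, a)))
      (lipQ_nonneg hLr hLp (n + 1))
      (by
        intro x x' a
        have h1 := (abs_le.1 (hM.reward k hk _ hh (x, a) (x', a))).2
        have h2 := (abs_le.1 (hM.abs_integral_sub_le hX hk hh (lipQ_nonneg hLr hLp n) hlip
          (x, a) (x', a))).2
        have h3 := mul_le_mul_of_nonneg_left (hdist x x' a) (lipQ_nonneg hLr hLp (n + 1))
        rw [lipQ_succ] at h3 ⊢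
        linarith)
      (fun x => ⟨_, by rintro _ ⟨a, rfl⟩; exact (MDP.step_mem hmeas hmem _ (x, a)).2⟩) hε
    exact ⟨p, hp, fun _ => hpx⟩
  choose p hp hpx using sel
  -- Selections are indexed by the number of remaining steps after the current one, policies by the
  -- step; j = H - n translates between the two.
  refine ⟨fun j => p (H - j), fun j => hp _, fun n => ?_⟩
  induction n with
  | zero => intro _ x; simp [MDP.bellman, MDP.valueToGo]
  | succ n ih =>
    intro hn x
    have hsub : H - (H - n) = n := by omega
    obtain ⟨hmem, hlip⟩ := hM.bellman_props hdist hX hLr hLp hk n (by omega)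
    obtain ⟨vmeas, vmem⟩ := MDP.valueToGo_props (M := M) (H := H) (k := k)
      (fun j => p (H - j)) (fun j => hp _) n
    have hmeas : Measurable (M.bellman H k n) := (continuous_of_abs_sub_le hlip).measurable
    have hb : ∀ {f : X → ℝ}, (∀ x, f x ∈ Icc (0 : ℝ) n) → ∀ x, |f x| ≤ n := fun hf x => by
      rw [abs_of_nonneg (hf x).1]; exact (hf x).2
    have := M.markov k (H - n)
    have iv := integrable_of_bounded vmeas (hb vmem) (M.P k (H - n) (x, p n x))
    have h1 : ∫ y, M.bellman H k n y ∂(M.P k (H - n) (x, p n x))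
        ≤ (∫ y, M.valueToGo H k (fun j => p (H - j)) n y ∂(M.P k (H - n) (x, p n x))) + n * ε := by
      calc _ ≤ ∫ y, (M.valueToGo H k (fun j => p (H - j)) n y + n * ε)
            ∂(M.P k (H - n) (x, p n x)) :=
          integral_mono (integrable_of_bounded hmeas (hb hmem) _)
            (iv.add (integrable_const _)) fun y => ih (by omega) y
        _ = _ := by rw [integral_add iv (integrable_const _)]; simp
    have h2 := hpx n hn x
    simp only [MDP.valueToGo, hsub]
    push_cast
    linarith

/-- No policy beats the recursion, and near-optimal measurable policies approach it. The recursive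
form is the one whose Lipschitz constant can be followed step by step. -/
lemma MDP.IsLipschitz.optimalValue_eq [Nonempty A] (hM : M.IsLipschitz K H Lr Lp)
    (hdist : ∀ (x x' : X) (a : A), dist (x, a) (x', a) ≤ dist x x')
    (hX : ∃ d, HasCoveringExponent X d) (hLr : 0 ≤ Lr) (hLp : 0 ≤ Lp) (hk : k ∈ Finset.Icc 1 K)
    {h : ℕ} (hh : 1 ≤ h) : M.optimalValue H k h = M.bellman H k (H + 1 - h) := by
  funext x
  have hn : H + 1 - h ≤ H := by omega
  have : Nonempty {π : ℕ → X → A // ∀ j, Measurable (π j)} :=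
    ⟨fun _ _ => Classical.arbitrary A, fun _ => measurable_const⟩
  refine le_antisymm (ciSup_le fun π =>
    hM.valueToGo_le_bellman hdist hX hLr hLp hk π.1 π.2 _ hn x) ?_
  refine le_of_forall_pos_le_add fun ε hε => ?_
  -- At most H losses accumulate; H + 1 avoids a division by zero.
  obtain ⟨π, hπ, hπx⟩ := hM.exists_policy hdist hX hLr hLp hk (ε := ε / (H + 1)) (by positivity)
  have h1 := hπx _ hn x
  have h2 := le_ciSup (f := fun π : {π : ℕ → X → A // ∀ j, Measurable (π j)} =>
    M.policyValue H π.1 k h x)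
    ⟨_, by rintro _ ⟨π, rfl⟩; exact (MDP.valueToGo_props π.1 π.2 _).2 x |>.2⟩ ⟨π, hπ⟩
  have h3 : ((H + 1 - h : ℕ) : ℝ) * (ε / (H + 1)) ≤ ε := by
    rw [mul_div_assoc', div_le_iff₀ (by positivity), mul_comm]
    refine mul_le_mul_of_nonneg_left ?_ hε.le
    exact_mod_cast hn.trans (Nat.le_succ H)
  exact (h1.trans (add_le_add h2 h3))

/-- The optimal value functions are Lipschitz and bounded by the horizon. -/
lemma MDP.IsLipschitz.optimalValue_mem [Nonempty A] (hM : M.IsLipschitz K H Lr Lp)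
    (hdist : ∀ (x x' : X) (a : A), dist (x, a) (x', a) ≤ dist x x')
    (hX : ∃ d, HasCoveringExponent X d) (hLr : 0 ≤ Lr) (hLp : 0 ≤ Lp) (hk : k ∈ Finset.Icc 1 K)
    {h : ℕ} (hh : 1 ≤ h) : M.optimalValue H k h ∈ boundedLipschitz X (lipQ H Lr Lp) H := by
  rw [hM.optimalValue_eq hdist hX hLr hLp hk hh]
  have hn : H + 1 - h ≤ H := by omega
  obtain ⟨hmem, hlip⟩ := hM.bellman_props hdist hX hLr hLp hk _ hn
  refine ⟨fun x y => (hlip x y).trans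
    (mul_le_mul_of_nonneg_right (lipQ_mono hLr hLp hn) dist_nonneg), fun x => ?_⟩
  rw [abs_of_nonneg (hmem x).1]
  exact (hmem x).2.trans (by exact_mod_cast hn)

end ValueFunctions

/-! ### Kernel weights: spatial bias, error decomposition, dependence on the query point -/

section Weights

variable {Ω X A : Type*} [MetricSpace (X × A)] {κ : KernelSpec} {T : Trajectory Ω X A}

lemma weight_mem (k h s : ℕ) (u : X × A) (ω : Ω) : weight κ T k h s u ω ∈ Icc (0 : ℝ) 1 :=
  κ.Γ_mem _ _ (div_nonneg dist_nonneg κ.σ_pos.le)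

lemma abs_weight_sub_le (k h s : ℕ) (u v : X × A) (ω : Ω) :
    |weight κ T k h s u ω - weight κ T k h s v ω| ≤ κ.C₂ * (dist u v / κ.σ) := by
  refine (κ.Γ_lipschitz _ _ _ (div_nonneg dist_nonneg κ.σ_pos.le)
    (div_nonneg dist_nonneg κ.σ_pos.le)).trans ?_
  refine mul_le_mul_of_nonneg_left ?_ κ.C₂_pos.le
  rw [← sub_div, abs_div, abs_of_pos κ.σ_pos]
  exact div_le_div_of_nonneg_right (abs_dist_sub_le _ _ _) κ.σ_pos.le

lemma β_le_count (k h : ℕ) (u : X × A) (ω : Ω) : κ.β ≤ count κ T k h u ω :=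
  le_add_of_nonneg_right (Finset.sum_nonneg fun s _ => (weight_mem k h s u ω).1)

lemma count_pos (k h : ℕ) (u : X × A) (ω : Ω) : 0 < count κ T k h u ω :=
  κ.β_pos.trans_le (β_le_count k h u ω)

lemma sum_weight_le_count (k h : ℕ) (u : X × A) (ω : Ω) :
    ∑ s ∈ Finset.Ico 1 k, weight κ T k h s u ω ≤ count κ T k h u ω :=
  le_add_of_nonneg_left κ.β_pos.le

lemma continuous_weight (k h s : ℕ) (ω : Ω) : Continuous fun u => weight κ T k h s u ω :=
  continuous_of_abs_sub_le (L := κ.C₂ / κ.σ) fun u v =>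
    (abs_weight_sub_le k h s u v ω).trans (le_of_eq (by ring))

lemma continuous_count (k h : ℕ) (ω : Ω) : Continuous fun u => count κ T k h u ω :=
  continuous_const.add (continuous_finsetSum _ fun s _ => continuous_weight k h s ω)

lemma sum_abs_weight_sub_le {K k : ℕ} (hk : k ∈ Finset.Icc 1 K) (h : ℕ) {u v : X × A} {r : ℝ}
    (hr : dist u v ≤ r) (ω : Ω) :
    ∑ s ∈ Finset.Ico 1 k, |weight κ T k h s u ω - weight κ T k h s v ω|
      ≤ K * (κ.C₂ * (r / κ.σ)) := by
  have hr0 : 0 ≤ r := dist_nonneg.trans hr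
  have hpos : 0 ≤ κ.C₂ * (r / κ.σ) :=
    mul_nonneg κ.C₂_pos.le (div_nonneg hr0 κ.σ_pos.le)
  calc _ ≤ ∑ s ∈ Finset.Ico 1 k, κ.C₂ * (r / κ.σ) := Finset.sum_le_sum fun s _ =>
        (abs_weight_sub_le k h s u v ω).trans (mul_le_mul_of_nonneg_left
          (div_le_div_of_nonneg_right hr κ.σ_pos.le) κ.C₂_pos.le)
    _ ≤ _ := by
        rw [Finset.sum_const, Nat.card_Ico, nsmul_eq_mul]
        refine mul_le_mul_of_nonneg_right ?_ hpos
        have := (Finset.mem_Icc.1 hk).2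
        exact_mod_cast (by omega : k - 1 ≤ K)

lemma mul_exp_neg_sq_le_one (x : ℝ) : x * Real.exp (-x ^ 2 / 2) ≤ 1 := by
  have h1 := Real.add_one_le_exp (x ^ 2 / 2)
  have h2 : x ≤ Real.exp (x ^ 2 / 2) := by nlinarith [sq_nonneg (x - 1)]
  rw [neg_div, Real.exp_neg, ← div_eq_mul_inv]
  exact (div_le_one (Real.exp_pos _)).2 h2

/-- The threshold τ satisfies a ≤ exp(τ²/2), and z² - τ² ≥ (z - τ)² beyond it; so a is absorbed and
y exp(-y²/2) ≤ 1 remains, with y = z - τ. -/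
lemma gaussian_tail_le {a z : ℝ} (ha : 0 < a) (hz : √(2 * Real.posLog a) ≤ z) :
    a * Real.exp (-z ^ 2 / 2) * (z - √(2 * Real.posLog a)) ≤ 1 := by
  set τ := √(2 * Real.posLog a) with hτ
  have hτ0 : 0 ≤ τ := Real.sqrt_nonneg _
  have hτ2 : τ ^ 2 = 2 * Real.posLog a :=
    Real.sq_sqrt (mul_nonneg zero_le_two Real.posLog_nonneg)
  have ha' : a ≤ Real.exp (τ ^ 2 / 2) := by
    rw [← Real.log_le_iff_le_exp ha, hτ2]
    have : Real.log a ≤ Real.posLog a := le_max_right _ _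
    linarith
  calc a * Real.exp (-z ^ 2 / 2) * (z - τ)
      ≤ Real.exp (τ ^ 2 / 2) * Real.exp (-z ^ 2 / 2) * (z - τ) := by
        gcongr
    _ ≤ Real.exp (-(z - τ) ^ 2 / 2) * (z - τ) := by
        rw [← Real.exp_add]
        refine mul_le_mul_of_nonneg_right (Real.exp_le_exp.2 ?_) (by linarith)
        nlinarith [mul_nonneg hτ0 (sub_nonneg.2 hz)]
    _ ≤ 1 := by rw [mul_comm]; exact mul_exp_neg_sq_le_one _

/-- The weighted mean distance between `u` and the data is of the order of the bandwidth. -/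
lemma sum_weight_mul_dist_le {k : ℕ} (hk : 1 ≤ k) (h : ℕ) (u : X × A) (ω : Ω) :
    ∑ s ∈ Finset.Ico 1 k, weight κ T k h s u ω * dist u (T.x s h ω, T.a s h ω)
      ≤ 2 * κ.σ * spatialFactor κ k * count κ T k h u ω := by
  have hk0 : (0 : ℝ) < k := by exact_mod_cast hk
  have hβ := κ.β_pos
  have hσ := κ.σ_pos
  have hC := κ.C₁_pos
  set a : ℝ := κ.C₁ * k / κ.β with ha
  have ha0 : 0 < a := by positivity
  set τ := √(2 * Real.posLog a) with hτ
  have hτ0 : 0 ≤ τ := Real.sqrt_nonneg _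
  have hτle : τ + 1 ≤ 2 * spatialFactor κ k := by
    have : τ ≤ 2 * √(Real.posLog a) := by
      rw [hτ, Real.sqrt_le_left (by positivity), mul_pow, Real.sq_sqrt Real.posLog_nonneg]
      linarith [Real.posLog_nonneg (x := a)]
    rw [spatialFactor, ← ha]; linarith
  -- Up to the threshold τ the distance is at most τσ. Beyond it, a = C₁k/β is chosen so that the
  -- excess is at most β/k per episode, hence at most β ≤ `count` in total.
  have hterm : ∀ s, weight κ T k h s u ω * dist u (T.x s h ω, T.a s h ω)
      ≤ κ.σ * (τ * weight κ T k h s u ω + κ.β / k) := by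
    intro s
    obtain ⟨w0, w1⟩ := weight_mem (κ := κ) (T := T) k h s u ω
    set z := dist u (T.x s h ω, T.a s h ω) / κ.σ with hz
    have hz0 : 0 ≤ z := div_nonneg dist_nonneg hσ.le
    have hd : dist u (T.x s h ω, T.a s h ω) = κ.σ * z := by rw [hz]; field_simp
    have hw : weight κ T k h s u ω ≤ κ.C₁ * Real.exp (-z ^ 2 / 2) := κ.Γ_gaussian _ _ hz0
    rw [hd]
    have : weight κ T k h s u ω * (z - τ) ≤ κ.β / k := by
      rcases le_total z τ with hzt | hzt
      · exact (mul_nonpos_of_nonneg_of_nonpos w0 (by linarith)).trans (by positivity)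
      · calc weight κ T k h s u ω * (z - τ) ≤ κ.C₁ * Real.exp (-z ^ 2 / 2) * (z - τ) :=
              mul_le_mul_of_nonneg_right hw (by linarith)
          _ = (κ.β / k) * (a * Real.exp (-z ^ 2 / 2) * (z - τ)) := by rw [ha]; field_simp
          _ ≤ (κ.β / k) * 1 := mul_le_mul_of_nonneg_left (gaussian_tail_le ha0 hzt) (by positivity)
          _ = κ.β / k := mul_one _
    nlinarith
  have hC0 := count_pos (κ := κ) (T := T) k h u ω
  calc _ ≤ ∑ s ∈ Finset.Ico 1 k, κ.σ * (τ * weight κ T k h s u ω + κ.β / k) :=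
        Finset.sum_le_sum fun s _ => hterm s
    _ = κ.σ * (τ * ∑ s ∈ Finset.Ico 1 k, weight κ T k h s u ω + (k - 1 : ℕ) * (κ.β / k)) := by
        rw [← Finset.mul_sum, Finset.sum_add_distrib, ← Finset.mul_sum, Finset.sum_const,
          Nat.card_Ico, nsmul_eq_mul]
    _ ≤ κ.σ * (τ * count κ T k h u ω + 1 * count κ T k h u ω) := by
        refine mul_le_mul_of_nonneg_left (add_le_add (mul_le_mul_of_nonneg_left
          (sum_weight_le_count k h u ω) hτ0) ?_) hσ.le
        rw [one_mul]
        refine le_trans ?_ (β_le_count k h u ω)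
        rw [mul_div_assoc', div_le_iff₀ hk0, mul_comm]
        exact mul_le_mul_of_nonneg_left (by exact_mod_cast Nat.sub_le k 1) hβ.le
    _ = κ.σ * (τ + 1) * count κ T k h u ω := by ring
    _ ≤ _ := by
        refine mul_le_mul_of_nonneg_right ?_ hC0.le
        nlinarith

/-- The weighted sum of the deviations of `Z s` from the means `m s` at the visited points. -/
noncomputable def weightedDeviation (κ : KernelSpec) (T : Trajectory Ω X A) (k h : ℕ) (Z : ℕ → ℝ)
    (m : ℕ → X × A → ℝ) (u : X × A) (ω : Ω) : ℝ :=
  ∑ s ∈ Finset.Ico 1 k, weight κ T k h s u ω * (Z s - m s (T.x s h ω, T.a s h ω))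

/-- The error of a kernel estimate, in terms of noise, spatial bias and regularization bias. -/
lemma abs_estimate_sub_average_le {k : ℕ} (hk : 1 ≤ k) (h : ℕ) (Z : ℕ → ℝ) (m : ℕ → X × A → ℝ)
    {Λ B : ℝ} (hΛ : 0 ≤ Λ) (u : X × A) (ω : Ω)
    (hm : ∀ s ∈ Finset.Ico 1 k, ∀ v, |m s v - m s u| ≤ Λ * dist u v) (hB : |m k u| ≤ B) :
    |∑ s ∈ Finset.Ico 1 k, normWeight κ T k h s u ω * Z s -
      (∑ s ∈ Finset.Ico 1 k, normWeight κ T k h s u ω * m s u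
        + κ.β * m k u / count κ T k h u ω)| ≤
      |weightedDeviation κ T k h Z m u ω| / count κ T k h u ω
        + 2 * Λ * spatialFactor κ k * κ.σ + κ.β * B / count κ T k h u ω := by
  have hC := count_pos (κ := κ) (T := T) k h u ω
  set C := count κ T k h u ω with hCdef
  -- The unnormalized spatial bias.
  set D : ℝ := ∑ s ∈ Finset.Ico 1 k,
    weight κ T k h s u ω * (m s (T.x s h ω, T.a s h ω) - m s u) with hD
  have e : ∑ s ∈ Finset.Ico 1 k, normWeight κ T k h s u ω * Z s -
      (∑ s ∈ Finset.Ico 1 k, normWeight κ T k h s u ω * m s u + κ.β * m k u / C)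
      = weightedDeviation κ T k h Z m u ω / C + D / C - κ.β * m k u / C := by
    rw [← sub_sub, ← Finset.sum_sub_distrib, weightedDeviation, hD, ← add_div,
      ← Finset.sum_add_distrib, Finset.sum_div]
    congr 1
    refine Finset.sum_congr rfl fun s _ => ?_
    rw [normWeight, ← hCdef]; ring
  have hDle : |D| ≤ 2 * Λ * spatialFactor κ k * κ.σ * C := by
    calc |D| ≤ ∑ s ∈ Finset.Ico 1 k,
          |weight κ T k h s u ω * (m s (T.x s h ω, T.a s h ω) - m s u)| :=
          Finset.abs_sum_le_sum_abs _ _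
      _ ≤ ∑ s ∈ Finset.Ico 1 k,
          Λ * (weight κ T k h s u ω * dist u (T.x s h ω, T.a s h ω)) := by
          refine Finset.sum_le_sum fun s hs => ?_
          have w0 := (weight_mem (κ := κ) (T := T) k h s u ω).1
          rw [abs_mul, abs_of_nonneg w0]
          calc _ ≤ weight κ T k h s u ω * (Λ * dist u (T.x s h ω, T.a s h ω)) :=
                mul_le_mul_of_nonneg_left (hm s hs _) w0
            _ = _ := by ring
      _ ≤ Λ * (2 * κ.σ * spatialFactor κ k * C) := by
          rw [← Finset.mul_sum]
          exact mul_le_mul_of_nonneg_left (sum_weight_mul_dist_le hk h u ω) hΛ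
      _ = _ := by ring
  rw [e]
  have h1 : |D / C| ≤ 2 * Λ * spatialFactor κ k * κ.σ := by
    rw [abs_div, abs_of_pos hC, div_le_iff₀ hC]; exact hDle
  have h2 : |κ.β * m k u / C| ≤ κ.β * B / C := by
    rw [abs_div, abs_of_pos hC, abs_mul, abs_of_pos κ.β_pos]
    exact div_le_div_of_nonneg_right (mul_le_mul_of_nonneg_left hB κ.β_pos.le) hC.le
  have h3 : |weightedDeviation κ T k h Z m u ω / C|
      = |weightedDeviation κ T k h Z m u ω| / C := by rw [abs_div, abs_of_pos hC]
  rw [← h3]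
  exact (abs_sub _ _).trans (add_le_add ((abs_add_le _ _).trans (add_le_add le_rfl h1)) h2)

lemma rpow_three_halves {β : ℝ} (hβ : 0 < β) : β ^ (3 / 2 : ℝ) = β * √β := by
  rw [show (3 / 2 : ℝ) = 1 + 1 / 2 by norm_num, Real.rpow_add hβ, Real.rpow_one,
    Real.sqrt_eq_rpow]

lemma self_normalized_perturb {β C C' S S' B L e : ℝ} (hβ : 0 < β) (hC : β ≤ C) (hC' : β ≤ C')
    (hB : 0 ≤ B) (he : |C - C'| ≤ e) (hS' : |S'| ≤ √(2 * B ^ 2 * L * C'))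
    (hS : |S - S'| ≤ 2 * B * e) :
    |S| / C ≤ √(2 * B ^ 2 * L / C) + B * √(2 * L) * (e / (2 * β ^ (3 / 2 : ℝ)))
      + 2 * B * (e / β) := by
  have hC0 : 0 < C := hβ.trans_le hC
  have hC0' : 0 < C' := hβ.trans_le hC'
  have he0 : 0 ≤ e := (abs_nonneg _).trans he
  have hsC : 0 < √C := Real.sqrt_pos.2 hC0
  have hsβ : 0 < √β := Real.sqrt_pos.2 hβ
  have hsq : √C ^ 2 = C := Real.sq_sqrt hC0.le
  have e1 : √(2 * B ^ 2 * L * C') = B * √(2 * L) * √C' := by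
    rw [show 2 * B ^ 2 * L * C' = B ^ 2 * (C' * (2 * L)) by ring, Real.sqrt_mul (sq_nonneg B),
      Real.sqrt_sq hB, Real.sqrt_mul hC0'.le]; ring
  have e2 : √(2 * B ^ 2 * L / C) = B * √(2 * L) * (√C / C) := by
    rw [show 2 * B ^ 2 * L / C = B ^ 2 * (C⁻¹ * (2 * L)) by ring, Real.sqrt_mul (sq_nonneg B),
      Real.sqrt_sq hB, Real.sqrt_mul (inv_nonneg.2 hC0.le), Real.sqrt_inv]
    have : √C / C = (√C)⁻¹ := by rw [div_eq_iff hC0.ne', eq_inv_mul_iff_mul_eq₀ hsC.ne', ← sq, hsq]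
    rw [this]; ring
  have h1 : √C' ≤ √C + e / (2 * √C) := by
    rw [Real.sqrt_le_left (by positivity)]
    have h2 : (√C + e / (2 * √C)) ^ 2 = C + e + (e / (2 * √C)) ^ 2 := by
      rw [add_sq, hsq]; field_simp
    rw [h2]
    nlinarith [(abs_le.1 he).1, sq_nonneg (e / (2 * √C))]
  have h3 : e / (2 * √C) / C ≤ e / (2 * β ^ (3 / 2 : ℝ)) := by
    rw [rpow_three_halves hβ, div_div]
    refine div_le_div_of_nonneg_left he0 (by positivity) ?_
    have := mul_le_mul hC (Real.sqrt_le_sqrt hC) hsβ.le hC0.le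
    linarith
  have hG : 0 ≤ B * √(2 * L) := mul_nonneg hB (Real.sqrt_nonneg _)
  have h4 : |S| ≤ B * √(2 * L) * (√C + e / (2 * √C)) + 2 * B * e := by
    rw [e1] at hS'
    have := abs_sub_abs_le_abs_sub S S'
    have := mul_le_mul_of_nonneg_left h1 hG
    linarith
  calc |S| / C ≤ (B * √(2 * L) * (√C + e / (2 * √C)) + 2 * B * e) / C :=
        div_le_div_of_nonneg_right h4 hC0.le
    _ = B * √(2 * L) * (√C / C) + B * √(2 * L) * (e / (2 * √C) / C) + 2 * B * (e / C) := by ring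
    _ ≤ _ := by
        rw [e2]
        gcongr

lemma abs_count_sub_le (k h : ℕ) (u v : X × A) (ω : Ω) :
    |count κ T k h u ω - count κ T k h v ω|
      ≤ ∑ s ∈ Finset.Ico 1 k, |weight κ T k h s u ω - weight κ T k h s v ω| := by
  rw [count, count, add_sub_add_left_eq_sub, ← Finset.sum_sub_distrib]
  exact Finset.abs_sum_le_sum_abs _ _

/-- Transfer of a self-normalized bound from a point of a net to its neighbours. -/
lemma abs_weightedDeviation_div_count_le {K k : ℕ} (hk : k ∈ Finset.Icc 1 K) (h : ℕ) {Z : ℕ → ℝ}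
    {m : ℕ → X × A → ℝ} {B L r : ℝ} (hB : 0 ≤ B) {u v : X × A} {ω : Ω} (hr : dist u v ≤ r)
    (hY : ∀ s ∈ Finset.Ico 1 k, |Z s - m s (T.x s h ω, T.a s h ω)| ≤ 2 * B)
    (hv : |weightedDeviation κ T k h Z m v ω| ≤ √(2 * B ^ 2 * L * count κ T k h v ω)) :
    |weightedDeviation κ T k h Z m u ω| / count κ T k h u ω ≤
      √(2 * B ^ 2 * L / count κ T k h u ω)
      + B * √(2 * L) * (K * (κ.C₂ * (r / κ.σ)) / (2 * κ.β ^ (3 / 2 : ℝ)))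
      + 2 * B * (K * (κ.C₂ * (r / κ.σ)) / κ.β) := by
  have hw := sum_abs_weight_sub_le (κ := κ) (T := T) hk h hr ω
  refine self_normalized_perturb κ.β_pos (β_le_count k h u ω) (β_le_count k h v ω) hB
    ((abs_count_sub_le k h u v ω).trans hw) hv ?_
  rw [weightedDeviation, weightedDeviation, ← Finset.sum_sub_distrib]
  calc _ ≤ ∑ s ∈ Finset.Ico 1 k, |weight κ T k h s u ω * (Z s - m s (T.x s h ω, T.a s h ω))
          - weight κ T k h s v ω * (Z s - m s (T.x s h ω, T.a s h ω))| :=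
        Finset.abs_sum_le_sum_abs _ _
    _ ≤ ∑ s ∈ Finset.Ico 1 k, 2 * B * |weight κ T k h s u ω - weight κ T k h s v ω| := by
        refine Finset.sum_le_sum fun s hs => ?_
        rw [← sub_mul, abs_mul, mul_comm]
        exact mul_le_mul_of_nonneg_right (hY s hs) (abs_nonneg _)
    _ ≤ _ := by
        rw [← Finset.mul_sum]
        exact mul_le_mul_of_nonneg_left hw (by linarith)

end Weights

/-! ### Adaptedness to the histories -/

section History

variable {Ω X A : Type*} [mX : MeasurableSpace X] [mA : MeasurableSpace A]
  {T : Trajectory Ω X A} {H k h : ℕ}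

lemma Trajectory.measurable_x_episodeInfo {j : ℕ} (hj : j ∈ Finset.Icc 1 h) :
    Measurable[T.episodeInfo k h] (T.x k j) :=
  Measurable.of_comap_le (le_sup_of_le_left (le_sup_of_le_left
    (le_iSup₂_of_le (f := fun j (_ : j ∈ Finset.Icc 1 h) => mX.comap (T.x k j)) j hj le_rfl)))

lemma Trajectory.measurable_a_episodeInfo {j : ℕ} (hj : j ∈ Finset.Ico 1 h) :
    Measurable[T.episodeInfo k h] (T.a k j) :=
  Measurable.of_comap_le (le_sup_of_le_left (le_sup_of_le_right
    (le_iSup₂_of_le (f := fun j (_ : j ∈ Finset.Ico 1 h) => mA.comap (T.a k j)) j hj le_rfl)))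

lemma Trajectory.measurable_rew_episodeInfo {j : ℕ} (hj : j ∈ Finset.Ico 1 h) :
    Measurable[T.episodeInfo k h] (T.rew k j) :=
  Measurable.of_comap_le (le_sup_of_le_right
    (le_iSup₂_of_le (f := fun j (_ : j ∈ Finset.Ico 1 h) =>
      MeasurableSpace.comap (T.rew k j) inferInstance) j hj le_rfl))

lemma Trajectory.episodeInfo_le_history {s t : ℕ} (hs : 1 ≤ s) (hst : s < t) (h : ℕ) :
    T.episodeInfo s (H + 1) ≤ T.history H t h :=
  le_sup_of_le_left (le_sup_of_le_left
    (le_iSup₂_of_le (f := fun s (_ : s ∈ Finset.Ico 1 t) => T.episodeInfo s (H + 1)) s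
      (Finset.mem_Ico.2 ⟨hs, hst⟩) le_rfl))

lemma Trajectory.measurable_pair_history (hh : 1 ≤ h) :
    Measurable[T.history H k h] fun ω => (T.x k h ω, T.a k h ω) := by
  refine Measurable.prodMk ?_ ?_
  · exact (T.measurable_x_episodeInfo (Finset.mem_Icc.2 ⟨hh, le_rfl⟩)).mono
      (le_sup_of_le_left le_sup_right) le_rfl
  · exact Measurable.of_comap_le le_sup_right

lemma Trajectory.episodeInfo_mono (hh : h ∈ Finset.Icc 1 H) :
    T.episodeInfo k h ≤ T.episodeInfo k (H + 1) := by
  have hH := (Finset.mem_Icc.1 hh).2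
  refine sup_le_sup (sup_le_sup ?_ ?_) ?_
  · exact biSup_mono fun j hj => by simp only [Finset.mem_Icc] at hj ⊢; omega
  · exact biSup_mono fun j hj => by simp only [Finset.mem_Ico] at hj ⊢; omega
  · exact biSup_mono fun j hj => by simp only [Finset.mem_Ico] at hj ⊢; omega

lemma Trajectory.history_mono {s t : ℕ} (hs : 1 ≤ s) (hst : s < t) (hh : h ∈ Finset.Icc 1 H) :
    T.history H s h ≤ T.history H t h := by
  have h1 := T.episodeInfo_le_history (H := H) hs hst h
  refine sup_le (sup_le (iSup₂_le fun j hj => ?_) ((T.episodeInfo_mono hh).trans h1)) ?_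
  · have := Finset.mem_Ico.1 hj
    exact T.episodeInfo_le_history this.1 (by omega) h
  · refine Measurable.comap_le ((T.measurable_a_episodeInfo ?_).mono h1 le_rfl)
    simp only [Finset.mem_Icc, Finset.mem_Ico] at hh ⊢; omega

lemma Trajectory.measurable_next_history {s t : ℕ} (hs : 1 ≤ s) (hst : s < t)
    (hh : h ∈ Finset.Icc 1 H) : Measurable[T.history H t h] (T.x s (h + 1)) :=
  (T.measurable_x_episodeInfo (by simp only [Finset.mem_Icc] at hh ⊢; omega)).mono
    (T.episodeInfo_le_history hs hst h) le_rfl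

lemma Trajectory.measurable_rew_history {s t : ℕ} (hs : 1 ≤ s) (hst : s < t)
    (hh : h ∈ Finset.Icc 1 H) : Measurable[T.history H t h] (T.rew s h) :=
  (T.measurable_rew_episodeInfo (by simp only [Finset.mem_Icc, Finset.mem_Ico] at hh ⊢; omega)).mono
    (T.episodeInfo_le_history hs hst h) le_rfl

/-- Predictability: for a fixed u the weight sees episode s only through the pair visited at step h,
which is known before the reward and the next state are drawn. -/
lemma measurable_weight_history [MetricSpace (X × A)] [OpensMeasurableSpace (X × A)]
    {κ : KernelSpec} (hh : 1 ≤ h) (k s : ℕ) (u : X × A) :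
    Measurable[T.history H s h] fun ω => weight κ T k h s u ω := by
  have h1 : Measurable fun v : X × A => κ.Γ (k - s - 1) (dist u v / κ.σ) := by
    refine (continuous_of_abs_sub_le (L := κ.C₂ / κ.σ) fun v v' => ?_).measurable
    refine (κ.Γ_lipschitz _ _ _ (div_nonneg dist_nonneg κ.σ_pos.le)
      (div_nonneg dist_nonneg κ.σ_pos.le)).trans ?_
    rw [← sub_div, abs_div, abs_of_pos κ.σ_pos, div_mul_eq_mul_div, mul_div_assoc]
    refine mul_le_mul_of_nonneg_left ?_ κ.C₂_pos.le
    refine div_le_div_of_nonneg_right ?_ κ.σ_pos.le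
    rw [dist_comm u v, dist_comm u v']
    exact abs_dist_sub_le v v' u
  exact h1.comp (T.measurable_pair_history hh)

end History

/-! ### The observations as weighted martingale noise -/

section Interaction

variable {Ω X A : Type*} [mΩ : MeasurableSpace Ω] [mX : MeasurableSpace X] [mA : MeasurableSpace A]
  {μ : Measure Ω} {T : Trajectory Ω X A} {M : MDP X A} {K H k h : ℕ}

lemma Trajectory.IsInteraction.episodeInfo_le (hT : T.IsInteraction M K H μ) (k h : ℕ) :
    T.episodeInfo k h ≤ mΩ :=
  sup_le (sup_le (iSup₂_le fun j _ => (hT.measurable_x k j).comap_le)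
    (iSup₂_le fun j _ => (hT.measurable_a k j).comap_le))
    (iSup₂_le fun j _ => (hT.measurable_rew k j).comap_le)

lemma Trajectory.IsInteraction.history_le (hT : T.IsInteraction M K H μ) (k h : ℕ) :
    T.history H k h ≤ mΩ :=
  sup_le (sup_le (iSup₂_le fun s _ => hT.episodeInfo_le s _) (hT.episodeInfo_le k h))
    (hT.measurable_a k h).comap_le

lemma MDP.measurable_integral (M : MDP X A) (k h : ℕ) {f : X → ℝ} (hf : Measurable f) :
    Measurable fun u => ∫ y, f y ∂(M.P k h u) := by
  have := M.markov k h
  exact hf.stronglyMeasurable.integral_kernel.measurable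

/-- Conditional expectations of functions of the next state. -/
lemma Trajectory.IsInteraction.condExp_next [IsProbabilityMeasure μ]
    (hT : T.IsInteraction M K H μ) (hk : k ∈ Finset.Icc 1 K) (hh : h ∈ Finset.Icc 1 H)
    {f : X → ℝ} (hf : Measurable f) {B : ℝ} (hB : ∀ x, |f x| ≤ B) :
    μ[fun ω => f (T.x k (h + 1) ω) | T.history H k h]
      =ᵐ[μ] fun ω => ∫ y, f y ∂(M.P k h (T.x k h ω, T.a k h ω)) := by
  have hle := hT.history_le k h
  have := M.markov k h
  have mx := hT.measurable_x k (h + 1)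
  have mu : Measurable[T.history H k h] fun ω => (T.x k h ω, T.a k h ω) :=
    T.measurable_pair_history (Finset.mem_Icc.1 hh).1
  have mu' := mu.mono hle le_rfl
  have mP := M.measurable_integral k h hf
  have hPB : ∀ u, |∫ y, f y ∂(M.P k h u)| ≤ B := fun u =>
    abs_le.2 (integral_mem_Icc hf fun x => abs_le.1 (hB x))
  have hfi : Integrable (fun ω => f (T.x k (h + 1) ω)) μ :=
    integrable_of_bounded (hf.comp mx) (fun ω => hB _) μ
  have hPi : Integrable (fun ω => ∫ y, f y ∂(M.P k h (T.x k h ω, T.a k h ω))) μ :=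
    integrable_of_bounded (mP.comp mu') (fun ω => hPB _) μ
  refine (ae_eq_condExp_of_forall_setIntegral_eq hle hfi (fun s _ _ => hPi.integrableOn)
    (fun s hs _ => ?_) (mP.comp mu).stronglyMeasurable.aestronglyMeasurable).symm
  have hs' := hle s hs
  -- The law of the next state is given only on sets B. On each event s of the history this
  -- identifies two measures on X, which extends the formula to bounded measurable f.
  have hmeas : (μ.restrict s).map (T.x k (h + 1))
      = ((μ.restrict s).map fun ω => (T.x k h ω, T.a k h ω)).bind (M.P k h) := by
    ext E hE
    have hEm : MeasurableSet (T.x k (h + 1) ⁻¹' E) := mx hE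
    rw [Measure.map_apply mx hE, Measure.bind_apply hE (M.P k h).measurable.aemeasurable,
      lintegral_map ((M.P k h).measurable_coe hE) mu', Measure.restrict_apply hEm]
    have hint : ∫ ω in s, (M.P k h (T.x k h ω, T.a k h ω)).real E ∂μ
        = μ.real (T.x k (h + 1) ⁻¹' E ∩ s) := by
      rw [← setIntegral_congr_ae hs' ((hT.next_law k hk h hh E hE).mono fun ω hω _ => hω),
        setIntegral_condExp hle ((integrable_const _).indicator hEm) hs, integral_indicator hEm,
        Measure.restrict_restrict hEm]
      simp
    have hnn : ∀ ω, 0 ≤ (M.P k h (T.x k h ω, T.a k h ω)).real E := fun ω => measureReal_nonneg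
    have hmr : Measurable fun ω => (M.P k h (T.x k h ω, T.a k h ω)).real E :=
      (((M.P k h).measurable_coe hE).comp mu').ennreal_toReal
    have hi : Integrable (fun ω => (M.P k h (T.x k h ω, T.a k h ω)).real E) (μ.restrict s) :=
      integrable_of_bounded hmr (B := 1) (fun ω => by
        rw [abs_of_nonneg (hnn ω)]; exact measureReal_le_one) _
    have h2 := ofReal_integral_eq_lintegral_ofReal hi (ae_of_all _ hnn)
    rw [hint, ofReal_measureReal] at h2
    rw [h2]
    exact lintegral_congr fun ω => ofReal_measureReal
  calc ∫ ω in s, ∫ y, f y ∂(M.P k h (T.x k h ω, T.a k h ω)) ∂μ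
      = ∫ u, ∫ y, f y ∂(M.P k h u) ∂((μ.restrict s).map fun ω => (T.x k h ω, T.a k h ω)) :=
        (integral_map mu'.aemeasurable mP.aestronglyMeasurable).symm
    _ = ∫ y, f y ∂(((μ.restrict s).map fun ω => (T.x k h ω, T.a k h ω)).bind (M.P k h)) := by
        have := Kernel.integral_comp (η := M.P k h) (a := ())
          (κ := Kernel.const Unit ((μ.restrict s).map fun ω => (T.x k h ω, T.a k h ω)))
          (integrable_of_bounded hf hB _)
        simpa only [Kernel.comp_apply, Kernel.const_apply] using this.symm
    _ = ∫ ω in s, f (T.x k (h + 1) ω) ∂μ := by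
        rw [← hmeas, integral_map mx.aemeasurable hf.aestronglyMeasurable]

variable [MetricSpace (X × A)] [OpensMeasurableSpace (X × A)] {κ : KernelSpec}

/-- Observations `Z s` with mean `m s` at the visited point satisfy the noise model. -/
lemma Trajectory.IsInteraction.isWeightedNoise (hT : T.IsInteraction M K H μ)
    (hh : h ∈ Finset.Icc 1 H) {Z : ℕ → Ω → ℝ} {m : ℕ → X × A → ℝ} {B : ℝ} (hB : 0 < B) (v : X × A)
    (hm : ∀ s, Measurable (m s)) (hmB : ∀ s u, |m s u| ≤ B)
    (hZ : ∀ s, Measurable (Z s)) (hZB : ∀ s ∈ Finset.Ico 1 k, ∀ᵐ ω ∂μ, |Z s ω| ≤ B)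
    (hZa : ∀ s t, 1 ≤ s → s < t → Measurable[T.history H t h] (Z s))
    (hc : ∀ s ∈ Finset.Ico 1 k,
      μ[Z s | T.history H s h] =ᵐ[μ] fun ω => m s (T.x s h ω, T.a s h ω)) :
    IsWeightedNoise μ (fun s => T.history H s h) k (fun s => weight κ T k h s v) Z
      (fun s ω => m s (T.x s h ω, T.a s h ω)) B where
  B_pos := hB
  le s := hT.history_le s h
  mono _ hs _ _ hst := T.history_mono (Finset.mem_Ico.1 hs).1 hst hh
  w_meas s _ := measurable_weight_history (Finset.mem_Icc.1 hh).1 k s v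
  m_meas s _ := (hm s).comp (T.measurable_pair_history (Finset.mem_Icc.1 hh).1)
  Z_meas s _ := hZ s
  Z_adapted s hs t _ hst := hZa s t (Finset.mem_Ico.1 hs).1 hst
  w_mem s ω := weight_mem k h s v ω
  m_bound s _ _ := hmB s _
  Z_bound := hZB
  cond_mean := hc

lemma Trajectory.IsInteraction.isWeightedNoise_rew (hT : T.IsInteraction M K H μ)
    (hk : k ∈ Finset.Icc 1 K) (hh : h ∈ Finset.Icc 1 H) (v : X × A) :
    IsWeightedNoise μ (fun s => T.history H s h) k (fun s => weight κ T k h s v)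
      (fun s => T.rew s h) (fun s ω => M.r s h (T.x s h ω, T.a s h ω)) 1 := by
  have hsK : ∀ s ∈ Finset.Ico 1 k, s ∈ Finset.Icc 1 K := fun s hs => by
    simp only [Finset.mem_Icc, Finset.mem_Ico] at hs hk ⊢; omega
  refine hT.isWeightedNoise hh one_pos v (m := fun s => M.r s h) (fun s => M.measurable_r s h)
    (fun s u => ?_) (fun s => hT.measurable_rew s h) (fun s hs => ?_)
    (fun s t hs hst => T.measurable_rew_history hs hst hh)
    (fun s hs => hT.rew_mean s (hsK s hs) h hh)
  · rw [abs_of_nonneg (M.r_mem s h u).1]; exact (M.r_mem s h u).2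
  · filter_upwards [hT.rew_mem s (hsK s hs) h hh] with ω hω
    rw [abs_of_nonneg hω.1]; exact hω.2

lemma Trajectory.IsInteraction.isWeightedNoise_next [IsProbabilityMeasure μ]
    (hT : T.IsInteraction M K H μ)
    (hk : k ∈ Finset.Icc 1 K) (hh : h ∈ Finset.Icc 1 H) (v : X × A) {f : X → ℝ} (hf : Measurable f)
    {B : ℝ} (hB : 0 < B) (hfB : ∀ x, |f x| ≤ B) :
    IsWeightedNoise μ (fun s => T.history H s h) k (fun s => weight κ T k h s v)
      (fun s ω => f (T.x s (h + 1) ω))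
      (fun s ω => ∫ y, f y ∂(M.P s h (T.x s h ω, T.a s h ω))) B := by
  have hsK : ∀ s ∈ Finset.Ico 1 k, s ∈ Finset.Icc 1 K := fun s hs => by
    simp only [Finset.mem_Icc, Finset.mem_Ico] at hs hk ⊢; omega
  refine hT.isWeightedNoise hh hB v (m := fun s u => ∫ y, f y ∂(M.P s h u))
    (fun s => M.measurable_integral s h hf)
    (fun s u => ?_) (fun s => hf.comp (hT.measurable_x s (h + 1)))
    (fun s hs => ae_of_all _ fun ω => hfB _)
    (fun s t hs hst => hf.comp (T.measurable_next_history hs hst hh))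
    (fun s hs => hT.condExp_next (hsK s hs) hh hf hfB)
  have := M.markov s h
  exact abs_le.2 (integral_mem_Icc hf fun x => abs_le.1 (hfB x))

end Interaction

/-! ### Temporal bias, and transfer of Bernstein bounds between neighbours -/

section TemporalBias

lemma sum_pow_ite_le {η : ℝ} (hη0 : 0 < η) (hη1 : η < 1) (W k : ℕ) :
    ∑ s ∈ Finset.Ico 1 k, (if W ≤ k - s - 1 then η ^ (k - s - 1) else 0)
      ≤ η ^ W / (1 - η) := by
  have h1 : (0 : ℝ) < 1 - η := by linarith
  have key : ∀ n : ℕ, (1 - η) * ∑ j ∈ Finset.range n, (if W ≤ j then η ^ j else 0)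
      ≤ η ^ W - η ^ max n W := by
    intro n
    induction n with
    | zero => simp
    | succ n ih =>
      rw [Finset.sum_range_succ, mul_add]
      split_ifs with hW
      · rw [max_eq_left hW] at ih
        rw [max_eq_left (by omega), pow_succ]
        linarith
      · rw [max_eq_right (by omega)] at ih ⊢
        linarith
  have e : ∑ s ∈ Finset.Ico 1 k, (if W ≤ k - s - 1 then η ^ (k - s - 1) else 0)
      = ∑ j ∈ Finset.range (k - 1), (if W ≤ j then η ^ j else 0) := by
    rw [Finset.sum_Ico_eq_sum_range,
      ← Finset.sum_range_reflect (fun j => if W ≤ j then η ^ j else (0 : ℝ))]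
    refine Finset.sum_congr rfl fun i _ => ?_
    rw [show k - (1 + i) - 1 = k - 1 - 1 - i by omega]
  rw [e, le_div_iff₀ h1, mul_comm]
  have := key (k - 1)
  have h2 : 0 ≤ η ^ max (k - 1) W := by positivity
  linarith

variable {Ω X A : Type*} [MetricSpace X] [MeasurableSpace X] [BorelSpace X] [MeasurableSpace A]
  {M : MDP X A} {K H k h : ℕ} {Lr Lp : ℝ}

lemma boundedLipschitz_measurable {L B : ℝ} {f : X → ℝ} (hf : f ∈ boundedLipschitz X L B) :
    Measurable f :=
  (continuous_of_abs_sub_le hf.1).measurable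

lemma boundedLipschitz_abs {L B : ℝ} {f : X → ℝ} (hf : f ∈ boundedLipschitz X L B) :
    (fun x => |f x|) ∈ boundedLipschitz X L B :=
  ⟨fun x y => (abs_abs_sub_abs_le (f x) (f y)).trans (hf.1 x y), fun x => by
    rw [abs_abs]; exact hf.2 x⟩

lemma MDP.abs_integral_le (M : MDP X A) (k h : ℕ) (u : X × A) {f : X → ℝ} (hf : Measurable f)
    {B : ℝ} (hB : ∀ x, |f x| ≤ B) : |∫ y, f y ∂(M.P k h u)| ≤ B := by
  have := M.markov k h
  exact abs_le.2 (integral_mem_Icc hf fun x => abs_le.1 (hB x))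

/-- Telescoping over consecutive episodes. The sum is extended down to j so that one bound serves
every episode of the window. -/
lemma MDP.abs_integral_sub_le_sum (M : MDP X A) (hX : ∃ d, HasCoveringExponent X d) (h : ℕ)
    {f : X → ℝ} {L : ℝ} (hL : 0 ≤ L) (hf : ∀ x y, |f x - f y| ≤ L * dist x y) (u : X × A)
    {s k j : ℕ} (hjs : j ≤ s) (hsk : s ≤ k) :
    |(∫ y, f y ∂(M.P s h u)) - ∫ y, f y ∂(M.P k h u)|
      ≤ L * ∑ i ∈ Finset.Ico j k, ⨆ u : X × A, wasserstein (M.P i h u) (M.P (i + 1) h u) := by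
  obtain ⟨D, hD⟩ := exists_dist_le hX
  have hW : ∀ i, ∀ u : X × A, 0 ≤ wasserstein (M.P i h u) (M.P (i + 1) h u) ∧
      wasserstein (M.P i h u) (M.P (i + 1) h u) ≤ D := fun i u => by
    have := M.markov i h
    have := M.markov (i + 1) h
    exact wasserstein_nonneg_and_le _ _ hD
  have hsup : ∀ i, wasserstein (M.P i h u) (M.P (i + 1) h u)
      ≤ ⨆ u : X × A, wasserstein (M.P i h u) (M.P (i + 1) h u) := fun i =>
    le_ciSup (f := fun u : X × A => wasserstein (M.P i h u) (M.P (i + 1) h u))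
      ⟨D, by rintro _ ⟨u, rfl⟩; exact (hW i u).2⟩ u
  have h1 := dist_le_Ico_sum_dist (fun i => ∫ y, f y ∂(M.P i h u)) hsk
  rw [Real.dist_eq] at h1
  refine h1.trans ?_
  rw [Finset.mul_sum]
  refine (Finset.sum_le_sum (g := fun i =>
    L * ⨆ u : X × A, wasserstein (M.P i h u) (M.P (i + 1) h u)) fun i _ => ?_).trans
    (Finset.sum_le_sum_of_subset_of_nonneg (Finset.Ico_subset_Ico_left hjs) fun i _ _ =>
      mul_nonneg hL ((hW i u).1.trans (hsup i)))
  have := M.markov i h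
  have := M.markov (i + 1) h
  rw [Real.dist_eq]
  exact (KernelRL.abs_integral_sub_le hX hL hf).trans (mul_le_mul_of_nonneg_left (hsup i) hL)

variable [MetricSpace (X × A)] {κ : KernelSpec} {T : Trajectory Ω X A}

lemma biasP_nonneg (hX : ∃ d, HasCoveringExponent X d) (hLr : 0 ≤ Lr) (hLp : 0 ≤ Lp) :
    0 ≤ biasP κ M H Lr Lp k h := by
  obtain ⟨D, hD⟩ := exists_dist_le hX
  have hη := κ.η_lt_one
  have hη0 := κ.η_pos
  have hβ := κ.β_pos
  have hC := κ.C₃_nonneg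
  refine add_nonneg (mul_nonneg (lipQ_nonneg hLr hLp H) (Finset.sum_nonneg fun i _ =>
    Real.iSup_nonneg fun u => ?_)) ?_
  · have := M.markov i h
    have := M.markov (i + 1) h
    exact (wasserstein_nonneg_and_le _ _ hD).1
  · have : 0 ≤ 1 - κ.η := by linarith
    positivity

/-- Replacing the transitions of past episodes by those of the current one costs the temporal
bias. -/
lemma sum_weight_mul_integral_le (hX : ∃ d, HasCoveringExponent X d)
    (hLr : 0 ≤ Lr) (hLp : 0 ≤ Lp) {g : X → ℝ}
    (hg : g ∈ boundedLipschitz X (2 * lipQ H Lr Lp) (2 * H)) (hg0 : ∀ x, 0 ≤ g x)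
    (u : X × A) (ω : Ω) :
    ∑ s ∈ Finset.Ico 1 k, weight κ T k h s u ω * ∫ y, g y ∂(M.P s h u)
      ≤ count κ T k h u ω * ((∫ y, g y ∂(M.P k h u)) + 2 * biasP κ M H Lr Lp k h) := by
  have hη1 := κ.η_lt_one
  have hη0 := κ.η_pos
  have hβ := κ.β_pos
  have hC₃ := κ.C₃_nonneg
  have hQ := lipQ_nonneg hLr hLp H
  set a : ℕ → ℝ := fun s => ∫ y, g y ∂(M.P s h u) with ha
  have ha0 : ∀ s, 0 ≤ a s := fun s => integral_nonneg hg0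
  have haB : ∀ s, a s ≤ 2 * H := fun s =>
    (abs_le.1 (M.abs_integral_le s h u (boundedLipschitz_measurable hg) hg.2)).2
  set V : ℝ := ∑ i ∈ Finset.Ico (max 1 (k - κ.W)) k,
    ⨆ u : X × A, wasserstein (M.P i h u) (M.P (i + 1) h u) with hV
  have hV0 : 0 ≤ 2 * lipQ H Lr Lp * V := by
    have := M.abs_integral_sub_le_sum hX h (mul_nonneg zero_le_two hQ) hg.1 u
      (j := max 1 (k - κ.W)) (s := max (max 1 (k - κ.W)) k) (k := max (max 1 (k - κ.W)) k)
      (le_max_left _ _) le_rfl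
    rcases le_total (max 1 (k - κ.W)) k with h1 | h1
    · rw [max_eq_right h1] at this
      exact (abs_nonneg _).trans this
    · rw [hV, Finset.Ico_eq_empty_of_le h1]; simp
  have hterm : ∀ s ∈ Finset.Ico 1 k, weight κ T k h s u ω * a s
      ≤ weight κ T k h s u ω * (a k + 2 * lipQ H Lr Lp * V)
        + 2 * H * κ.C₃ * (if κ.W ≤ k - s - 1 then κ.η ^ (k - s - 1) else 0) := by
    intro s hs
    obtain ⟨hs1, hsk⟩ := Finset.mem_Ico.1 hs
    obtain ⟨w0, w1⟩ := weight_mem (κ := κ) (T := T) k h s u ω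
    -- Episodes of age at least W are discounted by `Γ_forget` and bounded crudely by 2H; the more
    -- recent ones lie in the summation window of `biasP`.
    split_ifs with hW
    · have hw : weight κ T k h s u ω ≤ κ.C₃ * κ.η ^ (k - s - 1) :=
        κ.Γ_forget _ _ hW (div_nonneg dist_nonneg κ.σ_pos.le)
      have h1 : weight κ T k h s u ω * a s ≤ κ.C₃ * κ.η ^ (k - s - 1) * (2 * H) :=
        mul_le_mul hw (haB s) (ha0 s) (by positivity)
      have h2 : 0 ≤ weight κ T k h s u ω * (a k + 2 * lipQ H Lr Lp * V) :=
        mul_nonneg w0 (add_nonneg (ha0 k) hV0)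
      linarith
    · have h1 := M.abs_integral_sub_le_sum hX h (mul_nonneg zero_le_two hQ) hg.1 u
        (j := max 1 (k - κ.W)) (s := s) (k := k) (by omega) hsk.le
      have h2 : a s ≤ a k + 2 * lipQ H Lr Lp * V := by
        have := (abs_le.1 h1).2
        simp only [ha]; linarith
      have := mul_le_mul_of_nonneg_left h2 w0
      linarith
  have hgeo := sum_pow_ite_le hη0 hη1 κ.W k
  have hC := count_pos (κ := κ) (T := T) k h u ω
  have h1η : 0 < 1 - κ.η := by linarith
  calc _ ≤ ∑ s ∈ Finset.Ico 1 k, (weight κ T k h s u ω * (a k + 2 * lipQ H Lr Lp * V)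
        + 2 * H * κ.C₃ * (if κ.W ≤ k - s - 1 then κ.η ^ (k - s - 1) else 0)) :=
        Finset.sum_le_sum hterm
    _ = (∑ s ∈ Finset.Ico 1 k, weight κ T k h s u ω) * (a k + 2 * lipQ H Lr Lp * V)
        + 2 * H * κ.C₃ * ∑ s ∈ Finset.Ico 1 k,
          (if κ.W ≤ k - s - 1 then κ.η ^ (k - s - 1) else 0) := by
        rw [Finset.sum_add_distrib, ← Finset.sum_mul, ← Finset.mul_sum]
    _ ≤ count κ T k h u ω * (a k + 2 * lipQ H Lr Lp * V)
        + 2 * H * κ.C₃ * (κ.η ^ κ.W / (1 - κ.η)) := by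
        refine add_le_add (mul_le_mul_of_nonneg_right (sum_weight_le_count k h u ω)
          (add_nonneg (ha0 k) hV0)) (mul_le_mul_of_nonneg_left hgeo (by positivity))
    _ = count κ T k h u ω * (a k + 2 * lipQ H Lr Lp * V)
        + κ.β * (2 * κ.C₃ * H / κ.β * (κ.η ^ κ.W / (1 - κ.η))) := by field_simp
    _ ≤ count κ T k h u ω * (a k + 2 * lipQ H Lr Lp * V)
        + count κ T k h u ω * (2 * κ.C₃ * H / κ.β * (κ.η ^ κ.W / (1 - κ.η))) := by
        refine add_le_add le_rfl (mul_le_mul_of_nonneg_right (β_le_count k h u ω) (by positivity))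
    _ ≤ _ := by
        rw [← mul_add]
        refine mul_le_mul_of_nonneg_left ?_ hC.le
        have : 0 ≤ 2 * κ.C₃ * H / κ.β * (κ.η ^ κ.W / (1 - κ.η)) := by positivity
        rw [biasP, ← hV]
        linarith

/-- When a weight changes, both the deviation and 1/B² times the variance change with it. Together
they cost no more than the crude bound 2B for the deviation alone. -/
lemma abs_sub_add_variance_le {B z m v : ℝ} (hB : 2 ≤ B) (hz : |z| ≤ B) (hm : |m| ≤ B)
    (hv : v ≤ B ^ 2) : |z - m| + 1 / B ^ 2 * (v - m ^ 2) ≤ 2 * B := by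
  have hB0 : 0 < B := by linarith
  have h1 : |z - m| ≤ B + |m| := (abs_sub _ _).trans (by linarith)
  have h2 : 1 / B ^ 2 * (v - m ^ 2) ≤ 1 / B ^ 2 * (B ^ 2 - m ^ 2) :=
    mul_le_mul_of_nonneg_left (by linarith) (by positivity)
  -- B² - m² = (B - |m|)(B + |m|), and B + |m| ≤ 2B ≤ B² because B ≥ 2.
  have h3 : 1 / B ^ 2 * (B ^ 2 - m ^ 2) ≤ B - |m| := by
    rw [one_div, inv_mul_le_iff₀ (by positivity), ← sq_abs m]
    have := abs_nonneg m
    nlinarith [mul_nonneg (sub_nonneg.2 hm) (sub_nonneg.2 hB),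
      mul_nonneg (mul_nonneg (sub_nonneg.2 hm) hB0.le) (sub_nonneg.2 hB),
      mul_nonneg (sub_nonneg.2 hm) (sub_nonneg.2 hm)]
  linarith

/-- Transfer of a Bernstein bound from a point of a net to its neighbours. -/
lemma abs_weightedDeviation_le_of_bernstein (hk : k ∈ Finset.Icc 1 K) (h : ℕ)
    {Z : ℕ → ℝ} {m v : ℕ → X × A → ℝ} {B R r : ℝ} {u u' : X × A} {ω : Ω} (hr : dist u u' ≤ r)
    (hB : 2 ≤ B) (hZ : ∀ s, |Z s| ≤ B) (hm : ∀ s u, |m s u| ≤ B) (hv : ∀ s u, v s u ≤ B ^ 2)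
    (hu' : |weightedDeviation κ T k h Z m u' ω| ≤ R + 1 / B ^ 2 * ∑ s ∈ Finset.Ico 1 k,
      weight κ T k h s u' ω *
        (v s (T.x s h ω, T.a s h ω) - m s (T.x s h ω, T.a s h ω) ^ 2))
    (hvar : ∀ s u, 0 ≤ v s u - m s u ^ 2) :
    |weightedDeviation κ T k h Z m u ω| ≤ R + 1 / B ^ 2 * ∑ s ∈ Finset.Ico 1 k,
      weight κ T k h s u ω * (v s (T.x s h ω, T.a s h ω) - m s (T.x s h ω, T.a s h ω) ^ 2)
      + 2 * B * (K * (κ.C₂ * (r / κ.σ))) := by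
  set p : ℕ → X × A := fun s => (T.x s h ω, T.a s h ω) with hp
  have hw := sum_abs_weight_sub_le (κ := κ) (T := T) hk h hr ω
  have h1 : |weightedDeviation κ T k h Z m u ω| ≤ |weightedDeviation κ T k h Z m u' ω|
      + ∑ s ∈ Finset.Ico 1 k, |weight κ T k h s u ω - weight κ T k h s u' ω|
        * |Z s - m s (p s)| := by
    have e : weightedDeviation κ T k h Z m u ω = weightedDeviation κ T k h Z m u' ω
        + ∑ s ∈ Finset.Ico 1 k, (weight κ T k h s u ω - weight κ T k h s u' ω)
          * (Z s - m s (p s)) := by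
      rw [weightedDeviation, weightedDeviation, ← Finset.sum_add_distrib]
      exact Finset.sum_congr rfl fun s _ => by ring
    rw [e]
    refine (abs_add_le _ _).trans (add_le_add le_rfl ((Finset.abs_sum_le_sum_abs _ _).trans
      (le_of_eq (Finset.sum_congr rfl fun s _ => abs_mul _ _))))
  have h2 : ∑ s ∈ Finset.Ico 1 k, weight κ T k h s u' ω * (v s (p s) - m s (p s) ^ 2)
      ≤ ∑ s ∈ Finset.Ico 1 k, weight κ T k h s u ω * (v s (p s) - m s (p s) ^ 2)
      + ∑ s ∈ Finset.Ico 1 k, |weight κ T k h s u ω - weight κ T k h s u' ω|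
        * (v s (p s) - m s (p s) ^ 2) := by
    rw [← Finset.sum_add_distrib]
    refine Finset.sum_le_sum fun s _ => ?_
    have := neg_abs_le (weight κ T k h s u ω - weight κ T k h s u' ω)
    have := hvar s (p s)
    nlinarith
  have h3 : ∑ s ∈ Finset.Ico 1 k, |weight κ T k h s u ω - weight κ T k h s u' ω|
        * |Z s - m s (p s)| + 1 / B ^ 2 * ∑ s ∈ Finset.Ico 1 k,
        |weight κ T k h s u ω - weight κ T k h s u' ω| * (v s (p s) - m s (p s) ^ 2)
      ≤ 2 * B * (K * (κ.C₂ * (r / κ.σ))) := by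
    refine le_trans ?_ (mul_le_mul_of_nonneg_left hw (by linarith))
    rw [Finset.mul_sum, Finset.mul_sum, ← Finset.sum_add_distrib]
    refine Finset.sum_le_sum fun s _ => ?_
    have := mul_le_mul_of_nonneg_left
      (abs_sub_add_variance_le hB (hZ s) (hm s (p s)) (hv s (p s)))
      (abs_nonneg (weight κ T k h s u ω - weight κ T k h s u' ω))
    linarith
  have h4 := mul_le_mul_of_nonneg_left h2 (show 0 ≤ 1 / B ^ 2 by positivity)
  rw [mul_add] at h4
  linarith

end TemporalBias

/-! ### Union bounds over nets -/

section UnionBound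

variable {Ω : Type*} [MeasurableSpace Ω] {μ : Measure Ω} [IsProbabilityMeasure μ]

lemma measureReal_compl_le_of_ae {E E' : Set Ω} {δ : ℝ} (hE : μ.real Eᶜ ≤ δ)
    (h : ∀ᵐ ω ∂μ, ω ∈ E → ω ∈ E') : μ.real E'ᶜ ≤ δ := by
  refine le_trans (ENNReal.toReal_mono (measure_ne_top _ _) (measure_mono_ae ?_)) hE
  filter_upwards [h] with ω hω h' using fun h'' => h' (hω h'')

lemma measureReal_compl_forall_le {ι : Type*} (I : Finset ι) (G : ι → Set Ω) {q : ℝ}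
    (h : ∀ i ∈ I, μ.real (G i)ᶜ ≤ q) : μ.real {ω | ∀ i ∈ I, ω ∈ G i}ᶜ ≤ I.card * q := by
  have e : {ω | ∀ i ∈ I, ω ∈ G i}ᶜ = ⋃ i ∈ I, (G i)ᶜ := by
    ext ω; simp
  rw [e]
  refine (measureReal_biUnion_finset_le I _).trans ((Finset.sum_le_sum h).trans ?_)
  rw [Finset.sum_const, nsmul_eq_mul]

variable {X A : Type*} [MeasurableSpace X] [MeasurableSpace A] [MetricSpace (X × A)]
  {κ : KernelSpec} {T : Trajectory Ω X A} {K H : ℕ} {ι : Type*}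

/-- Union bound over episodes, steps, points `v` of a net and test functions `i`. -/
lemma measureReal_compl_forall_net_le (N : Finset ι) (C : Finset (X × A))
    (G : ℕ → ℕ → ι → X × A → Set Ω) {c δ : ℝ} (hc : N.card ≤ c) (hδ : 0 < δ)
    (hG : ∀ k ∈ Finset.Icc 1 K, ∀ h ∈ Finset.Icc 1 H, ∀ i ∈ N, ∀ v ∈ C,
      0 < K * H * C.card * c → μ.real (G k h i v)ᶜ ≤ δ / (K * H * C.card * c)) :
    μ.real {ω | ∀ k ∈ Finset.Icc 1 K, ∀ h ∈ Finset.Icc 1 H, ∀ i ∈ N, ∀ v ∈ C, ω ∈ G k h i v}ᶜ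
      ≤ δ := by
  set I : Finset (ℕ × ℕ × ι × (X × A)) := Finset.Icc 1 K ×ˢ Finset.Icc 1 H ×ˢ N ×ˢ C with hI
  have hcard : I.card = K * (H * (N.card * C.card)) := by
    simp [hI, Finset.card_product]
  have e : {ω | ∀ k ∈ Finset.Icc 1 K, ∀ h ∈ Finset.Icc 1 H, ∀ i ∈ N, ∀ v ∈ C, ω ∈ G k h i v}
      = {ω | ∀ j ∈ I, ω ∈ G j.1 j.2.1 j.2.2.1 j.2.2.2} := by
    ext ω
    simp only [hI, Finset.mem_product, mem_ofPred_eq, Prod.forall]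
    constructor
    · rintro h k l i x a ⟨h1, h2, h3, h4⟩
      exact h k h1 l h2 i h3 x a h4
    · intro h k h1 l h2 i h3 x a h4
      exact h k l i x a ⟨h1, h2, h3, h4⟩
  rw [e]
  have hc0 : 0 ≤ c := (Nat.cast_nonneg _).trans hc
  -- With no index there is nothing to bound; any index makes the denominator K H |C| c positive.
  rcases I.eq_empty_or_nonempty with h0 | ⟨⟨k, l, i, v⟩, hne⟩
  · rw [h0]; simp [hδ.le]
  have hpos : 0 < (K : ℝ) * H * C.card * c := by
    simp only [hI, Finset.mem_product] at hne
    obtain ⟨h1, h2, h3, h4⟩ := hne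
    have hK : 0 < K := by have := Finset.mem_Icc.1 h1; omega
    have hH : 0 < H := by have := Finset.mem_Icc.1 h2; omega
    have hN : 0 < N.card := Finset.card_pos.2 ⟨_, h3⟩
    have hC : 0 < C.card := Finset.card_pos.2 ⟨_, h4⟩
    have : 0 < c := lt_of_lt_of_le (by exact_mod_cast hN) hc
    positivity
  refine (measureReal_compl_forall_le I _ (q := δ / (K * H * C.card * c)) fun j hj => ?_).trans ?_
  · simp only [hI, Finset.mem_product] at hj
    exact hG _ hj.1 _ hj.2.1 _ hj.2.2.1 _ hj.2.2.2 hpos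
  · rw [mul_div_assoc', div_le_iff₀ hpos, mul_comm]
    refine mul_le_mul_of_nonneg_left ?_ hδ.le
    rw [hcard]; push_cast
    calc (K : ℝ) * (H * (N.card * C.card)) = K * H * C.card * N.card := by ring
      _ ≤ _ := mul_le_mul_of_nonneg_left hc (by positivity)

/-- The level L is the logarithm for which √(1 + k/β) e^{-L} equals the share δ/(K H |C| c) of one
index. -/
lemma measureReal_hoeffding_net_le (N : Finset ι) (C : Finset (X × A))
    {Z : ℕ → ℕ → ι → ℕ → Ω → ℝ} {m : ℕ → ℕ → ι → ℕ → X × A → ℝ} {B c δ : ℝ}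
    (hnoise : ∀ k ∈ Finset.Icc 1 K, ∀ h ∈ Finset.Icc 1 H, ∀ i ∈ N, ∀ v ∈ C,
      IsWeightedNoise μ (fun s => T.history H s h) k (fun s => weight κ T k h s v) (Z k h i)
        (fun s ω => m k h i s (T.x s h ω, T.a s h ω)) B)
    (hc : N.card ≤ c) (hδ : 0 < δ) :
    μ.real {ω | ∀ k ∈ Finset.Icc 1 K, ∀ h ∈ Finset.Icc 1 H, ∀ i ∈ N, ∀ v ∈ C,
      |weightedDeviation κ T k h (fun s => Z k h i s ω) (m k h i) v ω|
        ≤ √(2 * B ^ 2 * Real.log (K * H * C.card * √(1 + k / κ.β) / δ * c)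
          * count κ T k h v ω)}ᶜ ≤ δ := by
  refine measureReal_compl_forall_net_le N C (fun k h i v => {ω |
      |weightedDeviation κ T k h (fun s => Z k h i s ω) (m k h i) v ω|
        ≤ √(2 * B ^ 2 * Real.log (K * H * C.card * √(1 + k / κ.β) / δ * c)
          * count κ T k h v ω)}) hc hδ ?_
  intro k hk h hh i hi v hv hpos
  have hβ := κ.β_pos
  have := (hnoise k hk h hh i hi v hv).hoeffding hβ
    (Real.log (K * H * C.card * √(1 + k / κ.β) / δ * c))
  have hsq : 0 < √(1 + k / κ.β) := Real.sqrt_pos.2 (by positivity)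
  have harg : K * H * C.card * √(1 + k / κ.β) / δ * c
      = (K * H * C.card * c) * (√(1 + k / κ.β) / δ) := by ring
  have e : √(1 + k / κ.β) * Real.exp (-Real.log (K * H * C.card * √(1 + k / κ.β) / δ * c))
      = δ / (K * H * C.card * c) := by
    rw [Real.exp_neg, Real.exp_log (by rw [harg]; positivity), harg]
    field_simp
  rw [e] at this
  refine le_trans (le_of_eq ?_) this
  congr 1
  ext ω
  simp only [mem_compl_iff, mem_ofPred_eq, not_le]
  rfl

/-- The factor 2 in the logarithm splits the share of one index between the two tails. -/
lemma measureReal_bernstein_net_le (N : Finset ι) (C : Finset (X × A))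
    {Z : ℕ → ℕ → ι → ℕ → Ω → ℝ} {m v : ℕ → ℕ → ι → ℕ → X × A → ℝ} {B c δ t : ℝ}
    (ht : 0 < t) (htB : t * (2 * B) ≤ 1)
    (hnoise : ∀ k ∈ Finset.Icc 1 K, ∀ h ∈ Finset.Icc 1 H, ∀ i ∈ N, ∀ u ∈ C,
      IsWeightedNoise μ (fun s => T.history H s h) k (fun s => weight κ T k h s u) (Z k h i)
        (fun s ω => m k h i s (T.x s h ω, T.a s h ω)) B)
    (hv : ∀ k ∈ Finset.Icc 1 K, ∀ h ∈ Finset.Icc 1 H, ∀ i ∈ N, ∀ s ∈ Finset.Ico 1 k,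
      μ[fun ω => Z k h i s ω ^ 2 | T.history H s h]
        =ᵐ[μ] fun ω => v k h i s (T.x s h ω, T.a s h ω))
    (hvm : ∀ k h i s, i ∈ N → Measurable (v k h i s))
    (hvar : ∀ k h i s u, i ∈ N → 0 ≤ v k h i s u - m k h i s u ^ 2)
    (hc : N.card ≤ c) (hδ : 0 < δ) :
    μ.real {ω | ∀ k ∈ Finset.Icc 1 K, ∀ h ∈ Finset.Icc 1 H, ∀ i ∈ N, ∀ u ∈ C,
      |weightedDeviation κ T k h (fun s => Z k h i s ω) (m k h i) u ω|
        ≤ Real.log (2 * (K * H * C.card * c) / δ) / t + t * ∑ s ∈ Finset.Ico 1 k,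
          weight κ T k h s u ω * (v k h i s (T.x s h ω, T.a s h ω)
            - m k h i s (T.x s h ω, T.a s h ω) ^ 2)}ᶜ ≤ δ := by
  refine measureReal_compl_forall_net_le N C (fun k h i u => {ω |
      |weightedDeviation κ T k h (fun s => Z k h i s ω) (m k h i) u ω|
        ≤ Real.log (2 * (K * H * C.card * c) / δ) / t + t * ∑ s ∈ Finset.Ico 1 k,
          weight κ T k h s u ω * (v k h i s (T.x s h ω, T.a s h ω)
            - m k h i s (T.x s h ω, T.a s h ω) ^ 2)}) hc hδ ?_
  intro k hk h hh i hi u hu hpos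
  have hh1 := (Finset.mem_Icc.1 hh).1
  have hn := hnoise k hk h hh i hi u hu
  have hvm' : ∀ s ∈ Finset.Ico 1 k,
      Measurable[T.history H s h] fun ω => v k h i s (T.x s h ω, T.a s h ω) := fun s _ =>
    (hvm k h i s hi).comp (T.measurable_pair_history hh1)
  have b1 := hn.bernstein ht htB (v := fun s ω => v k h i s (T.x s h ω, T.a s h ω)) hvm'
    (hv k hk h hh i hi) (fun s ω => hvar k h i s _ hi) (Real.log (2 * (K * H * C.card * c) / δ))
  have b2 := hn.neg.bernstein ht htB (v := fun s ω => v k h i s (T.x s h ω, T.a s h ω)) hvm'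
    (fun s hs => by simpa only [neg_sq] using hv k hk h hh i hi s hs)
    (fun s ω => by simpa only [neg_sq] using hvar k h i s _ hi)
    (Real.log (2 * (K * H * C.card * c) / δ))
  have e : Real.exp (-Real.log (2 * (K * H * C.card * c) / δ))
      = δ / (K * H * C.card * c) / 2 := by
    rw [Real.exp_neg, Real.exp_log (by positivity)]
    field_simp
  rw [e] at b1 b2
  simp only [neg_sq, noiseSum_neg] at b2
  refine (measureReal_mono (fun ω hω => ?_)).trans ((measureReal_union_le _ _).trans
    ((add_le_add b1 b2).trans (le_of_eq (add_halves _))))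
  simp only [mem_compl_iff, mem_ofPred_eq, not_le] at hω
  exact lt_abs.1 hω

end UnionBound

/-! ### Probabilities of the reward, optimal-value and uniform events -/

section EventProbabilities

variable {Ω X A : Type*} [MeasurableSpace Ω] {μ : Measure Ω} [IsProbabilityMeasure μ]
  [MetricSpace X] [MeasurableSpace X] [BorelSpace X] [MeasurableSpace A]
  [MetricSpace (X × A)] [OpensMeasurableSpace (X × A)]
  {κ : KernelSpec} {M : MDP X A} {T : Trajectory Ω X A} {K H k h : ℕ} {Lr Lp δ : ℝ}

/-- The normalized weights and β/C add up to one, so each of the two operators moves by at most ε.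
-/
lemma abs_estP_sub_avP_sub_le {f g : X → ℝ} (hf : Measurable f) (hg : Measurable g) {B ε : ℝ}
    (hfB : ∀ x, |f x| ≤ B) (hgB : ∀ x, |g x| ≤ B) (hfg : ∀ x, |f x - g x| ≤ ε) (u : X × A)
    (ω : Ω) :
    |(estP κ T k h f u ω - avP κ M T k h f u ω) - (estP κ T k h g u ω - avP κ M T k h g u ω)|
      ≤ 2 * ε := by
  have hC := count_pos (κ := κ) (T := T) k h u ω
  have hw : ∀ s, 0 ≤ normWeight κ T k h s u ω := fun s =>
    div_nonneg (weight_mem k h s u ω).1 hC.le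
  have hsum : ∑ s ∈ Finset.Ico 1 k, normWeight κ T k h s u ω + κ.β / count κ T k h u ω = 1 := by
    simp only [normWeight]
    rw [← Finset.sum_div, ← add_div, add_comm]
    exact div_self hC.ne'
  have hβ : 0 ≤ κ.β / count κ T k h u ω := div_nonneg κ.β_pos.le hC.le
  -- Any state of the trajectory serves as a witness that X is nonempty.
  have hε : 0 ≤ ε := (abs_nonneg _).trans (hfg (T.x 0 0 ω))
  have hint : ∀ s, |(∫ y, f y ∂(M.P s h u)) - ∫ y, g y ∂(M.P s h u)| ≤ ε := fun s => by
    have := M.markov s h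
    rw [← integral_sub (integrable_of_bounded hf hfB _) (integrable_of_bounded hg hgB _)]
    exact M.abs_integral_le s h u (hf.sub hg) hfg
  have h1 : |estP κ T k h f u ω - estP κ T k h g u ω|
      ≤ (∑ s ∈ Finset.Ico 1 k, normWeight κ T k h s u ω) * ε := by
    rw [estP, estP, ← Finset.sum_sub_distrib, Finset.sum_mul]
    refine (Finset.abs_sum_le_sum_abs _ _).trans (Finset.sum_le_sum fun s _ => ?_)
    rw [← mul_sub, abs_mul, abs_of_nonneg (hw s)]
    exact mul_le_mul_of_nonneg_left (hfg _) (hw s)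
  have h2 : |avP κ M T k h f u ω - avP κ M T k h g u ω|
      ≤ (∑ s ∈ Finset.Ico 1 k, normWeight κ T k h s u ω) * ε + κ.β / count κ T k h u ω * ε := by
    have e : avP κ M T k h f u ω - avP κ M T k h g u ω
        = ∑ s ∈ Finset.Ico 1 k, normWeight κ T k h s u ω *
            ((∫ y, f y ∂(M.P s h u)) - ∫ y, g y ∂(M.P s h u))
          + κ.β / count κ T k h u ω *
            ((∫ y, f y ∂(M.P k h u)) - ∫ y, g y ∂(M.P k h u)) := by
      simp only [avP, mul_sub, Finset.sum_sub_distrib]; ring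
    rw [e]
    refine (abs_add_le _ _).trans (add_le_add ?_ ?_)
    · rw [Finset.sum_mul]
      refine (Finset.abs_sum_le_sum_abs _ _).trans (Finset.sum_le_sum fun s _ => ?_)
      rw [abs_mul, abs_of_nonneg (hw s)]
      exact mul_le_mul_of_nonneg_left (hint s) (hw s)
    · rw [abs_mul, abs_of_nonneg hβ]
      exact mul_le_mul_of_nonneg_left (hint k) hβ
  have h3 : |(estP κ T k h f u ω - avP κ M T k h f u ω)
      - (estP κ T k h g u ω - avP κ M T k h g u ω)|
      ≤ |estP κ T k h f u ω - estP κ T k h g u ω|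
        + |avP κ M T k h f u ω - avP κ M T k h g u ω| := by
    rw [sub_sub_sub_comm]; exact abs_sub _ _
  have h4 := mul_nonneg hβ hε
  have h5 : (∑ s ∈ Finset.Ico 1 k, normWeight κ T k h s u ω) * ε
      + κ.β / count κ T k h u ω * ε = ε := by rw [← add_mul, hsum, one_mul]
  linarith

lemma mem_Icc_of_mem_Ico {s : ℕ} (hk : k ∈ Finset.Icc 1 K) (hs : s ∈ Finset.Ico 1 k) :
    s ∈ Finset.Icc 1 K := by
  simp only [Finset.mem_Icc, Finset.mem_Ico] at hs hk ⊢; omega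

lemma abs_estP_sub_avP_le (hM : M.IsLipschitz K H Lr Lp) (hX : ∃ d, HasCoveringExponent X d)
    (hLp : 0 ≤ Lp) (hk : k ∈ Finset.Icc 1 K) (hh : h ∈ Finset.Icc 1 H) {L B : ℝ} (hL : 0 ≤ L)
    {f : X → ℝ} (hf : f ∈ boundedLipschitz X L B) (u : X × A) (ω : Ω) :
    |estP κ T k h f u ω - avP κ M T k h f u ω| ≤
      |weightedDeviation κ T k h (fun s => f (T.x s (h + 1) ω)) (fun s v => ∫ y, f y ∂(M.P s h v))
        u ω| / count κ T k h u ω + 2 * (L * Lp) * spatialFactor κ k * κ.σ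
        + κ.β * B / count κ T k h u ω :=
  abs_estimate_sub_average_le (Finset.mem_Icc.1 hk).1 h (fun s => f (T.x s (h + 1) ω))
    (fun s v => ∫ y, f y ∂(M.P s h v)) (mul_nonneg hL hLp) u ω
    (fun s hs v => by
      rw [dist_comm]
      exact hM.abs_integral_sub_le hX (mem_Icc_of_mem_Ico hk hs) hh hL hf.1 v u)
    (M.abs_integral_le k h u (boundedLipschitz_measurable hf) hf.2)

lemma measureReal_compl_eventReward_le (hXA : ∃ d, HasCoveringExponent (X × A) d) (hK : 1 ≤ K)
    (hLr : 0 ≤ Lr) (hδ : 0 < δ) (hM : M.IsLipschitz K H Lr Lp) (hT : T.IsInteraction M K H μ) :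
    μ.real (eventReward κ M T K H Lr δ)ᶜ ≤ δ := by
  have hK0 : (0 : ℝ) < K := by exact_mod_cast hK
  have hσ := κ.σ_pos
  have hβ := κ.β_pos
  have hC₂ := κ.C₂_pos
  -- At this radius r the total change of the weights, K C₂ r/σ, is C₂σ.
  obtain ⟨C, hC, hcov⟩ := exists_net hXA (ε := κ.σ ^ 2 / K) (by positivity)
  -- There is no function class here; a single dummy index stands for it.
  have hE := measureReal_hoeffding_net_le (μ := μ) (κ := κ) (T := T) (K := K) (H := H)
    ({()} : Finset Unit) C (Z := fun _ h _ s => T.rew s h) (m := fun _ h _ s => M.r s h) (B := 1)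
    (c := 1) (δ := δ) (fun k hk h hh _ _ v _ => hT.isWeightedNoise_rew hk hh v) (by simp) hδ
  -- Rewards are bounded only almost surely, so the net event implies the target event up to a null
  -- set.
  have hrew : ∀ᵐ ω ∂μ, ∀ s ∈ Finset.Icc 1 K, ∀ h ∈ Finset.Icc 1 H,
      T.rew s h ω ∈ Icc (0 : ℝ) 1 := by
    rw [Filter.eventually_all_finset]
    intro s hs
    rw [Filter.eventually_all_finset]
    exact hT.rew_mem s hs
  refine measureReal_compl_le_of_ae hE ?_
  filter_upwards [hrew] with ω hω hgood u k hk h hh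
  obtain ⟨v, hv, huv⟩ := hcov u
  have h0 := hgood k hk h hh () (by simp) v hv
  rw [hC, mul_one, ← logR] at h0
  have h1 := abs_weightedDeviation_div_count_le hk h zero_le_one huv (fun s hs => by
    have hsK := mem_Icc_of_mem_Ico hk hs
    have h2 := hω s hsK h hh
    have h3 := M.r_mem s h (T.x s h ω, T.a s h ω)
    rw [abs_le]; constructor <;> linarith [h2.1, h2.2, h3.1, h3.2]) h0
  have h2 := abs_estimate_sub_average_le (κ := κ) (T := T) (Finset.mem_Icc.1 hk).1 h
    (fun s => T.rew s h ω) (fun s => M.r s h) hLr (B := 1) u ω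
    (fun s hs v => by
      rw [dist_comm]; exact hM.reward s (mem_Icc_of_mem_Ico hk hs) h hh v u)
    (by rw [abs_of_nonneg (M.r_mem k h u).1]; exact (M.r_mem k h u).2)
  have e : (K : ℝ) * (κ.C₂ * (κ.σ ^ 2 / K / κ.σ)) = κ.C₂ * κ.σ := by field_simp
  rw [e, one_pow, mul_one, one_mul] at h1
  rw [estR, avR, bR]
  -- The net transfer costs 2C₂σ/β; the width allows 4C₂σ/β and the surplus is dropped.
  have h3 : 0 ≤ κ.C₂ / κ.β * κ.σ := by positivity
  calc _ ≤ _ := h2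
    _ ≤ _ := add_le_add (add_le_add h1 le_rfl) le_rfl
    _ = √(2 * logR X A κ K H k δ / count κ T k h u ω) + κ.β / count κ T k h u ω
        + ((κ.C₂ / (2 * κ.β ^ (3 / 2 : ℝ)) * √(2 * logR X A κ K H k δ) + 4 * κ.C₂ / κ.β)
          + 2 * Lr * spatialFactor κ k) * κ.σ - 2 * (κ.C₂ / κ.β * κ.σ) := by ring
    _ ≤ _ := by linarith

lemma measureReal_compl_eventOptimalValue_le [Nonempty A]
    (hdist : ∀ (x x' : X) (a : A), dist (x, a) (x', a) ≤ dist x x')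
    (hX : ∃ d, HasCoveringExponent X d) (hXA : ∃ d, HasCoveringExponent (X × A) d) (hK : 1 ≤ K)
    (hH : 1 ≤ H) (hLr : 0 ≤ Lr) (hLp : 0 ≤ Lp) (hδ : 0 < δ) (hM : M.IsLipschitz K H Lr Lp)
    (hT : T.IsInteraction M K H μ) :
    μ.real (eventOptimalValue κ M T K H Lr Lp δ)ᶜ ≤ δ := by
  have hK0 : (0 : ℝ) < K := by exact_mod_cast hK
  have hH0 : (0 : ℝ) < H := by exact_mod_cast hH
  have hσ := κ.σ_pos
  have hβ := κ.β_pos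
  have hC₂ := κ.C₂_pos
  have hV : ∀ k ∈ Finset.Icc 1 K, ∀ h,
      M.optimalValue H k (h + 1) ∈ boundedLipschitz X (lipQ H Lr Lp) H := fun k hk h =>
    hM.optimalValue_mem hdist hX hLr hLp hk (by omega)
  -- The further factor H in the radius offsets the range H of the value functions.
  obtain ⟨C, hC, hcov⟩ := exists_net hXA (ε := κ.σ ^ 2 / (K * H)) (by positivity)
  have hE := measureReal_hoeffding_net_le (μ := μ) (κ := κ) (T := T) (K := K) (H := H)
    ({()} : Finset Unit) C
    (Z := fun k h _ s ω => M.optimalValue H k (h + 1) (T.x s (h + 1) ω))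
    (m := fun k h _ s u => ∫ y, M.optimalValue H k (h + 1) y ∂(M.P s h u)) (B := H)
    (c := 1) (δ := δ) (fun k hk h hh _ _ v _ => hT.isWeightedNoise_next hk hh v
      (boundedLipschitz_measurable (hV k hk h)) hH0 (hV k hk h).2) (by simp) hδ
  refine measureReal_compl_le_of_ae hE (ae_of_all _ fun ω hgood u k hk h hh => ?_)
  obtain ⟨v, hv, huv⟩ := hcov u
  have h0 := hgood k hk h hh () (by simp) v hv
  rw [hC, mul_one, ← logP] at h0
  have h1 := abs_weightedDeviation_div_count_le hk h hH0.le huv (fun s _ => by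
    have h2 := (hV k hk h).2 (T.x s (h + 1) ω)
    have h3 := M.abs_integral_le s h (T.x s h ω, T.a s h ω)
      (boundedLipschitz_measurable (hV k hk h)) (hV k hk h).2
    exact (abs_sub _ _).trans (by linarith)) h0
  have h2 := abs_estP_sub_avP_le (κ := κ) (T := T) hM hX hLp hk hh (lipQ_nonneg hLr hLp H)
    (hV k hk h) u ω
  have e : (K : ℝ) * (κ.C₂ * (κ.σ ^ 2 / (K * H) / κ.σ)) = κ.C₂ * κ.σ / H := by field_simp
  rw [e] at h1
  rw [bP]
  have h3 : 0 ≤ κ.C₂ / κ.β * κ.σ := by positivity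
  calc _ ≤ _ := h2
    _ ≤ _ := add_le_add (add_le_add h1 le_rfl) le_rfl
    _ = √(2 * H ^ 2 * logP X A κ K H k δ / count κ T k h u ω) + κ.β * H / count κ T k h u ω
        + ((κ.C₂ / (2 * κ.β ^ (3 / 2 : ℝ)) * √(2 * logP X A κ K H k δ) + 4 * κ.C₂ / κ.β)
          + 2 * Lp * lipQ H Lr Lp * spatialFactor κ k) * κ.σ - 2 * (κ.C₂ / κ.β * κ.σ) := by
        field_simp; ring
    _ ≤ _ := by linarith

/-- The net of the function class at the scale of the bandwidth. -/
lemma exists_bandwidth_net (hX : ∃ d, HasCoveringExponent X d) (hH : 1 ≤ H) (hLr : 0 < Lr)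
    (hLp : 0 ≤ Lp) (hσ : lipQ H Lr Lp * κ.σ ≤ 2 * H) :
    ∃ N : Finset (X → ℝ), (∀ g ∈ N, g ∈ boundedLipschitz X (2 * lipQ H Lr Lp) (2 * H)) ∧
      (N.card : ℝ) ≤ (2 * H / (lipQ H Lr Lp * κ.σ)) ^ covNum X κ.σ ∧
      ∀ f ∈ boundedLipschitz X (2 * lipQ H Lr Lp) (2 * H), ∃ g ∈ N,
        ∀ x, |f x - g x| ≤ 8 * lipQ H Lr Lp * κ.σ := by
  have hH0 : (0 : ℝ) < H := by exact_mod_cast hH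
  have hQ := lipQ_pos hLr hLp hH
  have hs := κ.σ_pos
  have hQσ : 0 < lipQ H Lr Lp * κ.σ := mul_pos hQ hs
  set a : ℝ := 2 * H / (lipQ H Lr Lp * κ.σ) with ha
  have ha1 : 1 ≤ a := (one_le_div hQσ).2 hσ
  -- The net uses ⌊a⌋ cells; the assumption on L_Q σ guarantees at least one. Rounding down keeps
  -- the cardinality below the stated power, while a ≤ 2⌊a⌋ limits the cell width to 4L_Qσ. The
  -- Lipschitz steps add another 4L_Qσ.
  have hm : 1 ≤ ⌊a⌋₊ := Nat.one_le_floor_iff _ |>.2 ha1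
  obtain ⟨N, h1, h2, h3⟩ := exists_net_boundedLipschitz hX (L := 2 * lipQ H Lr Lp)
    (B := 2 * H) (ε := κ.σ) (by linarith) (by linarith) hs hm
  refine ⟨N, h1, ?_, fun f hf => ?_⟩
  · calc (N.card : ℝ) ≤ ((⌊a⌋₊ ^ covNum X κ.σ : ℕ) : ℝ) := by exact_mod_cast h2
      _ ≤ a ^ covNum X κ.σ := by
        push_cast
        exact pow_le_pow_left₀ (Nat.cast_nonneg _) (Nat.floor_le (by linarith)) _
  · obtain ⟨g, hg, hfg⟩ := h3 f hf
    refine ⟨g, hg, fun x => (hfg x).trans ?_⟩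
    have hm1 : (1 : ℝ) ≤ ⌊a⌋₊ := by exact_mod_cast hm
    have hlt := Nat.lt_floor_add_one a
    have : 2 * (2 * (H : ℝ)) / ⌊a⌋₊ ≤ 4 * (lipQ H Lr Lp * κ.σ) := by
      rw [div_le_iff₀ (by linarith)]
      have e : 2 * (H : ℝ) = lipQ H Lr Lp * κ.σ * a := by rw [ha]; field_simp
      nlinarith
    linarith

lemma measureReal_compl_eventUniform_le
    (hX : ∃ d, HasCoveringExponent X d) (hXA : ∃ d, HasCoveringExponent (X × A) d) (hK : 1 ≤ K)
    (hH : 1 ≤ H) (hLr : 0 < Lr) (hLp : 0 ≤ Lp) (hδ : 0 < δ) (hσ : lipQ H Lr Lp * κ.σ ≤ 2 * H)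
    (hM : M.IsLipschitz K H Lr Lp) (hT : T.IsInteraction M K H μ) :
    μ.real (eventUniform κ M T K H Lr Lp δ)ᶜ ≤ δ := by
  have hK0 : (0 : ℝ) < K := by exact_mod_cast hK
  have hH0 : (0 : ℝ) < H := by exact_mod_cast hH
  have hs := κ.σ_pos
  have hβ := κ.β_pos
  have hC₂ := κ.C₂_pos
  have hQ := lipQ_pos hLr hLp hH
  obtain ⟨N, hN, hNc, hNcov⟩ := exists_bandwidth_net (κ := κ) hX hH hLr hLp hσ
  obtain ⟨C, hC, hcov⟩ := exists_net hXA (ε := κ.σ ^ (2 + coveringDim X / 2) / (K * H))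
    (by positivity)
  have hE := measureReal_hoeffding_net_le (μ := μ) (κ := κ) (T := T) (K := K) (H := H) N C
    (Z := fun _ h g s ω => g (T.x s (h + 1) ω))
    (m := fun _ h g s u => ∫ y, g y ∂(M.P s h u)) (B := 2 * H) (δ := δ)
    (fun k hk h hh g hg v _ => hT.isWeightedNoise_next hk hh v
      (boundedLipschitz_measurable (hN g hg)) (by linarith) (hN g hg).2) hNc hδ
  refine measureReal_compl_le_of_ae hE (ae_of_all _ fun ω hgood u k hk h hh f hf => ?_)
  obtain ⟨v, hv, huv⟩ := hcov u
  obtain ⟨g, hg, hfg⟩ := hNcov f hf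
  have h0 := hgood k hk h hh g hg v hv
  rw [hC, ← logUnif] at h0
  have h1 := abs_weightedDeviation_div_count_le hk h (by linarith) huv (fun s _ => by
    have h2 := (hN g hg).2 (T.x s (h + 1) ω)
    have h3 := M.abs_integral_le s h (T.x s h ω, T.a s h ω)
      (boundedLipschitz_measurable (hN g hg)) (hN g hg).2
    exact (abs_sub _ _).trans (by linarith)) h0
  have h2 := abs_estP_sub_avP_le (κ := κ) (T := T) hM hX hLp hk hh
    (mul_nonneg zero_le_two hQ.le) (hN g hg) u ω
  have h3 := abs_estP_sub_avP_sub_le (κ := κ) (T := T) (M := M) (k := k) (h := h)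
    (boundedLipschitz_measurable hf)
    (boundedLipschitz_measurable (hN g hg)) hf.2 (hN g hg).2 hfg u ω
  have hpow : κ.σ ^ (2 + coveringDim X / 2) = κ.σ ^ (1 + coveringDim X / 2) * κ.σ := by
    rw [← Real.rpow_add_one hs.ne']; congr 1; ring
  -- One power of σ is lost to the Lipschitz constant of the weights, and the 1/H cancels the H in
  -- the range 2H of the class.
  have e : (K : ℝ) * (κ.C₂ * (κ.σ ^ (2 + coveringDim X / 2) / (K * H) / κ.σ))
      = κ.C₂ * κ.σ ^ (1 + coveringDim X / 2) / H := by rw [hpow]; field_simp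
  have hsqrt : √(8 * logUnif X A κ K H Lr Lp k δ)
      = 2 * √(2 * logUnif X A κ K H Lr Lp k δ) := by
    rw [show 8 * logUnif X A κ K H Lr Lp k δ = 2 ^ 2 * (2 * logUnif X A κ K H Lr Lp k δ) by ring,
      Real.sqrt_mul (by norm_num), Real.sqrt_sq (by norm_num)]
  rw [e] at h1
  rw [θ₁, θ₂, hsqrt]
  have h4 := abs_sub_abs_le_abs_sub (estP κ T k h f u ω - avP κ M T k h f u ω)
    (estP κ T k h g u ω - avP κ M T k h g u ω)
  have h5 : 0 ≤ lipQ H Lr Lp * κ.σ := by positivity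
  have h6 : (2 * (2 * (H : ℝ)) ^ 2 * logUnif X A κ K H Lr Lp k δ)
    = 8 * H ^ 2 * logUnif X A κ K H Lr Lp k δ := by ring
  rw [h6] at h1
  -- Replacing f by its net function costs 16L_Qσ, half of the 32L_Qσ in θ².
  calc |estP κ T k h f u ω - avP κ M T k h f u ω|
      ≤ |estP κ T k h g u ω - avP κ M T k h g u ω| + 2 * (8 * lipQ H Lr Lp * κ.σ) := by linarith
    _ ≤ _ := add_le_add h2 le_rfl
    _ ≤ _ := add_le_add (add_le_add (add_le_add h1 le_rfl) le_rfl) le_rfl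
    _ = √(8 * H ^ 2 * logUnif X A κ K H Lr Lp k δ / count κ T k h u ω)
        + 2 * κ.β * H / count κ T k h u ω
        + (4 * κ.C₂ / κ.β + κ.C₂ / (2 * κ.β ^ (3 / 2 : ℝ))
          * (2 * √(2 * logUnif X A κ K H Lr Lp k δ))) * κ.σ ^ (1 + coveringDim X / 2)
        + (4 * Lp * lipQ H Lr Lp * spatialFactor κ k + 32 * lipQ H Lr Lp) * κ.σ
        - 16 * (lipQ H Lr Lp * κ.σ) := by
        field_simp; ring
    _ ≤ _ := by linarith

end EventProbabilities

/-! ### Probability of the Bernstein event -/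

section BernsteinEvent

variable {Ω X A : Type*} [MeasurableSpace Ω] {μ : Measure Ω} [IsProbabilityMeasure μ]
  [MetricSpace X] [MeasurableSpace X] [BorelSpace X] [MeasurableSpace A]
  [MetricSpace (X × A)] [OpensMeasurableSpace (X × A)]
  {κ : KernelSpec} {M : MDP X A} {T : Trajectory Ω X A} {K H k h : ℕ} {Lr Lp δ : ℝ}

lemma MDP.sq_integral_le (M : MDP X A) (s h : ℕ) (u : X × A) {f : X → ℝ} (hf : Measurable f)
    {B : ℝ} (hB : ∀ x, |f x| ≤ B) :
    0 ≤ (∫ y, f y ^ 2 ∂(M.P s h u)) - (∫ y, f y ∂(M.P s h u)) ^ 2 := by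
  have := M.markov s h
  set a := ∫ y, f y ∂(M.P s h u) with ha
  have i1 := integrable_of_bounded hf hB (M.P s h u)
  have i2 : Integrable (fun y => f y ^ 2) (M.P s h u) :=
    integrable_of_bounded (hf.pow_const 2) (B := B ^ 2) (fun x => by
      rw [abs_pow]; exact pow_le_pow_left₀ (abs_nonneg _) (hB x) 2) _
  have h1 : 0 ≤ ∫ y, (f y - a) ^ 2 ∂(M.P s h u) := integral_nonneg fun y => sq_nonneg _
  have h2 : ∫ y, (f y - a) ^ 2 ∂(M.P s h u) = (∫ y, f y ^ 2 ∂(M.P s h u)) - a ^ 2 := by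
    have e : ∀ y, (f y - a) ^ 2 = f y ^ 2 - 2 * a * f y + a ^ 2 := fun y => by ring
    simp only [e]
    have i3 : Integrable (fun y => f y ^ 2 - 2 * a * f y) (M.P s h u) := i2.sub (i1.const_mul _)
    rw [integral_add i3 (integrable_const _), integral_sub i2 (i1.const_mul _), integral_const_mul, ← ha]
    simp; ring
  linarith

lemma MDP.integral_sq_le (M : MDP X A) (s h : ℕ) (u : X × A) {f : X → ℝ} (hf : Measurable f)
    {B : ℝ} (hB : ∀ x, |f x| ≤ B) :
    ∫ y, f y ^ 2 ∂(M.P s h u) ≤ B * ∫ y, |f y| ∂(M.P s h u) := by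
  have := M.markov s h
  rw [← integral_const_mul]
  refine integral_mono
    (integrable_of_bounded (hf.pow_const 2) (B := B ^ 2) (fun x => by
      rw [abs_pow]; exact pow_le_pow_left₀ (abs_nonneg _) (hB x) 2) _)
    ((integrable_of_bounded hf hB _).abs.const_mul B) fun y => ?_
  show f y ^ 2 ≤ B * |f y|
  rw [← sq_abs, sq]
  exact mul_le_mul_of_nonneg_right (hB y) (abs_nonneg _)

/-- The conditional variances along the data are controlled by `P|f|`, up to the spatial and
temporal biases. -/
lemma sum_weight_mul_variance_le (hX : ∃ d, HasCoveringExponent X d)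
    (hM : M.IsLipschitz K H Lr Lp) (hLr : 0 ≤ Lr) (hLp : 0 ≤ Lp) (hk : k ∈ Finset.Icc 1 K)
    (hh : h ∈ Finset.Icc 1 H) {f : X → ℝ}
    (hf : f ∈ boundedLipschitz X (2 * lipQ H Lr Lp) (2 * H)) (u : X × A) (ω : Ω) :
    ∑ s ∈ Finset.Ico 1 k, weight κ T k h s u ω *
      ((∫ y, f y ^ 2 ∂(M.P s h (T.x s h ω, T.a s h ω)))
        - (∫ y, f y ∂(M.P s h (T.x s h ω, T.a s h ω))) ^ 2)
      ≤ count κ T k h u ω * (2 * H * ((∫ y, |f y| ∂(M.P k h u)) + 2 * biasP κ M H Lr Lp k h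
        + 4 * Lp * lipQ H Lr Lp * spatialFactor κ k * κ.σ)) := by
  have hQ := lipQ_nonneg hLr hLp H
  have hfm := boundedLipschitz_measurable hf
  have hfa := boundedLipschitz_abs hf
  have h1 := sum_weight_mul_integral_le (κ := κ) (T := T) (M := M) (k := k) (h := h) hX hLr hLp
    hfa (fun x => abs_nonneg _) u ω
  have h2 := sum_weight_mul_dist_le (κ := κ) (T := T) (Finset.mem_Icc.1 hk).1 h u ω
  have h3 : ∀ s ∈ Finset.Ico 1 k, weight κ T k h s u ω *
      ((∫ y, f y ^ 2 ∂(M.P s h (T.x s h ω, T.a s h ω)))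
        - (∫ y, f y ∂(M.P s h (T.x s h ω, T.a s h ω))) ^ 2)
      ≤ 2 * H * (weight κ T k h s u ω * (∫ y, |f y| ∂(M.P s h u))
        + 2 * lipQ H Lr Lp * Lp *
          (weight κ T k h s u ω * dist u (T.x s h ω, T.a s h ω))) := by
    intro s hs
    set p := (T.x s h ω, T.a s h ω)
    have w0 := (weight_mem (κ := κ) (T := T) k h s u ω).1
    have a1 := M.integral_sq_le s h p hfm hf.2
    have a2 := (abs_le.1 (hM.abs_integral_sub_le hX (mem_Icc_of_mem_Ico hk hs) hh
      (mul_nonneg zero_le_two hQ) hfa.1 p u)).2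
    rw [dist_comm] at a2
    have a3 : (∫ y, |f y| ∂(M.P s h p)) ≤ (∫ y, |f y| ∂(M.P s h u))
        + 2 * lipQ H Lr Lp * Lp * dist u p := by linarith
    have a4 := mul_le_mul_of_nonneg_left a3 (show (0 : ℝ) ≤ 2 * H by positivity)
    calc _ ≤ weight κ T k h s u ω * (2 * H * ((∫ y, |f y| ∂(M.P s h u))
          + 2 * lipQ H Lr Lp * Lp * dist u p)) := by
          refine mul_le_mul_of_nonneg_left ?_ w0
          have := sq_nonneg (∫ y, f y ∂(M.P s h p))
          linarith
      _ = _ := by ring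
  refine (Finset.sum_le_sum h3).trans ?_
  rw [← Finset.mul_sum, Finset.sum_add_distrib, ← Finset.mul_sum]
  have h4 := mul_le_mul_of_nonneg_left h2 (show 0 ≤ 2 * lipQ H Lr Lp * Lp by positivity)
  calc _ ≤ 2 * H * (count κ T k h u ω * ((∫ y, |f y| ∂(M.P k h u)) + 2 * biasP κ M H Lr Lp k h)
        + 2 * lipQ H Lr Lp * Lp * (2 * κ.σ * spatialFactor κ k * count κ T k h u ω)) :=
        mul_le_mul_of_nonneg_left (add_le_add h1 h4) (by positivity)
    _ = _ := by ring

/-- The Bernstein union bound needs only the factor 2 in the logarithm, which 4e(2k + 1) exceeds.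
Nonnegativity, which rests on δ ≤ 1, is what later permits enlarging constants in front of the
logarithm. -/
lemma logB_bound [Nonempty X] [Nonempty A]
    (hXA : ∃ d, HasCoveringExponent (X × A) d) (hK : 1 ≤ K) (hH : 1 ≤ H) (hLr : 0 < Lr)
    (hLp : 0 ≤ Lp) (hδ : 0 < δ) (hδ1 : δ ≤ 1) (hσ : lipQ H Lr Lp * κ.σ ≤ 2 * H) :
    0 ≤ logB X A κ K H Lr Lp k δ ∧
    Real.log (2 * (K * H * covNum (X × A) (κ.σ ^ (2 + coveringDim X) / (H ^ 2 * K)) *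
      (2 * H / (lipQ H Lr Lp * κ.σ)) ^ covNum X κ.σ) / δ) ≤ logB X A κ K H Lr Lp k δ := by
  have hK1 : (1 : ℝ) ≤ K := by exact_mod_cast hK
  have hH1 : (1 : ℝ) ≤ H := by exact_mod_cast hH
  have hs := κ.σ_pos
  have hQ := lipQ_pos hLr hLp hH
  have hN : (1 : ℝ) ≤ covNum (X × A) (κ.σ ^ (2 + coveringDim X) / (H ^ 2 * K)) := by
    exact_mod_cast covNum_pos hXA (by positivity)
  have hc : 1 ≤ (2 * H / (lipQ H Lr Lp * κ.σ)) ^ covNum X κ.σ :=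
    one_le_pow₀ ((one_le_div (mul_pos hQ hs)).2 hσ)
  set n := (covNum (X × A) (κ.σ ^ (2 + coveringDim X) / (H ^ 2 * K)) : ℝ)
  set c : ℝ := (2 * H / (lipQ H Lr Lp * κ.σ)) ^ covNum X κ.σ
  have hp : 1 ≤ K * H * n * c / δ := by
    rw [one_le_div hδ]
    refine hδ1.trans ?_
    have h1 := one_le_mul_of_one_le_of_one_le hK1 hH1
    exact one_le_mul_of_one_le_of_one_le (one_le_mul_of_one_le_of_one_le h1 hN) hc
  have he : 1 ≤ Real.exp 1 := Real.one_le_exp zero_le_one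
  have hk : (1 : ℝ) ≤ 2 * k + 1 := by
    have : (0 : ℝ) ≤ k := Nat.cast_nonneg k
    linarith
  have hlead : 2 ≤ 4 * Real.exp 1 * (2 * k + 1) := by
    nlinarith [one_le_mul_of_one_le_of_one_le he hk]
  have hle : 2 * (K * H * n * c) / δ
      ≤ 4 * Real.exp 1 * (2 * k + 1) / δ * (K * H) * n * c := by
    calc 2 * (K * H * n * c) / δ = 2 * (K * H * n * c / δ) := by ring
      _ ≤ 4 * Real.exp 1 * (2 * k + 1) * (K * H * n * c / δ) :=
        mul_le_mul_of_nonneg_right hlead (by linarith)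
      _ = _ := by ring
  have h2 : 1 ≤ 2 * (K * H * n * c) / δ := by
    rw [mul_div_assoc]; linarith
  have hlog : Real.log (2 * (K * H * n * c) / δ) ≤ logB X A κ K H Lr Lp k δ :=
    Real.log_le_log (by linarith) hle
  exact ⟨(Real.log_nonneg h2).trans hlog, hlog⟩

lemma measureReal_compl_eventBernstein_le [Nonempty X] [Nonempty A]
    (hX : ∃ d, HasCoveringExponent X d) (hXA : ∃ d, HasCoveringExponent (X × A) d) (hK : 1 ≤ K)
    (hH : 1 ≤ H) (hLr : 0 < Lr) (hLp : 0 ≤ Lp) (hδ : 0 < δ) (hδ1 : δ ≤ 1)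
    (hσ : lipQ H Lr Lp * κ.σ ≤ 2 * H)
    (hM : M.IsLipschitz K H Lr Lp) (hT : T.IsInteraction M K H μ) :
    μ.real (eventBernstein κ M T K H Lr Lp δ)ᶜ ≤ δ := by
  have hK0 : (0 : ℝ) < K := by exact_mod_cast hK
  have hH1 : (1 : ℝ) ≤ H := by exact_mod_cast hH
  have hH0 : (0 : ℝ) < H := by linarith
  have hs := κ.σ_pos
  have hβ := κ.β_pos
  have hC₂ := κ.C₂_pos
  have hQ := lipQ_pos hLr hLp hH
  obtain ⟨N, hN, hNc, hNcov⟩ := exists_bandwidth_net (κ := κ) hX hH hLr hLp hσ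
  obtain ⟨C, hC, hcov⟩ := exists_net hXA (ε := κ.σ ^ (2 + coveringDim X) / (H ^ 2 * K))
    (by positivity)
  have hNm : ∀ g ∈ N, Measurable g := fun g hg => boundedLipschitz_measurable (hN g hg)
  -- The choice t = 1/B² with B = 2H is admissible since 2tB = 1/H ≤ 1. It turns the variance bound
  -- 2H P|f| into P|f|/(2H) and L/t into 4H²L.
  have hE := measureReal_bernstein_net_le (μ := μ) (κ := κ) (T := T) (K := K) (H := H) N C
    (Z := fun _ h g s ω => g (T.x s (h + 1) ω))
    (m := fun _ h g s u => ∫ y, g y ∂(M.P s h u))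
    (v := fun _ h g s u => ∫ y, g y ^ 2 ∂(M.P s h u)) (B := 2 * H) (δ := δ)
    (t := 1 / (2 * H) ^ 2) (by positivity)
    (by rw [div_mul_eq_mul_div, div_le_one (by positivity)]; nlinarith)
    (fun k hk h hh g hg v _ => hT.isWeightedNoise_next hk hh v (hNm g hg) (by linarith) (hN g hg).2)
    (fun k hk h hh g hg s hs => hT.condExp_next (mem_Icc_of_mem_Ico hk hs) hh
      ((hNm g hg).pow_const 2) (B := (2 * H) ^ 2) (fun x => by
        rw [abs_pow]; exact pow_le_pow_left₀ (abs_nonneg _) ((hN g hg).2 x) 2))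
    (fun k h g s hg => M.measurable_integral s h ((hNm g hg).pow_const 2))
    (fun k h g s u hg => M.sq_integral_le s h u (hNm g hg) (hN g hg).2) hNc hδ
  refine measureReal_compl_le_of_ae hE (ae_of_all _ fun ω hgood u k hk h hh f hf => ?_)
  obtain ⟨v, hv, huv⟩ := hcov u
  obtain ⟨g, hg, hfg⟩ := hNcov f hf
  have h0 := hgood k hk h hh g hg v hv
  rw [hC] at h0
  obtain ⟨hL0, hLle⟩ := logB_bound (κ := κ) (k := k) hXA hK hH hLr hLp hδ hδ1 hσ
  have hsq : ∀ x, |g x ^ 2| ≤ (2 * (H : ℝ)) ^ 2 := fun x => by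
    rw [abs_pow]; exact pow_le_pow_left₀ (abs_nonneg _) ((hN g hg).2 x) 2
  have h1 := abs_weightedDeviation_le_of_bernstein (κ := κ) (T := T) hk h
    (Z := fun s => g (T.x s (h + 1) ω)) (m := fun s u => ∫ y, g y ∂(M.P s h u))
    (v := fun s u => ∫ y, g y ^ 2 ∂(M.P s h u)) (B := 2 * H) huv (by linarith)
    (fun s => (hN g hg).2 _) (fun s u => M.abs_integral_le s h u (hNm g hg) (hN g hg).2)
    (fun s u => (abs_le.1 (M.abs_integral_le s h u ((hNm g hg).pow_const 2) hsq)).2) h0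
    (fun s u => M.sq_integral_le s h u (hNm g hg) (hN g hg).2)
  have h2 := sum_weight_mul_variance_le (κ := κ) (T := T) hX hM hLr.le hLp hk hh (hN g hg) u ω
  have h3 := abs_estP_sub_avP_le (κ := κ) (T := T) hM hX hLp hk hh
    (mul_nonneg zero_le_two hQ.le) (hN g hg) u ω
  have h4 := abs_estP_sub_avP_sub_le (κ := κ) (T := T) (M := M) (k := k) (h := h)
    (boundedLipschitz_measurable hf) (hNm g hg) hf.2 (hN g hg).2 hfg u ω
  have h5 := abs_sub_abs_le_abs_sub (estP κ T k h f u ω - avP κ M T k h f u ω)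
    (estP κ T k h g u ω - avP κ M T k h g u ω)
  have hpow : κ.σ ^ (2 + coveringDim X) = κ.σ ^ (1 + coveringDim X) * κ.σ := by
    rw [← Real.rpow_add_one hs.ne']; congr 1; ring
  -- Multiplied by 2B = 4H and divided by the count this is at most the middle term of θ³; the other
  -- two terms of θ³ are slack.
  have e : (K : ℝ) * (κ.C₂ * (κ.σ ^ (2 + coveringDim X) / (H ^ 2 * K) / κ.σ))
      = κ.C₂ * κ.σ ^ (1 + coveringDim X) / H ^ 2 := by rw [hpow]; field_simp
  rw [e] at h1
  have hCu := count_pos (κ := κ) (T := T) k h u ω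
  have hβC := β_le_count (κ := κ) (T := T) k h u ω
  have hb := biasP_nonneg (κ := κ) (M := M) (H := H) (k := k) (h := h) hX hLr.le hLp
  have hℓ : 0 ≤ spatialFactor κ k := add_nonneg zero_le_one (Real.sqrt_nonneg _)
  have hσd : 0 < κ.σ ^ (1 + coveringDim X) := Real.rpow_pos_of_pos hs _
  set Cu := count κ T k h u ω
  set Q := lipQ H Lr Lp
  set b := biasP κ M H Lr Lp k h
  set ℓ := spatialFactor κ k
  set LB := logB X A κ K H Lr Lp k δ
  set σd := κ.σ ^ (1 + coveringDim X)
  set ag := ∫ y, |g y| ∂(M.P k h u)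
  set af := ∫ y, |f y| ∂(M.P k h u)
  have hagf : ag ≤ af + 8 * Q * κ.σ := by
    have := M.markov k h
    have i1 := (integrable_of_bounded (boundedLipschitz_measurable hf) hf.2 (M.P k h u)).abs
    have i2 := (integrable_of_bounded (hNm g hg) (hN g hg).2 (M.P k h u)).abs
    calc ag ≤ ∫ y, (|f y| + 8 * Q * κ.σ) ∂(M.P k h u) :=
          integral_mono i2 (i1.add (integrable_const _)) fun y => by
            have a1 := hfg y
            have a2 := abs_sub_abs_le_abs_sub (g y) (f y)
            rw [abs_sub_comm] at a2
            show |g y| ≤ |f y| + 8 * Q * κ.σ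
            linarith
      _ = _ := by rw [integral_add i1 (integrable_const _)]; simp [af]
  have haf : 0 ≤ af := integral_nonneg fun y => abs_nonneg _
  -- the noise at `u`, divided by the count
  have h6 : |weightedDeviation κ T k h (fun s => g (T.x s (h + 1) ω))
      (fun s u => ∫ y, g y ∂(M.P s h u)) u ω| / Cu
      ≤ 4 * H ^ 2 * LB / Cu + 1 / (2 * H) * (ag + 2 * b + 4 * Lp * Q * ℓ * κ.σ)
        + 4 * κ.C₂ * σd / (H * κ.β) := by
    have a1 := h1.trans (add_le_add (add_le_add
      (div_le_div_of_nonneg_right hLle (by positivity))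
      (mul_le_mul_of_nonneg_left h2 (by positivity))) le_rfl)
    rw [div_le_iff₀ hCu]
    refine a1.trans ?_
    have a2 : 2 * (2 * (H : ℝ)) * (κ.C₂ * σd / H ^ 2) ≤ 4 * κ.C₂ * σd / (H * κ.β) * Cu := by
      have : 2 * (2 * (H : ℝ)) * (κ.C₂ * σd / H ^ 2) = 4 * κ.C₂ * σd / (H * κ.β) * κ.β := by
        field_simp; ring
      rw [this]
      exact mul_le_mul_of_nonneg_left hβC (by positivity)
    have a3 : LB / (1 / (2 * (H : ℝ)) ^ 2) = 4 * H ^ 2 * LB / Cu * Cu := by field_simp; ring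
    have a4 : 1 / (2 * (H : ℝ)) ^ 2 * (Cu * (2 * H * (ag + 2 * b + 4 * Lp * Q * ℓ * κ.σ)))
        = 1 / (2 * H) * (ag + 2 * b + 4 * Lp * Q * ℓ * κ.σ) * Cu := by field_simp
    rw [a3, a4]
    linarith
  have hHinv : 1 / (H : ℝ) ≤ 1 := (div_le_one hH0).2 hH1
  have hHinv0 : 0 < 1 / (H : ℝ) := by positivity
  -- Returning from g to f inside the integral costs 8L_Qσ, which with the 16L_Qσ from the
  -- estimators stays below the 32L_Qσ of θ⁴. The 2L_pL_Qℓσ from the variance and the 4L_pL_Qℓσ of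
  -- the spatial bias make up its 6L_pL_Qℓσ.
  have h7 : 1 / (2 * (H : ℝ)) * (ag + 2 * b + 4 * Lp * Q * ℓ * κ.σ)
      ≤ 1 / H * af + 2 / H * b + (8 * Q + 2 * Lp * Q * ℓ) * κ.σ := by
    have a1 : 1 / (2 * (H : ℝ)) * (ag + 2 * b + 4 * Lp * Q * ℓ * κ.σ)
        = 1 / H * (ag / 2 + b + 2 * Lp * Q * ℓ * κ.σ) := by
      field_simp; ring
    have a2 : ag / 2 ≤ af + 8 * Q * κ.σ := by
      have : 0 ≤ 8 * Q * κ.σ := by positivity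
      linarith
    have a3 : 0 ≤ (8 * Q + 2 * Lp * Q * ℓ) * κ.σ := by positivity
    have a4 := mul_le_mul_of_nonneg_right hHinv a3
    have a5 := mul_nonneg hHinv0.le hb
    have a6 := mul_le_mul_of_nonneg_left a2 hHinv0.le
    have a7 : 2 / (H : ℝ) * b = 2 * (1 / H * b) := by ring
    rw [a1, a7]
    linarith
  have h8 : 4 * H ^ 2 * LB / Cu ≤ 14 * H ^ 2 * LB / Cu := by
    refine div_le_div_of_nonneg_right ?_ hCu.le
    have : 0 ≤ H ^ 2 * LB := by positivity
    linarith
  have h9 : 4 * κ.C₂ * σd / (H * κ.β) ≤ θ₃ X A κ K H Lr Lp k δ * σd := by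
    have a1 : 0 ≤ 2 * Lp * Q * κ.σ / (H ^ 2 * K) := by positivity
    have a2 : 0 ≤ 14 * LB * κ.C₂ / κ.β ^ 2 := by positivity
    have a3 : 4 * κ.C₂ * σd / (H * κ.β) = 4 * κ.C₂ / (H * κ.β) * σd := by ring
    rw [a3, θ₃]
    exact mul_le_mul_of_nonneg_right (by linarith) hσd.le
  have h10 : (14 * H ^ 2 * LB + 2 * κ.β * H) / Cu
      = 14 * H ^ 2 * LB / Cu + κ.β * (2 * H) / Cu := by ring
  rw [θ₄, h10]
  have h11 : 0 ≤ Q * κ.σ := by positivity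
  linarith

end BernsteinEvent

/-! ### Measurability of the events -/

section Measurability

/-- For each ω the inequality holds on a closed set of points, so a countable dense set of points
decides it. -/
lemma measurableSet_forall_le {Ω Z : Type*} [MeasurableSpace Ω] [MetricSpace Z] {D : Set Z}
    (hDc : D.Countable) (hD : Dense D) {F G : Z → Ω → ℝ} (hF : ∀ ω, Continuous fun z => F z ω)
    (hG : ∀ ω, Continuous fun z => G z ω) (hFm : ∀ z, Measurable (F z))
    (hGm : ∀ z, Measurable (G z)) : MeasurableSet {ω | ∀ z, F z ω ≤ G z ω} := by
  have e : {ω | ∀ z, F z ω ≤ G z ω} = ⋂ z ∈ D, {ω | F z ω ≤ G z ω} := by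
    ext ω
    simp only [mem_ofPred_eq, mem_iInter]
    refine ⟨fun h z _ => h z, fun h z => ?_⟩
    have hcl : IsClosed {z | F z ω ≤ G z ω} := isClosed_le (hF ω) (hG ω)
    exact hcl.closure_subset_iff.2 (fun z hz => h z hz) (hD z)
  rw [e]
  exact MeasurableSet.biInter hDc fun z _ => measurableSet_le (hFm z) (hGm z)

variable {Ω X A : Type*} [MeasurableSpace Ω] {μ : Measure Ω} [IsProbabilityMeasure μ]
  [MetricSpace X] [MeasurableSpace X] [BorelSpace X] [MeasurableSpace A]
  [MetricSpace (X × A)] [OpensMeasurableSpace (X × A)]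
  {κ : KernelSpec} {M : MDP X A} {T : Trajectory Ω X A} {K H k h : ℕ} {Lr Lp δ : ℝ}

lemma continuous_normWeight (k h s : ℕ) (ω : Ω) : Continuous fun u => normWeight κ T k h s u ω :=
  (continuous_weight k h s ω).div (continuous_count k h ω) fun u => (count_pos k h u ω).ne'

lemma Trajectory.IsInteraction.measurable_weight (hT : T.IsInteraction M K H μ) (hh : 1 ≤ h)
    (k s : ℕ) (u : X × A) : Measurable fun ω => weight κ T k h s u ω :=
  (measurable_weight_history hh k s u).mono (hT.history_le s h) le_rfl

lemma Trajectory.IsInteraction.measurable_count (hT : T.IsInteraction M K H μ) (hh : 1 ≤ h)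
    (k : ℕ) (u : X × A) : Measurable fun ω => count κ T k h u ω :=
  measurable_const.add (Finset.measurable_fun_sum _ fun s _ => hT.measurable_weight hh k s u)

lemma Trajectory.IsInteraction.measurable_normWeight (hT : T.IsInteraction M K H μ) (hh : 1 ≤ h)
    (k s : ℕ) (u : X × A) : Measurable fun ω => normWeight κ T k h s u ω :=
  (hT.measurable_weight hh k s u).div (hT.measurable_count hh k u)

lemma continuous_estimate (k h : ℕ) (Z : ℕ → ℝ) (ω : Ω) :
    Continuous fun u => ∑ s ∈ Finset.Ico 1 k, normWeight κ T k h s u ω * Z s :=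
  continuous_finsetSum _ fun s _ => (continuous_normWeight k h s ω).mul continuous_const

lemma continuous_average (hk : k ∈ Finset.Icc 1 K) (h : ℕ) {m : ℕ → X × A → ℝ}
    (hm : ∀ s ∈ Finset.Icc 1 K, Continuous (m s)) (ω : Ω) :
    Continuous fun u => ∑ s ∈ Finset.Ico 1 k, normWeight κ T k h s u ω * m s u
      + κ.β * m k u / count κ T k h u ω :=
  (continuous_finsetSum _ fun s hs =>
    (continuous_normWeight k h s ω).mul (hm s (mem_Icc_of_mem_Ico hk hs))).add
    ((continuous_const.mul (hm k hk)).div (continuous_count k h ω) fun u => (count_pos k h u ω).ne')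

lemma Trajectory.IsInteraction.measurable_estimate (hT : T.IsInteraction M K H μ) (hh : 1 ≤ h)
    (k : ℕ) {Z : ℕ → Ω → ℝ} (hZ : ∀ s, Measurable (Z s)) (u : X × A) :
    Measurable fun ω => ∑ s ∈ Finset.Ico 1 k, normWeight κ T k h s u ω * Z s ω :=
  Finset.measurable_fun_sum _ fun s _ => (hT.measurable_normWeight hh k s u).mul (hZ s)

lemma Trajectory.IsInteraction.measurable_average (hT : T.IsInteraction M K H μ) (hh : 1 ≤ h)
    (k : ℕ) (m : ℕ → X × A → ℝ) (u : X × A) :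
    Measurable fun ω => ∑ s ∈ Finset.Ico 1 k, normWeight κ T k h s u ω * m s u
      + κ.β * m k u / count κ T k h u ω :=
  (Finset.measurable_fun_sum _ fun s _ =>
    (hT.measurable_normWeight hh k s u).mul measurable_const).add
    (measurable_const.div (hT.measurable_count hh k u))

lemma continuous_const_div_count (k h : ℕ) (c : ℝ) (ω : Ω) :
    Continuous fun u => c / count κ T k h u ω :=
  continuous_const.div (continuous_count k h ω) fun u => (count_pos k h u ω).ne'

lemma measurableSet_forall_forall_forall {P : X × A → ℕ → ℕ → Ω → Prop}
    (hP : ∀ k ∈ Finset.Icc 1 K, ∀ h ∈ Finset.Icc 1 H, MeasurableSet {ω | ∀ u, P u k h ω}) :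
    MeasurableSet {ω | ∀ u : X × A, ∀ k ∈ Finset.Icc 1 K, ∀ h ∈ Finset.Icc 1 H, P u k h ω} := by
  have e : {ω | ∀ u : X × A, ∀ k ∈ Finset.Icc 1 K, ∀ h ∈ Finset.Icc 1 H, P u k h ω}
      = ⋂ k ∈ Finset.Icc 1 K, ⋂ h ∈ Finset.Icc 1 H, {ω | ∀ u, P u k h ω} := by
    ext ω
    simp only [mem_ofPred_eq, mem_iInter]
    exact ⟨fun h k hk l hl u => h u k hk l hl, fun h u k hk l hl => h k hk l hl u⟩
  rw [e]
  exact Finset.measurableSet_biInter _ fun k hk => Finset.measurableSet_biInter _ fun h hh =>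
    hP k hk h hh

lemma measurableSet_eventReward (hXA : ∃ d, HasCoveringExponent (X × A) d)
    (hM : M.IsLipschitz K H Lr Lp) (hT : T.IsInteraction M K H μ) :
    MeasurableSet (eventReward κ M T K H Lr δ) := by
  obtain ⟨D, hDc, hD⟩ := exists_countable_dense hXA
  refine measurableSet_forall_forall_forall fun k hk h hh => ?_
  have hh1 := (Finset.mem_Icc.1 hh).1
  refine measurableSet_forall_le hDc hD
    (fun ω => ((continuous_estimate k h (fun s => T.rew s h ω) ω).sub
      (continuous_average hk h (m := fun s => M.r s h) (fun s hs =>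
        continuous_of_abs_sub_le (hM.reward s hs h hh)) ω)).abs)
    (fun ω => ((continuous_const_div_count k h _ ω).sqrt.add
      (continuous_const_div_count k h _ ω)).add continuous_const)
    (fun u => ?_) (fun u => ?_)
  · exact ((hT.measurable_estimate hh1 k (fun s => hT.measurable_rew s h) u).sub
      (hT.measurable_average hh1 k (fun s => M.r s h) u)).abs
  · have := hT.measurable_count (κ := κ) hh1 k u
    fun_prop

lemma continuous_abs_estP_sub_avP (hX : ∃ d, HasCoveringExponent X d)
    (hM : M.IsLipschitz K H Lr Lp) (hk : k ∈ Finset.Icc 1 K) (hh : h ∈ Finset.Icc 1 H) {L B : ℝ}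
    (hL : 0 ≤ L) {f : X → ℝ} (hf : f ∈ boundedLipschitz X L B) (ω : Ω) :
    Continuous fun u => |estP κ T k h f u ω - avP κ M T k h f u ω| :=
  ((continuous_estimate k h (fun s => f (T.x s (h + 1) ω)) ω).sub
    (continuous_average hk h (m := fun s u => ∫ y, f y ∂(M.P s h u)) (fun _ hs =>
      continuous_of_abs_sub_le (hM.abs_integral_sub_le hX hs hh hL hf.1)) ω)).abs

lemma Trajectory.IsInteraction.measurable_abs_estP_sub_avP (hT : T.IsInteraction M K H μ)
    (hh : 1 ≤ h) (k : ℕ) {f : X → ℝ} (hf : Measurable f) (u : X × A) :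
    Measurable fun ω => |estP κ T k h f u ω - avP κ M T k h f u ω| :=
  ((hT.measurable_estimate hh k (fun s => hf.comp (hT.measurable_x s (h + 1))) u).sub
    (hT.measurable_average hh k (fun s u => ∫ y, f y ∂(M.P s h u)) u)).abs

lemma measurableSet_eventOptimalValue [Nonempty A]
    (hdist : ∀ (x x' : X) (a : A), dist (x, a) (x', a) ≤ dist x x')
    (hX : ∃ d, HasCoveringExponent X d)
    (hXA : ∃ d, HasCoveringExponent (X × A) d) (hLr : 0 ≤ Lr) (hLp : 0 ≤ Lp)
    (hM : M.IsLipschitz K H Lr Lp) (hT : T.IsInteraction M K H μ) :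
    MeasurableSet (eventOptimalValue κ M T K H Lr Lp δ) := by
  obtain ⟨D, hDc, hD⟩ := exists_countable_dense hXA
  refine measurableSet_forall_forall_forall fun k hk h hh => ?_
  have hh1 := (Finset.mem_Icc.1 hh).1
  have hV := hM.optimalValue_mem hdist hX hLr hLp hk (h := h + 1) (by omega)
  refine measurableSet_forall_le hDc hD
    (continuous_abs_estP_sub_avP hX hM hk hh (lipQ_nonneg hLr hLp H) hV)
    (fun ω => ((continuous_const_div_count k h _ ω).sqrt.add
      (continuous_const_div_count k h _ ω)).add continuous_const)
    (hT.measurable_abs_estP_sub_avP hh1 k (boundedLipschitz_measurable hV)) (fun u => ?_)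
  have := hT.measurable_count (κ := κ) hh1 k u
  fun_prop

/-- Measurability of a bound that holds simultaneously for all functions of the class. -/
lemma measurableSet_forall_boundedLipschitz (hX : ∃ d, HasCoveringExponent X d)
    (hXA : ∃ d, HasCoveringExponent (X × A) d) (hM : M.IsLipschitz K H Lr Lp)
    (hT : T.IsInteraction M K H μ) (hk : k ∈ Finset.Icc 1 K)
    (hh : h ∈ Finset.Icc 1 H) {L B c : ℝ} (hL : 0 ≤ L) (hB : 0 < B) (hc : 0 ≤ c)
    {R : X × A → Ω → ℝ} (hR : ∀ ω, Continuous fun u => R u ω) (hRm : ∀ u, Measurable (R u)) :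
    MeasurableSet {ω | ∀ u, ∀ f ∈ boundedLipschitz X L B,
      |estP κ T k h f u ω - avP κ M T k h f u ω| ≤ c * (∫ y, |f y| ∂(M.P k h u)) + R u ω} := by
  obtain ⟨D, hDc, hD⟩ := exists_countable_dense hXA
  obtain ⟨N, hNc, hNF, hN⟩ := exists_countable_dense_boundedLipschitz hX hL hB
  have hh1 := (Finset.mem_Icc.1 hh).1
  have e : {ω | ∀ u, ∀ f ∈ boundedLipschitz X L B,
      |estP κ T k h f u ω - avP κ M T k h f u ω| ≤ c * (∫ y, |f y| ∂(M.P k h u)) + R u ω}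
      = ⋂ g ∈ N, {ω | ∀ u, |estP κ T k h g u ω - avP κ M T k h g u ω|
        ≤ c * (∫ y, |g y| ∂(M.P k h u)) + R u ω} := by
    ext ω
    simp only [mem_ofPred_eq, mem_iInter]
    refine ⟨fun h g hg u => h u g (hNF hg), fun hg u f hf => ?_⟩
    have key : ∀ ε > 0, |estP κ T k h f u ω - avP κ M T k h f u ω|
        ≤ c * (∫ y, |f y| ∂(M.P k h u)) + R u ω + (2 + c) * ε := by
      intro ε hε
      obtain ⟨g, hgN, hfg⟩ := hN f hf ε hε
      have hgF := hNF hgN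
      have h1 := abs_estP_sub_avP_sub_le (κ := κ) (T := T) (M := M) (k := k) (h := h)
        (boundedLipschitz_measurable hf)
        (boundedLipschitz_measurable hgF) hf.2 hgF.2 hfg u ω
      have h2 := abs_sub_abs_le_abs_sub (estP κ T k h f u ω - avP κ M T k h f u ω)
        (estP κ T k h g u ω - avP κ M T k h g u ω)
      have h3 := hg g hgN u
      have h4 : ∫ y, |g y| ∂(M.P k h u) ≤ (∫ y, |f y| ∂(M.P k h u)) + ε := by
        have := M.markov k h
        have i1 := (integrable_of_bounded (boundedLipschitz_measurable hf) hf.2 (M.P k h u)).abs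
        have i2 := (integrable_of_bounded (boundedLipschitz_measurable hgF) hgF.2 (M.P k h u)).abs
        calc _ ≤ ∫ y, (|f y| + ε) ∂(M.P k h u) :=
              integral_mono i2 (i1.add (integrable_const _)) fun y => by
                have a1 := hfg y
                have a2 := abs_sub_abs_le_abs_sub (g y) (f y)
                rw [abs_sub_comm] at a2
                show |g y| ≤ |f y| + ε
                linarith
          _ = _ := by rw [integral_add i1 (integrable_const _)]; simp
      have h5 := mul_le_mul_of_nonneg_left h4 hc
      linarith
    -- An approximation within ε moves the estimation error by 2ε and the integral term by cε.
    refine le_of_forall_pos_le_add fun ε hε => (key (ε / (2 + c)) (by positivity)).trans ?_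
    rw [mul_div_cancel₀ _ (by positivity)]
  rw [e]
  refine MeasurableSet.biInter hNc fun g hg => measurableSet_forall_le hDc hD
    (continuous_abs_estP_sub_avP hX hM hk hh hL (hNF hg)) (fun ω => ?_)
    (hT.measurable_abs_estP_sub_avP hh1 k (boundedLipschitz_measurable (hNF hg))) (fun u => ?_)
  · exact (continuous_const.mul (continuous_of_abs_sub_le (hM.abs_integral_sub_le hX hk hh hL
      (boundedLipschitz_abs (hNF hg)).1))).add (hR ω)
  · exact measurable_const.add (hRm u)

lemma measurableSet_eventUniform (hX : ∃ d, HasCoveringExponent X d)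
    (hXA : ∃ d, HasCoveringExponent (X × A) d) (hLr : 0 ≤ Lr) (hLp : 0 ≤ Lp) (hH : 1 ≤ H)
    (hM : M.IsLipschitz K H Lr Lp) (hT : T.IsInteraction M K H μ) :
    MeasurableSet (eventUniform κ M T K H Lr Lp δ) := by
  have hH0 : (0 : ℝ) < H := by exact_mod_cast hH
  refine measurableSet_forall_forall_forall fun k hk h hh => ?_
  -- This width has no integral term, hence c = 0.
  have := measurableSet_forall_boundedLipschitz (κ := κ) (c := 0) hX hXA hM hT hk hh
    (mul_nonneg zero_le_two (lipQ_nonneg hLr hLp H)) (mul_pos two_pos hH0) le_rfl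
    (R := fun u ω => √(8 * H ^ 2 * logUnif X A κ K H Lr Lp k δ / count κ T k h u ω)
        + 2 * κ.β * H / count κ T k h u ω
        + θ₁ X A κ K H Lr Lp k δ * κ.σ ^ (1 + coveringDim X / 2)
        + θ₂ κ H Lr Lp k * κ.σ)
    (fun ω => (((continuous_const_div_count k h _ ω).sqrt.add
      (continuous_const_div_count k h _ ω)).add continuous_const).add continuous_const)
    (fun u => by
      have := hT.measurable_count (κ := κ) (Finset.mem_Icc.1 hh).1 k u
      fun_prop)
  simpa only [zero_mul, zero_add] using this

lemma measurableSet_eventBernstein (hX : ∃ d, HasCoveringExponent X d)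
    (hXA : ∃ d, HasCoveringExponent (X × A) d) (hLr : 0 ≤ Lr) (hLp : 0 ≤ Lp) (hH : 1 ≤ H)
    (hM : M.IsLipschitz K H Lr Lp) (hT : T.IsInteraction M K H μ) :
    MeasurableSet (eventBernstein κ M T K H Lr Lp δ) := by
  have hH0 : (0 : ℝ) < H := by exact_mod_cast hH
  refine measurableSet_forall_forall_forall fun k hk h hh => ?_
  have := measurableSet_forall_boundedLipschitz (κ := κ) (c := 1 / H) hX hXA hM hT hk hh
    (mul_nonneg zero_le_two (lipQ_nonneg hLr hLp H)) (mul_pos two_pos hH0) (by positivity)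
    (R := fun u ω => (14 * H ^ 2 * logB X A κ K H Lr Lp k δ + 2 * κ.β * H) / count κ T k h u ω
        + θ₃ X A κ K H Lr Lp k δ * κ.σ ^ (1 + coveringDim X)
        + θ₄ κ H Lr Lp k * κ.σ
        + 2 / H * biasP κ M H Lr Lp k h)
    (fun ω => (((continuous_const_div_count k h _ ω).add continuous_const).add
      continuous_const).add continuous_const)
    (fun u => by
      have := hT.measurable_count (κ := κ) (Finset.mem_Icc.1 hh).1 k u
      fun_prop)
  simpa only [← add_assoc] using this

end Measurability

end KernelRL

/-! ### Assembly of the four events -/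

theorem mainTheorem1 {Ω X A : Type*} [MeasurableSpace Ω] (μ : Measure Ω) [IsProbabilityMeasure μ]
    [MetricSpace X] [MeasurableSpace X] [BorelSpace X] [MeasurableSpace A]
    [MetricSpace (X × A)] [OpensMeasurableSpace (X × A)]
    (hdist : ∀ (x x' : X) (a : A), dist (x, a) (x', a) ≤ dist x x')
    (hX : ∃ d, KernelRL.HasCoveringExponent X d)
    (hXA : ∃ d, KernelRL.HasCoveringExponent (X × A) d)
    (K H : ℕ) (Lr Lp δ : ℝ) (hLr : 0 < Lr) (hLp : 0 ≤ Lp) (hδ : 0 < δ)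
    (κ : KernelRL.KernelSpec) (hσ : KernelRL.lipQ H Lr Lp * κ.σ ≤ 2 * H)
    (M : KernelRL.MDP X A) (hM : M.IsLipschitz K H Lr Lp)
    (T : KernelRL.Trajectory Ω X A) (hT : T.IsInteraction M K H μ) :
    MeasurableSet (KernelRL.goodEvent κ M T K H Lr Lp δ) ∧
      1 - δ / 2 ≤ μ.real (KernelRL.goodEvent κ M T K H Lr Lp δ) := by
  have hΩ : Nonempty Ω := nonempty_of_isProbabilityMeasure μ
  have : Nonempty X := ⟨T.x 0 0 hΩ.some⟩
  have : Nonempty A := ⟨T.a 0 0 hΩ.some⟩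
  by_cases h0 : 1 ≤ K ∧ 1 ≤ H
  swap
  -- Without episodes or steps all conditions are vacuous.
  · have huniv : KernelRL.goodEvent κ M T K H Lr Lp δ = Set.univ := by
      refine Set.eq_univ_of_forall fun ω => ?_
      have hempty : ∀ k ∈ Finset.Icc 1 K, ∀ h ∈ Finset.Icc 1 H, False := fun k hk h hh => by
        rw [Finset.mem_Icc] at hk hh; omega
      exact ⟨⟨⟨fun u k hk h hh => (hempty k hk h hh).elim,
        fun u k hk h hh => (hempty k hk h hh).elim⟩,
        fun u k hk h hh => (hempty k hk h hh).elim⟩,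
        fun u k hk h hh => (hempty k hk h hh).elim⟩
    rw [huniv]
    refine ⟨MeasurableSet.univ, ?_⟩
    rw [probReal_univ]; linarith
  obtain ⟨hK, hH⟩ := h0
  have m1 := KernelRL.measurableSet_eventReward (κ := κ) (δ := δ / 8) hXA hM hT
  have m2 := KernelRL.measurableSet_eventOptimalValue (κ := κ) (δ := δ / 8) hdist hX hXA hLr.le hLp
    hM hT
  have m3 := KernelRL.measurableSet_eventUniform (κ := κ) (δ := δ / 8) hX hXA hLr.le hLp hH hM hT
  have m4 := KernelRL.measurableSet_eventBernstein (κ := κ) (δ := δ / 8) hX hXA hLr.le hLp hH hM hT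
  have hmeas : MeasurableSet (KernelRL.goodEvent κ M T K H Lr Lp δ) :=
    ((m1.inter m2).inter m3).inter m4
  refine ⟨hmeas, ?_⟩
  -- For δ ≥ 2 the lower bound is not positive. Otherwise δ/8 ≤ 1, as the Bernstein event requires.
  rcases le_or_gt 2 δ with hδ2 | hδ2
  · exact le_trans (by linarith) measureReal_nonneg
  have hδ8 : 0 < δ / 8 := by linarith
  have p1 := KernelRL.measureReal_compl_eventReward_le (κ := κ) hXA hK hLr.le hδ8 hM hT
  have p2 := KernelRL.measureReal_compl_eventOptimalValue_le (κ := κ) hdist hX hXA hK hH hLr.le hLp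
    hδ8 hM hT
  have p3 := KernelRL.measureReal_compl_eventUniform_le (κ := κ) hX hXA hK hH hLr hLp hδ8 hσ hM hT
  have p4 := KernelRL.measureReal_compl_eventBernstein_le (κ := κ) hX hXA hK hH hLr hLp hδ8
    (by linarith) hσ hM hT
  have hcompl : μ.real (KernelRL.goodEvent κ M T K H Lr Lp δ)ᶜ ≤ δ / 2 := by
    rw [KernelRL.goodEvent, Set.compl_inter, Set.compl_inter, Set.compl_inter]
    have u1 := measureReal_union_le (μ := μ)
      (((KernelRL.eventReward κ M T K H Lr (δ / 8))ᶜ ∪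
        (KernelRL.eventOptimalValue κ M T K H Lr Lp (δ / 8))ᶜ) ∪
        (KernelRL.eventUniform κ M T K H Lr Lp (δ / 8))ᶜ)
      (KernelRL.eventBernstein κ M T K H Lr Lp (δ / 8))ᶜ
    have u2 := measureReal_union_le (μ := μ)
      ((KernelRL.eventReward κ M T K H Lr (δ / 8))ᶜ ∪
        (KernelRL.eventOptimalValue κ M T K H Lr Lp (δ / 8))ᶜ)
      (KernelRL.eventUniform κ M T K H Lr Lp (δ / 8))ᶜ
    have u3 := measureReal_union_le (μ := μ) (KernelRL.eventReward κ M T K H Lr (δ / 8))ᶜ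
      (KernelRL.eventOptimalValue κ M T K H Lr Lp (δ / 8))ᶜ
    linarith
  rw [probReal_compl_eq_one_sub hmeas] at hcompl
  linarith
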